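/- Fix $T>0$ and let $\Omega_T=\{(x,y,t):x\in\mathbb R,\ y>0,\ 0<t<T\}$. For $k\in\mathbb C$ write $k=k_R+ik_I$. Put $\partial_x^{-1}f(x)=\int_{-\infty}^xf(\xi)\,d\xi$ (convergent improper integral). All functions are complex valued. The KPII equation is $$q_t+6qq_x+q_{xxx}+3\,\partial_x^{-1}q_{yy}=0 ,\qquad (x,y,t)\in\Omega_T .\tag{KPII}$$ **Data.** Let $u$ be a classical solution of (KPII) which is $C^3$ on $\overline{\Omega_T}$, tends to $0$ as $|x|\to\infty$ and as $y\to\infty$, and is integrable over the half-plane for each $t$. Let $q_0(x,y)=u(x,y,0)$ be a Schwartz function on $\mathbb R\times[0,\infty)$, $g(x,t)=u(x,0,t)$, $h(x,t)=u_y(x,0,t)$, where $h(\cdot,t)\in L^1(\mathbb R)$ for each $t\in[0,T]$ and $g,\ g_x,\ \partial_x^{-1}h\in L^1(\mathbb R\times(0,T))$. Let $$H(x,t,k,l)=3\big[g_x(x,t)-2i(l+k)g(x,t)-\partial_x^{-1}h(x,t)\big],\quad \omega(k,l)=4il(l^2+3kl+3k^2),$$ $$E(x,y,t,k,l)=e^{ilx-l(l+2k)y+\omega(k,l)t},\qquad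 e_\lambda(x,y,t,k_R,\lambda)=E(x,y,t,k_R,-\lambda-2k_R).$$ Let $O(k_R)=\{l\in\mathbb R:l(l+2k_R)\ge0\}$ and $I(k_R)=\{l\in\mathbb R:l(l+2k_R)\le0\}$. A function on the closed upper (lower) half $k$-plane carries the superscript $+$ ($-$); its restriction to $k_R\le0$ is given the index $1$, its restriction to $k_R\ge0$ the index $2$. The $+$ and $-$ functions may differ on the real axis. Let $\rho^+(x,y,k)$ ($k_I\ge 0$) and $\rho^-(x,y,k),\ \varphi^-(x,t,k)$ ($k_I\le 0$) be bounded and continuous for $x\in\mathbb R$, $y>0$, $0<t<T$, and solve (the first integral in the equation for $\varphi^-$ converging absolutely in $l$) $$\rho^{+}=1+\tfrac1{2\pi}\int_{O(k_R)}\!\!dl\int_{\mathbb R}\!d\xi\int_0^y\!d\eta\,e^{-il(\xi-x)+l(l+2k)(\eta-y)}q_0\rho^{+}-\tfrac1{2\pi}\int_{I(k_R)}\!\!dl\int_{\mathbb R}\!d\xi\int_y^\infty\!d\eta\,e^{-il(\xi-x)+l(l+2k)(\eta-y)}q_0\rho^{+},$$ the same equation for $\rho^-$ with the additional term $$-\tfrac1{2\pi}\int_{O(k_R)}dl\int_{\mathbb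 R}d\xi\int_0^Td\tau\,e^{-il(\xi-x)-l(l+2k)y-\omega(k,l)\tau}H(\xi,\tau,k,l)\varphi^-(\xi,\tau,k)$$ on the right, and $$\varphi^-=1-\tfrac1{2\pi}\int_{O(k_R)}\!\!dl\int_{\mathbb R}\!d\xi\int_t^T\!d\tau\,e^{-il(\xi-x)-\omega(k,l)(\tau-t)}H\varphi^-+\tfrac1{2\pi}\int_{I(k_R)}\!\!dl\int_{\mathbb R}\!d\xi\int_0^t\!d\tau\,e^{-il(\xi-x)-\omega(k,l)(\tau-t)}H\varphi^-$$ $$-\tfrac1{2\pi}\int_{I(k_R)}dl\int_{\mathbb R}d\xi\int_0^\infty d\eta\,e^{-il(\xi-x)+l(l+2k)\eta+\omega(k,l)t}q_0\rho^- .$$ **Global relation.** Assume that for some bounded function $M^-(x,y,t,k)$, $k_I\le0$, continuous in $(x,y)$, and all $0<t<T$, $k_I\le0$, $l(l+2k_R)\le 0$, $$\int_{\mathbb R}\!d\xi\int_0^\infty\! d\eta\,e^{-il\xi+l(l+2k)\eta}q_0\rho^--\int_{\mathbb R}\!d\xi\int_0^t\! d\tau\,e^{-il\xi-\omega(k,l)\tau}H\varphi^-=\int_{\mathbb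 R}\!d\xi\int_0^\infty\! d\eta\,e^{-il\xi+l(l+2k)\eta-\omega(k,l)t}u(\xi,\eta,t)M^-(\xi,\eta,t,k).$$ **Spectral functions.** Put $$\beta^\pm(k)=\tfrac1{2\pi}\int_{\mathbb R}d\xi\int_0^\infty d\eta\,e^{2ik_R\xi-4ik_Rk_I\eta}q_0\rho^\pm(\xi,\eta,k),$$ $$\alpha^-(k)=\tfrac1{2\pi}\int_{\mathbb R}d\xi\int_0^Td\tau\,e^{2ik_R\xi+8ik_R(k_R^2-3k_I^2)\tau}H(\xi,\tau,k,-2k_R)\varphi^-(\xi,\tau,k),$$ $\gamma^+=\beta^+$ and $\gamma^-=\beta^--\alpha^-$ (so that $\gamma_1^\pm,\gamma_2^\pm$ are the restrictions of $\gamma^\pm$ to $k_R\le0$, $k_R\ge0$). Put $$r(k_R,\lambda,l)=\tfrac1{2\pi}\int_{\mathbb R}d\xi\int_0^\infty d\eta\,e^{-il\xi+l(l+2k_R)\eta}q_0(\xi,\eta)\,e_\lambda(\xi,\eta,0,k_R,\lambda)\,\rho^+(\xi,\eta,-k_R-\lambda),$$ written $r_1$ if $-k_R-\lambda\le0$ and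 $r_2$ if $-k_R-\lambda\ge0$, and $$p(k_R,l)=\tfrac1{2\pi}\int_{\mathbb R}d\xi\int_0^Td\tau\,e^{-il\xi-\omega(k_R,l)\tau}H(\xi,\tau,k_R,l)\varphi^-(\xi,\tau,k_R).$$ Assume that for each $k_R\le0$ the system, with $b_2=0$, $b_1=-2k_R$, $$\chi_2(k_R,\lambda)-\int_{-\infty}^{\lambda}\!\chi_2(k_R,l)r_2(k_R,l,-2k_R-\lambda)dl-\int_{-2k_R-\lambda}^\infty\!\chi_1(k_R,l)r_1(k_R,l,-2k_R-\lambda)dl=p(k_R,-2k_R-\lambda),\quad\lambda\le b_2,$$ $$\chi_1(k_R,\lambda)-\int_{-\infty}^{-2k_R-\lambda}\!\chi_2(k_R,l)r_2(k_R,l,-2k_R-\lambda)dl-\int_{\lambda}^\infty\!\chi_1(k_R,l)r_1(k_R,l,-2k_R-\lambda)dl=p(k_R,-2k_R-\lambda),\quad\lambda\ge b_1,$$ has a unique solution $\chi_2(k_R,\cdot)$ on $(-\infty,b_2]$, $\chi_1(k_R,\cdot)$ on $[b_1,\infty)$ among continuous integrable functions; and that for each $k_R\ge0$ the same system with $b_2=-2k_R$,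 $b_1=0$ has a unique such solution, denoted $\psi_2(k_R,\cdot),\psi_1(k_R,\cdot)$. **The function $\mu$.** Consider, for $(x,y,t)\in\Omega_T$ and $k\notin\mathbb R$, the equation for $\mu$, with $\nu=\nu_R+i\nu_I$ and $E=E(x,y,t,\nu,-2\nu_R)$, $$\begin{aligned}\mu(x,y,t,k)=1&+\frac1\pi\int_{-\infty}^0\!d\nu_R\int_0^{i\nu_R}\!\frac{d\nu_I}{\nu-k}\chi_2(\nu,-2i\nu_I)E\,\mu^+_2(-\nu_R,\nu_I)-\frac1\pi\int_0^\infty\! d\nu_R\int_{i\nu_R}^{i\infty}\!\frac{d\nu_I}{\nu-k}\chi_1(\nu,-2i\nu_I)E\,\mu^+_1(-\nu_R,\nu_I)\\&+\frac1\pi\int_{-\infty}^0\!d\nu_R\int_{i\nu_R}^{-i\infty}\!\frac{d\nu_I}{\nu-k}\psi_2(\nu,-2i\nu_I)E\,\mu^+_2(-\nu_R,\nu_I)-\frac1\pi\int_0^\infty\! d\nu_R\int_0^{i\nu_R}\!\frac{d\nu_I}{\nu-k}\psi_1(\nu,-2i\nu_I)E\,\mu^+_1(-\nu_R,\nu_I)\\&+\frac1\pi\int_0^\infty\!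 d\nu_R\int_0^\infty\!\frac{d\nu_I}{\nu-k}\gamma_2^+E\,\mu_1^+(-\nu_R,\nu_I)-\frac1\pi\int_{-\infty}^0\! d\nu_R\int_0^\infty\!\frac{d\nu_I}{\nu-k}\gamma_1^+E\,\mu_2^+(-\nu_R,\nu_I)\\&+\frac1\pi\int_0^\infty\! d\nu_R\int_{-\infty}^0\!\frac{d\nu_I}{\nu-k}\gamma_2^-E\,\mu_1^-(-\nu_R,\nu_I)-\frac1\pi\int_{-\infty}^0\! d\nu_R\int_{-\infty}^0\!\frac{d\nu_I}{\nu-k}\gamma_1^-E\,\mu_2^-(-\nu_R,\nu_I).\end{aligned}$$ Here $\mu^\pm_j(a,b)$ is the value at $x,y,t$ and $k=a+ib$; in the first four terms $\nu_I=is$ with $s$ real, so $\nu=\nu_R-s$ and $-\nu_R+i\nu_I=-\nu_R-s$ are real. Assume that $\gamma^{\pm}(\nu)/(\nu-k)$ over the upper, respectively lower, half-plane, and $\chi_{1,2}/(\nu-k)$, $\psi_{1,2}/(\nu-k)$ over their domains above, are absolutely integrable for every $k\notin\mathbb R$. Assume that for each $(x,y,t)\in\Omega_T$ the equation has a unique solution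 $\mu$ consisting of bounded continuous functions $\mu^\pm$ on the closed upper and lower half-planes. **Smoothness and decay.** Let $$q(x,y,t)=-2i\lim_{k\to\infty}k\,\mu_x(x,y,t,k),\qquad(x,y,t)\in\Omega_T,$$ the limit existing in both closed half-planes. Assume that $\mu^\pm$ are $C^5$ in $(x,y,t)$, that their $(x,y,t)$-derivatives up to order $3$ are continuous in $(x,y,t,k)$, and that, locally uniformly in $(x,y,t)\in\Omega_T$ and for all $k$ in the closed half-plane, $\mu_y,\mu_t,\mu_{xxx}$ are bounded and $\mu-1$, $\mu_{xx}$, $k\mu_x-\tfrac i2q$ are $O\big(1/(1+|k|)\big)$. Assume finally that $q,q_x,q_{xxx},q_t\to0$ as $x\to-\infty$ for fixed $(y,t)$. **Then** $q$ is of class $C^3$ in $\Omega_T$, the improper integral $\partial_x^{-1}q_{yy}$ converges, and $q$ solves (KPII) in $\Omega_T$. -/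

import Mathlib

open Set Filter Topology MeasureTheory

noncomputable section

namespace KPII

/-! ### The equation -/

/-- The open space-time region `x ∈ ℝ`, `y > 0`, `0 < t < T`. -/
def region (T : ℝ) : Set (ℝ × ℝ × ℝ) := {p | 0 < p.2.1 ∧ 0 < p.2.2 ∧ p.2.2 < T}

/-- `v = ∂ₓ⁻¹ f (x) = ∫_{-∞}^x f(ξ) dξ`, the integral being a convergent improper integral. -/
def HasDxInv (f : ℝ → ℂ) (x : ℝ) (v : ℂ) : Prop :=
  Tendsto (fun X : ℝ => ∫ ξ in X..x, f ξ) atBot (𝓝 v)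

/-- The value `∂ₓ⁻¹ f (x)`. -/
def dxInv (f : ℝ → ℂ) (x : ℝ) : ℂ :=
  limUnder atBot (fun X : ℝ => ∫ ξ in X..x, f ξ)

/-- `q` is a classical solution of `q_t + 6 q q_x + q_xxx + 3 ∂ₓ⁻¹ q_yy = 0`
for `x ∈ ℝ`, `y > 0`, `0 < t < T`. -/
structure SolvesKPII (T : ℝ) (q : ℝ → ℝ → ℝ → ℂ) : Prop where
  smooth : ContDiffOn ℝ 3 (fun p : ℝ × ℝ × ℝ => q p.1 p.2.1 p.2.2) (region T)
  equation : ∀ x y t : ℝ, 0 < y → 0 < t → t < T →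
    ∃ v : ℂ, HasDxInv (fun ξ => iteratedDeriv 2 (fun s => q ξ s t) y) x v ∧
      deriv (fun s => q x y s) t + 6 * q x y t * deriv (fun s => q s y t) x
        + iteratedDeriv 3 (fun s => q s y t) x + 3 * v = 0

/-- `u` solves the initial-boundary value problem for KPII with initial value `q₀` and boundary
values `u(x,0,t) = g(x,t)`, `u_y(x,0,t) = h(x,t)`; it is smooth up to the boundary and decays,
`q₀` is a Schwartz function on the closed half-plane, and the combinations of the boundary values
which enter the spectral functions are absolutely integrable. -/
structure SolvesIBVP (T : ℝ) (u : ℝ → ℝ → ℝ → ℂ) (q₀ g h : ℝ → ℝ → ℂ) : Prop where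
  smooth : ContDiffOn ℝ 3 (fun p : ℝ × ℝ × ℝ => u p.1 p.2.1 p.2.2)
    {p | 0 ≤ p.2.1 ∧ 0 ≤ p.2.2 ∧ p.2.2 ≤ T}
  solves : SolvesKPII T u
  initial : ∀ x y : ℝ, 0 ≤ y → u x y 0 = q₀ x y
  boundary : ∀ x t : ℝ, 0 ≤ t → t ≤ T → u x 0 t = g x t
  boundary_deriv : ∀ x t : ℝ, 0 ≤ t → t ≤ T →
    HasDerivWithinAt (fun y => u x y t) (h x t) (Ici 0) 0
  schwartz : ∃ F : SchwartzMap (ℝ × ℝ) ℂ, ∀ x y : ℝ, 0 ≤ y → q₀ x y = F (x, y)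
  decay_x : ∀ y t : ℝ, 0 ≤ y → 0 ≤ t → t ≤ T →
    Tendsto (fun x => u x y t) (cocompact ℝ) (𝓝 0)
  decay_y : ∀ x t : ℝ, 0 ≤ t → t ≤ T → Tendsto (fun y => u x y t) atTop (𝓝 0)
  integrable : ∀ t : ℝ, 0 ≤ t → t ≤ T →
    IntegrableOn (fun z : ℝ × ℝ => u z.1 z.2 t) (univ ×ˢ Ioi 0)
  integrable_h : ∀ t : ℝ, 0 ≤ t → t ≤ T → Integrable (fun x => h x t)
  integrable_g : IntegrableOn (fun z : ℝ × ℝ => g z.1 z.2) (univ ×ˢ Ioo 0 T)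
  integrable_gx :
    IntegrableOn (fun z : ℝ × ℝ => deriv (fun s => g s z.2) z.1) (univ ×ˢ Ioo 0 T)
  integrable_dxInv_h :
    IntegrableOn (fun z : ℝ × ℝ => dxInv (fun s => h s z.2) z.1) (univ ×ˢ Ioo 0 T)

/-! ### Half-planes, exponentials and the combination `H` of the boundary values

A function `f_{1}^±, f_2^±` of `k = k_R + i k_I` given on the four closed quadrants (index `1` for
`k_R ≤ 0`, index `2` for `k_R ≥ 0`, sign `±` for `± k_I ≥ 0`), with `f_1^± = f_2^±` on the imaginary
axis, is the same as two functions `f⁺, f⁻`, one on each closed half-plane. The two may differ on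
the real axis. Accordingly `f_1^±`, `f_2^±` denote below the restrictions of `f⁺`, `f⁻`. -/

/-- The closed upper half-plane. -/
def upperHalf : Set ℂ := {k | 0 ≤ k.im}

/-- The closed lower half-plane. -/
def lowerHalf : Set ℂ := {k | k.im ≤ 0}

/-- The exponent `4 i l (l² + 3 k l + 3 k²)`. -/
def disp (k l : ℂ) : ℂ := 4 * Complex.I * l * (l ^ 2 + 3 * k * l + 3 * k ^ 2)

/-- `E(x,y,t,k,l) = exp(i l x - l (l + 2 k) y + 4 i l (l² + 3 k l + 3 k²) t)`. -/
def E (x y t : ℝ) (k l : ℂ) : ℂ :=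
  Complex.exp (Complex.I * l * x - l * (l + 2 * k) * y + disp k l * t)

/-- `e_λ(x,y,t,k_R,λ) = E(x,y,t,k_R,-λ-2k_R)`. -/
def eLam (x y t kR lam : ℝ) : ℂ := E x y t kR (-lam - 2 * kR)

/-- `H(x,t,k,l) = 3 [g_x(x,t) - 2 i (l + k) g(x,t) - ∂ₓ⁻¹ h(x,t)]`. -/
def H (g h : ℝ → ℝ → ℂ) (x t : ℝ) (k l : ℂ) : ℂ :=
  3 * (deriv (fun s => g s t) x - 2 * Complex.I * (l + k) * g x t - dxInv (fun s => h s t) x)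

/-- `{l : l (l + 2 k_R) ≥ 0}`: this is `(-∞,0] ∪ [-2k_R,∞)` for `k_R ≤ 0` and
`(-∞,-2k_R] ∪ [0,∞)` for `k_R ≥ 0`. -/
def outer (kR : ℝ) : Set ℝ := {l | 0 ≤ l * (l + 2 * kR)}

/-- `{l : l (l + 2 k_R) ≤ 0}`: the interval between `0` and `-2k_R`. -/
def inner (kR : ℝ) : Set ℝ := {l | l * (l + 2 * kR) ≤ 0}

/-! ### The eigenfunctions `ρ_{1,2}^±` at `t = 0` and `φ_{1,2}^-` at `y = 0` -/

/-- `∫ dξ ∫_{η ∈ S} dη e^{-il(ξ-x) + l(l+2k)(η-y)} q₀(ξ,η) ρ(ξ,η,k)`. -/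
def initTerm (q₀ : ℝ → ℝ → ℂ) (ρ : ℝ → ℝ → ℂ → ℂ) (S : Set ℝ) (x y : ℝ) (k : ℂ) (l : ℝ) : ℂ :=
  ∫ ξ : ℝ, ∫ η in S,
    Complex.exp (-Complex.I * l * (ξ - x) + l * (l + 2 * k) * (η - y)) * q₀ ξ η * ρ ξ η k

/-- `∫ dξ ∫_{τ ∈ S} dτ e^{-il(ξ-x) - l(l+2k)y - 4il(l²+3kl+3k²)(τ-t)} H(ξ,τ,k,l) φ(ξ,τ,k)`. -/
def bdryTerm (g h : ℝ → ℝ → ℂ) (φ : ℝ → ℝ → ℂ → ℂ) (S : Set ℝ) (x y t : ℝ) (k : ℂ) (l : ℝ) : ℂ :=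
  ∫ ξ : ℝ, ∫ τ in S,
    Complex.exp (-Complex.I * l * (ξ - x) - l * (l + 2 * k) * y - disp k l * (τ - t))
      * H g h ξ τ k l * φ ξ τ k

/-- `ρ⁺ = ρ_{1,2}^+` is a bounded continuous solution of the linear integral equations
defining it from `q₀`. -/
structure IsRhoPlus (q₀ : ℝ → ℝ → ℂ) (ρ : ℝ → ℝ → ℂ → ℂ) : Prop where
  continuous : ContinuousOn (fun z : ℝ × ℝ × ℂ => ρ z.1 z.2.1 z.2.2)
    (univ ×ˢ (Ioi 0 ×ˢ upperHalf))
  bounded : ∃ C : ℝ, ∀ x y : ℝ, ∀ k ∈ upperHalf, 0 < y → ‖ρ x y k‖ ≤ C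
  equation : ∀ x y : ℝ, ∀ k ∈ upperHalf, 0 < y →
    ρ x y k = 1
      + 1 / (2 * Real.pi) * (∫ l in outer k.re, initTerm q₀ ρ (Ioo 0 y) x y k l)
      - 1 / (2 * Real.pi) * (∫ l in inner k.re, initTerm q₀ ρ (Ioi y) x y k l)

/-- `ρ⁻ = ρ_{1,2}^-` and `φ⁻ = φ_{1,2}^-` form a bounded continuous solution of the linear integral
equations defining them from `q₀, g, h`. -/
structure IsRhoPhiMinus (T : ℝ) (q₀ g h : ℝ → ℝ → ℂ) (ρ φ : ℝ → ℝ → ℂ → ℂ) : Prop where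
  continuous_rho : ContinuousOn (fun z : ℝ × ℝ × ℂ => ρ z.1 z.2.1 z.2.2)
    (univ ×ˢ (Ioi 0 ×ˢ lowerHalf))
  continuous_phi : ContinuousOn (fun z : ℝ × ℝ × ℂ => φ z.1 z.2.1 z.2.2)
    (univ ×ˢ (Ioo 0 T ×ˢ lowerHalf))
  bounded_rho : ∃ C : ℝ, ∀ x y : ℝ, ∀ k ∈ lowerHalf, 0 < y → ‖ρ x y k‖ ≤ C
  bounded_phi : ∃ C : ℝ, ∀ x t : ℝ, ∀ k ∈ lowerHalf, 0 < t → t < T → ‖φ x t k‖ ≤ C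
  equation_rho : ∀ x y : ℝ, ∀ k ∈ lowerHalf, 0 < y →
    ρ x y k = 1
      + 1 / (2 * Real.pi) * (∫ l in outer k.re, initTerm q₀ ρ (Ioo 0 y) x y k l)
      - 1 / (2 * Real.pi) * (∫ l in outer k.re, bdryTerm g h φ (Ioo 0 T) x y 0 k l)
      - 1 / (2 * Real.pi) * (∫ l in inner k.re, initTerm q₀ ρ (Ioi y) x y k l)
  integrable_phi : ∀ x t : ℝ, ∀ k ∈ lowerHalf, 0 < t → t < T →
    IntegrableOn (fun l : ℝ => bdryTerm g h φ (Ioo t T) x 0 t k l) (outer k.re)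
  equation_phi : ∀ x t : ℝ, ∀ k ∈ lowerHalf, 0 < t → t < T →
    φ x t k = 1
      - 1 / (2 * Real.pi) * (∫ l in outer k.re, bdryTerm g h φ (Ioo t T) x 0 t k l)
      + 1 / (2 * Real.pi) * (∫ l in inner k.re, bdryTerm g h φ (Ioo 0 t) x 0 t k l)
      - 1 / (2 * Real.pi) * (∫ l in inner k.re,
          Complex.exp (disp k l * t) * initTerm q₀ ρ (Ioi 0) x 0 k l)

/-- The global relation
`∬ e^{-ilξ+l(l+2k)η} q₀ ρ_j^- dη dξ - ∫∫₀ᵗ e^{-ilξ-4il(l²+3kl+3k²)τ} H φ_j^- dτ dξ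
  = ∬ e^{-ilξ+l(l+2k)η-4il(l²+3kl+3k²)t} u(ξ,η,t) μ_j^- dη dξ`,  `l (l + 2 k_R) ≤ 0`,
for bounded `μ_1^-, μ_2^-` (here `m`, on the closed lower half-plane). -/
def GlobalRelation (T : ℝ) (u : ℝ → ℝ → ℝ → ℂ) (q₀ g h : ℝ → ℝ → ℂ) (ρ φ : ℝ → ℝ → ℂ → ℂ) : Prop :=
  ∃ m : ℝ → ℝ → ℝ → ℂ → ℂ,
    (∀ t : ℝ, ∀ k ∈ lowerHalf, 0 < t → t < T →
      ContinuousOn (fun z : ℝ × ℝ => m z.1 z.2 t k) (univ ×ˢ Ioi 0)) ∧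
    (∃ C : ℝ, ∀ x y t : ℝ, ∀ k ∈ lowerHalf, 0 < y → 0 < t → t < T → ‖m x y t k‖ ≤ C) ∧
    ∀ t : ℝ, ∀ k ∈ lowerHalf, ∀ l : ℝ, 0 < t → t < T → l ∈ inner k.re →
      initTerm q₀ ρ (Ioi 0) 0 0 k l - bdryTerm g h φ (Ioo 0 t) 0 0 0 k l
        = ∫ ξ : ℝ, ∫ η in Ioi (0 : ℝ),
            Complex.exp (-Complex.I * l * ξ + l * (l + 2 * k) * η - disp k l * t)
              * u ξ η t * m ξ η t k

/-! ### The spectral functions -/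

/-- `β(k) = (2π)⁻¹ ∫ dξ ∫₀^∞ dη e^{2i k_R ξ - 4i k_R k_I η} q₀(ξ,η) ρ(ξ,η,k)`: with `ρ = ρ^±` this
is `β_1^±` for `k_R ≤ 0` and `β_2^±` for `k_R ≥ 0`. -/
def beta (q₀ : ℝ → ℝ → ℂ) (ρ : ℝ → ℝ → ℂ → ℂ) (k : ℂ) : ℂ :=
  1 / (2 * Real.pi) * ∫ ξ : ℝ, ∫ η in Ioi (0 : ℝ),
    Complex.exp (2 * Complex.I * k.re * ξ - 4 * Complex.I * k.re * k.im * η) * q₀ ξ η * ρ ξ η k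

/-- `α(k) = (2π)⁻¹ ∫ dξ ∫₀^T dτ e^{2i k_R ξ + 8i k_R (k_R² - 3 k_I²) τ} H(ξ,τ,k,-2k_R) φ(ξ,τ,k)`:
with `φ = φ^-` this is `α_1^-` for `k_R ≤ 0` and `α_2^-` for `k_R ≥ 0`. -/
def alpha (T : ℝ) (g h : ℝ → ℝ → ℂ) (φ : ℝ → ℝ → ℂ → ℂ) (k : ℂ) : ℂ :=
  1 / (2 * Real.pi) * ∫ ξ : ℝ, ∫ τ in Ioo 0 T,
    Complex.exp (2 * Complex.I * k.re * ξ
        + 8 * Complex.I * k.re * ((k.re : ℂ) ^ 2 - 3 * (k.im : ℂ) ^ 2) * τ)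
      * H g h ξ τ k (-2 * k.re) * φ ξ τ k

/-- `γ_{1,2}^+ = β_{1,2}^+`, on the closed upper half-plane. -/
def gammaPlus (q₀ : ℝ → ℝ → ℂ) (ρp : ℝ → ℝ → ℂ → ℂ) (k : ℂ) : ℂ := beta q₀ ρp k

/-- `γ_{1,2}^- = β_{1,2}^- - α_{1,2}^-`, on the closed lower half-plane. -/
def gammaMinus (T : ℝ) (q₀ g h : ℝ → ℝ → ℂ) (ρm φm : ℝ → ℝ → ℂ → ℂ) (k : ℂ) : ℂ :=
  beta q₀ ρm k - alpha T g h φm k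

/-- The kernels `r_1`, `r_2`:
`(2π)⁻¹ ∫ dξ ∫₀^∞ dη e^{-ilξ+l(l+2k_R)η} q₀(ξ,η) e_λ(ξ,η,0,k_R,λ) ρ^+(ξ,η,-k_R-λ)`. This is `r_1`
when `-k_R-λ ≤ 0` (so that `ρ^+ = ρ_1^+`), and `r_2` when `-k_R-λ ≥ 0` (so that `ρ^+ = ρ_2^+`). -/
def rKer (q₀ : ℝ → ℝ → ℂ) (ρp : ℝ → ℝ → ℂ → ℂ) (kR lam l : ℝ) : ℂ :=
  1 / (2 * Real.pi) * ∫ ξ : ℝ, ∫ η in Ioi (0 : ℝ),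
    Complex.exp (-Complex.I * l * ξ + l * (l + 2 * kR) * η) * q₀ ξ η
      * (eLam ξ η 0 kR lam * ρp ξ η (((-kR - lam : ℝ)) : ℂ))

/-- `(2π)⁻¹ ∫ dξ ∫₀^T dτ e^{-ilξ-4il(l²+3k_R l+3k_R²)τ} H(ξ,τ,k_R,l) φ^-(ξ,τ,k_R)`; this is `p_1`,
formed with `φ_1^-`, for `k_R ≤ 0`, and `p_2`, formed with `φ_2^-`, for `k_R ≥ 0`. -/
def pFun (T : ℝ) (g h : ℝ → ℝ → ℂ) (φm : ℝ → ℝ → ℂ → ℂ) (kR l : ℝ) : ℂ :=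
  1 / (2 * Real.pi) * ∫ ξ : ℝ, ∫ τ in Ioo 0 T,
    Complex.exp (-Complex.I * l * ξ - disp kR l * τ) * H g h ξ τ kR l * φm ξ τ kR

/-- `(c₂, c₁)`, given on the rays `λ ≤ b₂` and `λ ≥ b₁`, is a continuous and integrable solution of
the Volterra system, for a fixed `k_R`, with the kernels `r = r_{1,2}` and the right-hand side `p`. -/
structure SolvesVolterra (r : ℝ → ℝ → ℝ → ℂ) (p : ℝ → ℝ → ℂ) (kR b₂ b₁ : ℝ) (c₂ c₁ : ℝ → ℂ) :
    Prop where
  continuous₂ : ContinuousOn c₂ (Iic b₂)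
  continuous₁ : ContinuousOn c₁ (Ici b₁)
  integrable₂ : IntegrableOn c₂ (Iic b₂)
  integrable₁ : IntegrableOn c₁ (Ici b₁)
  equation₂ : ∀ lam ≤ b₂,
    c₂ lam - (∫ l in Iic lam, c₂ l * r kR l (-2 * kR - lam))
      - (∫ l in Ici (-2 * kR - lam), c₁ l * r kR l (-2 * kR - lam)) = p kR (-2 * kR - lam)
  equation₁ : ∀ lam ≥ b₁,
    c₁ lam - (∫ l in Iic (-2 * kR - lam), c₂ l * r kR l (-2 * kR - lam))
      - (∫ l in Ici lam, c₁ l * r kR l (-2 * kR - lam)) = p kR (-2 * kR - lam)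

/-- `(c₂, c₁)` is the unique solution of the Volterra system. -/
def UniqueVolterra (r : ℝ → ℝ → ℝ → ℂ) (p : ℝ → ℝ → ℂ) (kR b₂ b₁ : ℝ) (c₂ c₁ : ℝ → ℂ) : Prop :=
  SolvesVolterra r p kR b₂ b₁ c₂ c₁ ∧
    ∀ d₂ d₁ : ℝ → ℂ, SolvesVolterra r p kR b₂ b₁ d₂ d₁ →
      EqOn d₂ c₂ (Iic b₂) ∧ EqOn d₁ c₁ (Ici b₁)

/-! ### The d-bar (Pompeiu) integral equation for `μ` -/

/-- The spectral data from which `μ` is built. -/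
structure SpectralData where
  γp : ℂ → ℂ
  γm : ℂ → ℂ
  χ₁ : ℝ → ℝ → ℂ
  χ₂ : ℝ → ℝ → ℂ
  ψ₁ : ℝ → ℝ → ℂ
  ψ₂ : ℝ → ℝ → ℂ

/-- The domains of integration of the four terms which come from the jump across the real axis.
The inner variable runs along the imaginary axis, `ν_I = i s` with `s` real, and `z = (ν_R, s)`. -/
def domχ₂ : Set (ℝ × ℝ) := {z | z.1 < 0 ∧ z.1 < z.2 ∧ z.2 < 0}

/-- See `domχ₂`. -/
def domχ₁ : Set (ℝ × ℝ) := {z | 0 < z.1 ∧ z.1 < z.2}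

/-- See `domχ₂`. -/
def domψ₂ : Set (ℝ × ℝ) := {z | z.1 < 0 ∧ z.2 < z.1}

/-- See `domχ₂`. -/
def domψ₁ : Set (ℝ × ℝ) := {z | 0 < z.1 ∧ 0 < z.2 ∧ z.2 < z.1}

/-- `∬_D (ν-k)⁻¹ c(ν,-2iν_I) E(x,y,t,ν,-2ν_R) μ^+(x,y,t,-ν_R,ν_I) ds dν_R` with `ν_I = i s`, so
that `ν = ν_R + i ν_I = ν_R - s` and `-2iν_I = 2s` are real, and `μ^+` is evaluated at the real
point `-ν_R + iν_I = -ν_R - s`. -/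
def jumpTerm (c : ℝ → ℝ → ℂ) (D : Set (ℝ × ℝ)) (x y t : ℝ) (mp : ℂ → ℂ) (k : ℂ) : ℂ :=
  ∫ z in D, c (z.1 - z.2) (2 * z.2) / (((z.1 - z.2 : ℝ) : ℂ) - k)
    * E x y t ((z.1 - z.2 : ℝ) : ℂ) (-2 * z.1) * mp ((-z.1 - z.2 : ℝ) : ℂ)

/-- `∬_D (ν-k)⁻¹ γ(ν_R,ν_I) E(x,y,t,ν,-2ν_R) μ(x,y,t,-ν_R,ν_I) dν_R dν_I`. -/
def areaTerm (γ : ℂ → ℂ) (D : Set ℂ) (x y t : ℝ) (m : ℂ → ℂ) (k : ℂ) : ℂ :=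
  ∫ ν in D, γ ν / (ν - k) * E x y t ν (-2 * ν.re) * m (-(starRingEnd ℂ ν))

/-- The right-hand side of the integral equation. In the first four terms
`∫₀^{iν_R} dν_I = -i ∫_{ν_R}^0 ds` and `∫_{iν_R}^{-i∞} dν_I = -i ∫_{-∞}^{ν_R} ds` for `ν_R < 0`,
`∫_{iν_R}^{i∞} dν_I = i ∫_{ν_R}^∞ ds` and `∫₀^{iν_R} dν_I = i ∫₀^{ν_R} ds` for `ν_R > 0`. -/
def pompeiuRHS (S : SpectralData) (x y t : ℝ) (mp mm : ℂ → ℂ) (k : ℂ) : ℂ :=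
  1 + 1 / Real.pi * (-Complex.I * jumpTerm S.χ₂ domχ₂ x y t mp k)
    - 1 / Real.pi * (Complex.I * jumpTerm S.χ₁ domχ₁ x y t mp k)
    + 1 / Real.pi * (-Complex.I * jumpTerm S.ψ₂ domψ₂ x y t mp k)
    - 1 / Real.pi * (Complex.I * jumpTerm S.ψ₁ domψ₁ x y t mp k)
    + 1 / Real.pi * areaTerm S.γp {ν | 0 < ν.re ∧ 0 < ν.im} x y t mp k
    - 1 / Real.pi * areaTerm S.γp {ν | ν.re < 0 ∧ 0 < ν.im} x y t mp k
    + 1 / Real.pi * areaTerm S.γm {ν | 0 < ν.re ∧ ν.im < 0} x y t mm k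
    - 1 / Real.pi * areaTerm S.γm {ν | ν.re < 0 ∧ ν.im < 0} x y t mm k

/-- `(mp, mm)`, the parts of `μ(x,y,t,·)` on the closed upper and lower half-planes, is a bounded
solution of the integral equation, continuous up to the real axis from either side. -/
structure SolvesPompeiu (S : SpectralData) (x y t : ℝ) (mp mm : ℂ → ℂ) : Prop where
  continuous_upper : ContinuousOn mp upperHalf
  continuous_lower : ContinuousOn mm lowerHalf
  bounded_upper : ∃ C : ℝ, ∀ k ∈ upperHalf, ‖mp k‖ ≤ C
  bounded_lower : ∃ C : ℝ, ∀ k ∈ lowerHalf, ‖mm k‖ ≤ C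
  equation_upper : ∀ k : ℂ, 0 < k.im → mp k = pompeiuRHS S x y t mp mm k
  equation_lower : ∀ k : ℂ, k.im < 0 → mm k = pompeiuRHS S x y t mp mm k

/-- `(mp, mm)` is the unique solution of the integral equation at the point `(x,y,t)`. -/
def UniquePompeiu (S : SpectralData) (x y t : ℝ) (mp mm : ℂ → ℂ) : Prop :=
  SolvesPompeiu S x y t mp mm ∧
    ∀ mp' mm' : ℂ → ℂ, SolvesPompeiu S x y t mp' mm' → EqOn mp' mp upperHalf ∧ EqOn mm' mm lowerHalf

/-- The spectral data decay so that the integrals in the integral equation converge absolutely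
(the exponentials `E` which occur there are bounded by `1`). -/
structure SpectralData.Decays (S : SpectralData) : Prop where
  gammaPlus : ∀ k : ℂ, k.im ≠ 0 → IntegrableOn (fun ν => S.γp ν / (ν - k)) {ν | 0 < ν.im}
  gammaMinus : ∀ k : ℂ, k.im ≠ 0 → IntegrableOn (fun ν => S.γm ν / (ν - k)) {ν | ν.im < 0}
  chi₂ : ∀ k : ℂ, k.im ≠ 0 → IntegrableOn
    (fun z : ℝ × ℝ => S.χ₂ (z.1 - z.2) (2 * z.2) / (((z.1 - z.2 : ℝ) : ℂ) - k)) domχ₂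
  chi₁ : ∀ k : ℂ, k.im ≠ 0 → IntegrableOn
    (fun z : ℝ × ℝ => S.χ₁ (z.1 - z.2) (2 * z.2) / (((z.1 - z.2 : ℝ) : ℂ) - k)) domχ₁
  psi₂ : ∀ k : ℂ, k.im ≠ 0 → IntegrableOn
    (fun z : ℝ × ℝ => S.ψ₂ (z.1 - z.2) (2 * z.2) / (((z.1 - z.2 : ℝ) : ℂ) - k)) domψ₂
  psi₁ : ∀ k : ℂ, k.im ≠ 0 → IntegrableOn
    (fun z : ℝ × ℝ => S.ψ₁ (z.1 - z.2) (2 * z.2) / (((z.1 - z.2 : ℝ) : ℂ) - k)) domψ₁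

/-! ### Smoothness and decay of `μ` and `q` -/

/-- `μ`, on one of the closed half-planes `D` of the `k`-plane, is smooth in `(x,y,t)` with
derivatives continuous in `(x,y,t,k)`; and, locally uniformly in `(x,y,t)`, as `k → ∞`,
`μ = 1 + O(1/k)`, `k μ_x = i q / 2 + O(1/k)`, `μ_xx = O(1/k)`, and `μ_xxx`, `μ_y`, `μ_t` are
bounded. -/
structure RegularOn (T : ℝ) (D : Set ℂ) (μ : ℝ → ℝ → ℝ → ℂ → ℂ) (q : ℝ → ℝ → ℝ → ℂ) : Prop where
  smooth : ∀ k ∈ D,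
    ContDiffOn ℝ 5 (fun p : ℝ × ℝ × ℝ => μ p.1 p.2.1 p.2.2 k) (region T)
  continuous : ∀ n : ℕ, n ≤ 3 → ContinuousOn
    (fun z : (ℝ × ℝ × ℝ) × ℂ =>
      iteratedFDeriv ℝ n (fun p : ℝ × ℝ × ℝ => μ p.1 p.2.1 p.2.2 z.2) z.1) (region T ×ˢ D)
  bounds : ∀ K : Set (ℝ × ℝ × ℝ), IsCompact K → K ⊆ region T →
    ∃ C : ℝ, ∀ x y t : ℝ, ∀ k ∈ D, (x, y, t) ∈ K →
      (1 + ‖k‖) * ‖μ x y t k - 1‖ ≤ C ∧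
      (1 + ‖k‖) * ‖k * deriv (fun s => μ s y t k) x - Complex.I / 2 * q x y t‖ ≤ C ∧
      (1 + ‖k‖) * ‖iteratedDeriv 2 (fun s => μ s y t k) x‖ ≤ C ∧
      ‖iteratedDeriv 3 (fun s => μ s y t k) x‖ ≤ C ∧
      ‖deriv (fun s => μ x s t k) y‖ ≤ C ∧
      ‖deriv (fun s => μ x y s k) t‖ ≤ C

/-- `q = -2 i lim_{k → ∞} k μ_x`, the limit being taken in either half-plane. -/
def IsPotential (T : ℝ) (μp μm : ℝ → ℝ → ℝ → ℂ → ℂ) (q : ℝ → ℝ → ℝ → ℂ) : Prop :=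
  ∀ x y t : ℝ, 0 < y → 0 < t → t < T →
    Tendsto (fun k : ℂ => -2 * Complex.I * (k * deriv (fun s => μp s y t k) x))
      (cocompact ℂ ⊓ 𝓟 upperHalf) (𝓝 (q x y t)) ∧
    Tendsto (fun k : ℂ => -2 * Complex.I * (k * deriv (fun s => μm s y t k) x))
      (cocompact ℂ ⊓ 𝓟 lowerHalf) (𝓝 (q x y t))

/-- `q`, `q_x`, `q_xxx`, `q_t` tend to zero as `x → -∞`, for fixed `(y,t)`. -/
def DecaysLeft (T : ℝ) (q : ℝ → ℝ → ℝ → ℂ) : Prop :=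
  ∀ y t : ℝ, 0 < y → 0 < t → t < T →
    Tendsto (fun x => q x y t) atBot (𝓝 0) ∧
    Tendsto (fun x => deriv (fun s => q s y t) x) atBot (𝓝 0) ∧
    Tendsto (fun x => iteratedDeriv 3 (fun s => q s y t) x) atBot (𝓝 0) ∧
    Tendsto (fun x => deriv (fun s => q x y s) t) atBot (𝓝 0)

end KPII

end

/-! The proof is the dressing method. All the terms of the integral equation combine into one
operator of Cauchy type, so that it reads `μ = 1 + K μ` for nonreal `k`, where `K f (k) = ∫ c (ν -
k)⁻¹ E(ν,l) f(ν + l)`. Two differential operators with coefficients polynomial in `k`, `laxY` and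
`laxT`, are adapted to `K`: multiplication by `E(k,l)` carries the operator at `k + l` into the
operator at `k` (`laxY_expE_mul`, `laxT_expE_mul`). Applying such an operator to `μ` therefore
commutes with `K` up to the difference of its coefficients at `ν` and at `k`. This difference is
divisible by `ν - k`, which cancels the Cauchy denominator.

For `G = laxY μ` the remainder `G - K G` is thus a function `Q(x,y,t)` without `k`. Then `G - Q μ`
is a bounded continuous solution of the homogeneous equation and vanishes by uniqueness
(`eq_zero_of_eq_op`, `exists_multiplier`), so `laxY μ = Q μ`. Letting `k → ∞` gives `Q = q`
(`eq_potential`). For `laxT` the remainder could still be linear in `k`, but the identity for `laxY`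
shows that its linear coefficient is zero (`dressing_laxT`). Hence `laxT μ = W μ` with another
`k`-independent `W`.

With `ψ = E(0,k) μ` this is the Lax pair `ψ_y = ψ_xx + q ψ`, `ψ_t = -4 ψ_xxx - 6 q ψ_x + W ψ`.
Equality of the mixed derivatives gives `A ψ_x + B ψ = 0` for all `k` (`lax_compatibility`), and
large `k` forces `A = B = 0` (`coefficients_eq_zero`). Elimination of `W` yields KPII, the decay of
`q` as `x → -∞` fixing the constant of integration (`solvesKPII_of_conditions`).

The data are integrable only against `(ν - k)⁻¹`, while each derivative of `E` produces a polynomial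
in `ν` and `l`, so one cannot differentiate under the integral sign. The commutation is therefore
proved weakly: derivatives are moved to a test function in `(x,y,t)` and Fubini's theorem is applied
(`Kernel.integral_mul_sub_op`). Continuity of both sides turns the weak identities into pointwise
ones (`eqOn_of_forall_integral_eq`). -/

noncomputable section

namespace KPII

/-! ### Partial derivatives -/

/-- Space-time `(x, y, t)`. -/
abbrev ST := ℝ × ℝ × ℝ

/-- The derivative of `f` in the direction `v`. -/
def pd (v : ST) (f : ST → ℂ) : ST → ℂ := fun p => fderiv ℝ f p v

abbrev ex : ST := (1, 0, 0)
abbrev ey : ST := (0, 1, 0)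
abbrev et : ST := (0, 0, 1)

lemma isOpen_region (T : ℝ) : IsOpen (region T) := by
  have h1 : IsOpen {p : ST | 0 < p.2.1} := isOpen_lt (by fun_prop) (by fun_prop)
  have h2 : IsOpen {p : ST | 0 < p.2.2} := isOpen_lt (by fun_prop) (by fun_prop)
  have h3 : IsOpen {p : ST | p.2.2 < T} := isOpen_lt (by fun_prop) (by fun_prop)
  exact h1.inter (h2.inter h3)

section pd

variable {Ω : Set ST} {f g : ST → ℂ} {p : ST} {v w : ST}

lemma pd_congr (hΩ : IsOpen Ω) (h : EqOn f g Ω) : EqOn (pd v f) (pd v g) Ω := by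
  intro p hp
  have : f =ᶠ[𝓝 p] g := Filter.eventuallyEq_of_mem (hΩ.mem_nhds hp) h
  simp only [pd, this.fderiv_eq]

lemma contDiffOn_pd {n m : ℕ∞} (hf : ContDiffOn ℝ n f Ω) (hΩ : IsOpen Ω) (hmn : m + 1 ≤ n) :
    ContDiffOn ℝ m (pd v f) Ω :=
  (hf.fderiv_of_isOpen hΩ (by exact_mod_cast hmn)).clm_apply contDiffOn_const

lemma differentiableAt_of_contDiffOn {n : ℕ∞} (hf : ContDiffOn ℝ n f Ω) (hΩ : IsOpen Ω)
    (hn : 1 ≤ n) (hp : p ∈ Ω) : DifferentiableAt ℝ f p :=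
  (hf.contDiffAt (hΩ.mem_nhds hp)).differentiableAt
    (by intro h0; rw [WithTop.coe_eq_zero] at h0; simp [h0] at hn)

lemma pd_add (hf : DifferentiableAt ℝ f p) (hg : DifferentiableAt ℝ g p) :
    pd v (fun x => f x + g x) p = pd v f p + pd v g p := by
  simp only [pd, fderiv_fun_add hf hg, add_apply]

lemma pd_sub (hf : DifferentiableAt ℝ f p) (hg : DifferentiableAt ℝ g p) :
    pd v (fun x => f x - g x) p = pd v f p - pd v g p := by
  simp only [pd, fderiv_fun_sub hf hg, sub_apply]

lemma pd_mul (hf : DifferentiableAt ℝ f p) (hg : DifferentiableAt ℝ g p) :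
    pd v (fun x => f x * g x) p = f p * pd v g p + pd v f p * g p := by
  simp only [pd, fderiv_fun_mul hf hg, add_apply,
    smul_apply, smul_eq_mul]
  ring

lemma pd_const_mul (c : ℂ) (hf : DifferentiableAt ℝ f p) :
    pd v (fun x => c * f x) p = c * pd v f p := by
  simp only [pd, fderiv_const_mul hf, smul_apply, smul_eq_mul]

lemma pd_comm {n : ℕ∞} (hf : ContDiffOn ℝ n f Ω) (hΩ : IsOpen Ω) (hn : 2 ≤ n) :
    EqOn (pd v (pd w f)) (pd w (pd v f)) Ω := by
  intro p hp
  have hc : ContDiffAt ℝ 2 f p :=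
    (hf.contDiffAt (hΩ.mem_nhds hp)).of_le
      (by have : ((2 : ℕ∞) : WithTop ℕ∞) ≤ n := by exact_mod_cast hn
          exact this)
  have hs := hc.isSymmSndFDerivAt (by simp) v w
  have hd : DifferentiableAt ℝ (fderiv ℝ f) p :=
    (hc.fderiv_right (m := 1) (by norm_num)).differentiableAt (by simp)
  have key (a b : ST) : pd a (pd b f) p = fderiv ℝ (fderiv ℝ f) p a b := by
    have e : pd b f = fun y => fderiv ℝ f y b := rfl
    rw [e, pd, fderiv_clm_apply hd (differentiableAt_const b)]
    simp
  rw [key, key, hs]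

lemma hasDerivAt_slice_x (hf : DifferentiableAt ℝ f p) :
    HasDerivAt (fun s => f (s, p.2.1, p.2.2)) (pd ex f p) p.1 := by
  have h : HasDerivAt (fun s : ℝ => ((s, p.2.1, p.2.2) : ST)) (1, 0, 0) p.1 :=
    (hasDerivAt_id _).prodMk ((hasDerivAt_const _ _).prodMk (hasDerivAt_const _ _))
  exact HasFDerivAt.comp_hasDerivAt (f := fun s : ℝ => ((s, p.2.1, p.2.2) : ST)) p.1 hf.hasFDerivAt h

lemma hasDerivAt_slice_y (hf : DifferentiableAt ℝ f p) :
    HasDerivAt (fun s => f (p.1, s, p.2.2)) (pd ey f p) p.2.1 := by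
  have h : HasDerivAt (fun s : ℝ => ((p.1, s, p.2.2) : ST)) (0, 1, 0) p.2.1 :=
    (hasDerivAt_const _ _).prodMk ((hasDerivAt_id _).prodMk (hasDerivAt_const _ _))
  exact HasFDerivAt.comp_hasDerivAt (f := fun s : ℝ => ((p.1, s, p.2.2) : ST)) p.2.1
    hf.hasFDerivAt h

lemma hasDerivAt_slice_t (hf : DifferentiableAt ℝ f p) :
    HasDerivAt (fun s => f (p.1, p.2.1, s)) (pd et f p) p.2.2 := by
  have h : HasDerivAt (fun s : ℝ => ((p.1, p.2.1, s) : ST)) (0, 0, 1) p.2.2 :=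
    (hasDerivAt_const _ _).prodMk ((hasDerivAt_const _ _).prodMk (hasDerivAt_id _))
  exact HasFDerivAt.comp_hasDerivAt (f := fun s : ℝ => ((p.1, p.2.1, s) : ST)) p.2.2
    hf.hasFDerivAt h

/-- The induction step which expresses iterated directional derivatives as values of the full
iterated derivative. It transfers the joint continuity in `(x,y,t,k)`, assumed for the latter, to
the former. -/
lemma pd_pd_eq_iteratedFDeriv {n : ℕ∞} (hf : ContDiffOn ℝ n f Ω) (hΩ : IsOpen Ω) {j : ℕ}
    (hj : (j + 1 : ℕ) ≤ n) (F : ST → ℂ) (u : Fin j → ST)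
    (hF : EqOn F (fun p => iteratedFDeriv ℝ j f p u) Ω) :
    EqOn (pd v F) (fun p => iteratedFDeriv ℝ (j + 1) f p (Fin.cons v u)) Ω := by
  intro p hp
  have hc : ContDiffAt ℝ n f p := hf.contDiffAt (hΩ.mem_nhds hp)
  have hd : DifferentiableAt ℝ (iteratedFDeriv ℝ j f) p := by
    refine hc.differentiableAt_iteratedFDeriv ?_
    have : ((j : ℕ∞) : WithTop ℕ∞) < ((j + 1 : ℕ) : ℕ∞) := by
      exact_mod_cast Nat.lt_succ_self j
    exact lt_of_lt_of_le this (by exact_mod_cast hj)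
  rw [pd_congr hΩ hF hp]
  simp only [pd]
  have := (hd.hasFDerivAt.continuousMultilinear_apply_const u).fderiv
  rw [this, iteratedFDeriv_succ_apply_left]
  simp

end pd

instance : (volume : Measure ST).IsAddHaarMeasure :=
  have : (volume : Measure (ℝ × ℝ)).IsAddHaarMeasure := Measure.prod.instIsAddHaarMeasure _ _
  Measure.prod.instIsAddHaarMeasure _ _

/-! ### Test functions and integration by parts -/

/-- `φ` is of class `C^n` with compact support in `Ω`. -/
structure IsTest (Ω : Set ST) (n : ℕ∞) (φ : ST → ℂ) : Prop where
  contDiff : ContDiff ℝ n φ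
  compact : HasCompactSupport φ
  subset : tsupport φ ⊆ Ω

namespace IsTest

variable {Ω : Set ST} {n m : ℕ∞} {φ χ f : ST → ℂ} {v : ST}

lemma of_le (h : IsTest Ω n φ) (hm : m ≤ n) : IsTest Ω m φ :=
  ⟨h.contDiff.of_le (by exact_mod_cast hm), h.compact, h.subset⟩

lemma tsupport_pd_subset : tsupport (pd v φ) ⊆ tsupport φ := by
  refine closure_minimal (fun p hp => ?_) (isClosed_tsupport φ)
  refine support_fderiv_subset ℝ (fun h0 => hp ?_)
  simp only [pd]
  rw [h0]; rfl

lemma pd (h : IsTest Ω n φ) (v : ST) (hm : m + 1 ≤ n) : IsTest Ω m (pd v φ) where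
  contDiff := (h.contDiff.fderiv_right (by exact_mod_cast hm)).clm_apply contDiff_const
  compact := h.compact.of_isClosed_subset (isClosed_tsupport _) tsupport_pd_subset
  subset := tsupport_pd_subset.trans h.subset

lemma add (h : IsTest Ω n φ) (h' : IsTest Ω n χ) : IsTest Ω n (fun p => φ p + χ p) where
  contDiff := h.contDiff.add h'.contDiff
  compact := h.compact.add h'.compact
  subset := (tsupport_add φ χ).trans (union_subset h.subset h'.subset)

/-- The factor may be irregular outside `Ω`, since the product vanishes near every point off the
support of `φ`. This makes `q φ` a test function although `q` is controlled only in the region. -/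
lemma mul_left (h : IsTest Ω n φ) (hΩ : IsOpen Ω) (hf : ContDiffOn ℝ n f Ω) :
    IsTest Ω n (fun p => f p * φ p) where
  contDiff := by
    refine contDiff_iff_contDiffAt.2 fun p => ?_
    by_cases hp : p ∈ tsupport φ
    · exact (hf.contDiffAt (hΩ.mem_nhds (h.subset hp))).mul h.contDiff.contDiffAt
    · refine (contDiffAt_const (c := (0 : ℂ))).congr_of_eventuallyEq ?_
      filter_upwards [notMem_tsupport_iff_eventuallyEq.1 hp] with z hz
      simp [hz]
  compact := h.compact.mul_left
  subset := (tsupport_mul_subset_right).trans h.subset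

lemma const_mul (h : IsTest Ω n φ) (hΩ : IsOpen Ω) (c : ℂ) : IsTest Ω n (fun p => c * φ p) :=
  h.mul_left hΩ contDiffOn_const

lemma neg (h : IsTest Ω n φ) (hΩ : IsOpen Ω) : IsTest Ω n (fun p => - φ p) := by
  simpa using h.const_mul hΩ (-1)

lemma sub (h : IsTest Ω n φ) (h' : IsTest Ω n χ) (hΩ : IsOpen Ω) :
    IsTest Ω n (fun p => φ p - χ p) := by
  simpa [sub_eq_add_neg] using h.add (h'.neg hΩ)

lemma continuous_mul (h : IsTest Ω n φ) (hΩ : IsOpen Ω) (hf : ContinuousOn f Ω) :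
    Continuous (fun p => φ p * f p) := by
  refine continuous_of_tsupport fun p hp => ?_
  have hp' : p ∈ Ω := h.subset (tsupport_mul_subset_left hp)
  exact h.contDiff.continuous.continuousAt.mul (hf.continuousAt (hΩ.mem_nhds hp'))

lemma integrable_mul (h : IsTest Ω n φ) (hΩ : IsOpen Ω) (hf : ContinuousOn f Ω) :
    Integrable (fun p => φ p * f p) :=
  (h.continuous_mul hΩ hf).integrable_of_hasCompactSupport h.compact.mul_right

lemma integrable (h : IsTest Ω n φ) : Integrable φ :=
  h.contDiff.continuous.integrable_of_hasCompactSupport h.compact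

/-- There is no boundary term because the support of `φ` is compact inside `Ω`; for the same reason
`f` has to be differentiable only there. -/
lemma integral_mul_pd (h : IsTest Ω n φ) (hΩ : IsOpen Ω) (hn : 1 ≤ n) (hf : ContDiffOn ℝ 1 f Ω)
    (v : ST) : ∫ p, φ p * KPII.pd v f p = - ∫ p, KPII.pd v φ p * f p := by
  have hf0 : ContDiffOn ℝ ((1 : ℕ∞) : WithTop ℕ∞) f Ω := hf
  have hc : ContinuousOn (KPII.pd v f) Ω := by
    have := contDiffOn_pd (v := v) (m := 0) hf0 hΩ (by simp)
    exact this.continuousOn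
  have hd : Differentiable ℝ φ := (h.of_le hn).contDiff.differentiable (by simp)
  exact integral_mul_fderiv_eq_neg_fderiv_mul_of_integrable
    ((h.pd v (m := 0) (by simpa using hn)).integrable_mul hΩ hf.continuousOn)
    (h.integrable_mul hΩ hc) (h.integrable_mul hΩ hf.continuousOn)
    (fun p _ => hd p)
    (fun p hp => differentiableAt_of_contDiffOn hf0 hΩ le_rfl (h.subset hp))

lemma integral_pd (h : IsTest Ω n φ) (hΩ : IsOpen Ω) (hn : 1 ≤ n) (v : ST) :
    ∫ p, KPII.pd v φ p = 0 := by
  have := h.integral_mul_pd hΩ hn (f := fun _ => 1) contDiffOn_const v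
  have h0 : KPII.pd v (fun _ => (1 : ℂ)) = 0 := by
    ext p; simp [KPII.pd]
  simpa [h0] using this

end IsTest

/-! ### The operators of the Lax pair and the exponentials -/

/-- `∂_y - ∂_x² - 2ik∂_x`. -/
def laxY (k : ℂ) (f : ST → ℂ) (p : ST) : ℂ :=
  pd ey f p - pd ex (pd ex f) p - 2 * Complex.I * k * pd ex f p

/-- `∂_t + 4∂_x³ + 12ik∂_x² - 12k²∂_x + 6q(∂_x + ik)`. -/
def laxT (q : ST → ℂ) (k : ℂ) (f : ST → ℂ) (p : ST) : ℂ :=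
  pd et f p + 4 * pd ex (pd ex (pd ex f)) p + 12 * Complex.I * k * pd ex (pd ex f) p
    - 12 * k ^ 2 * pd ex f p + 6 * q p * (pd ex f p + Complex.I * k * f p)

/-- `E` as a function on space-time. -/
def expE (k l : ℂ) (p : ST) : ℂ := E p.1 p.2.1 p.2.2 k l

lemma contDiff_expE (k l : ℂ) {n : WithTop ℕ∞} : ContDiff ℝ n (expE k l) := by
  have hr : ContDiff ℝ n (fun s : ℝ => (s : ℂ)) := Complex.ofRealCLM.contDiff
  have h1 : ContDiff ℝ n (fun p : ST => (p.1 : ℂ)) := hr.comp contDiff_fst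
  have h2 : ContDiff ℝ n (fun p : ST => (p.2.1 : ℂ)) := hr.comp contDiff_snd.fst
  have h3 : ContDiff ℝ n (fun p : ST => (p.2.2 : ℂ)) := hr.comp contDiff_snd.snd
  unfold expE E
  exact (((contDiff_const.mul h1).sub (contDiff_const.mul h2)).add (contDiff_const.mul h3)).cexp

lemma differentiableAt_expE (k l : ℂ) (p : ST) : DifferentiableAt ℝ (expE k l) p :=
  (contDiff_expE k l (n := 1)).differentiable (by simp) p

lemma pd_expE_ex (k l : ℂ) (p : ST) : pd ex (expE k l) p = Complex.I * l * expE k l p := by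
  refine (hasDerivAt_slice_x (differentiableAt_expE k l p)).unique ?_
  have h : HasDerivAt (fun s : ℝ => (s : ℂ)) 1 p.1 := Complex.ofRealCLM.hasDerivAt
  simpa [expE, E, mul_comm] using
    (((h.const_mul (Complex.I * l)).sub_const (l * (l + 2 * k) * p.2.1)).add_const
      (disp k l * p.2.2)).cexp

lemma pd_expE_ey (k l : ℂ) (p : ST) :
    pd ey (expE k l) p = -(l * (l + 2 * k)) * expE k l p := by
  refine (hasDerivAt_slice_y (differentiableAt_expE k l p)).unique ?_
  have h : HasDerivAt (fun s : ℝ => (s : ℂ)) 1 p.2.1 := Complex.ofRealCLM.hasDerivAt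
  simpa [expE, E, mul_comm] using
    (((h.const_mul (l * (l + 2 * k))).const_sub (Complex.I * l * p.1)).add_const
      (disp k l * p.2.2)).cexp

lemma pd_expE_et (k l : ℂ) (p : ST) : pd et (expE k l) p = disp k l * expE k l p := by
  refine (hasDerivAt_slice_t (differentiableAt_expE k l p)).unique ?_
  have h : HasDerivAt (fun s : ℝ => (s : ℂ)) 1 p.2.2 := Complex.ofRealCLM.hasDerivAt
  simpa [expE, E, mul_comm] using
    ((h.const_mul (disp k l)).const_add (Complex.I * l * p.1 - l * (l + 2 * k) * p.2.1)).cexp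

/-! ### Conjugation of the Lax operators by the exponentials -/

section gauge

variable {Ω : Set ST} {f : ST → ℂ} {q : ST → ℂ}

/-- Conjugation by `E` turns `∂_x` into `∂_x + il`; the higher orders below are the powers of this
shifted operator. -/
lemma pd_ex_expE_mul (k l : ℂ) (hΩ : IsOpen Ω) (hf : ContDiffOn ℝ (1 : ℕ∞) f Ω) :
    EqOn (pd ex (fun p => expE k l p * f p))
      (fun p => expE k l p * (pd ex f p + Complex.I * l * f p)) Ω := by
  intro p hp
  have h1 := differentiableAt_of_contDiffOn hf hΩ le_rfl hp
  simp only
  rw [pd_mul (differentiableAt_expE k l p) h1, pd_expE_ex]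
  ring

lemma contDiffOn_pd_add {n m : ℕ∞} (c : ℂ) (hΩ : IsOpen Ω) (hf : ContDiffOn ℝ n f Ω)
    (hm : m + 1 ≤ n) : ContDiffOn ℝ m (fun p => pd ex f p + c * f p) Ω :=
  (contDiffOn_pd hf hΩ hm).add
    (contDiffOn_const.mul (hf.of_le (by exact_mod_cast le_self_add.trans hm)))

lemma pd_ex_shift (c : ℂ) (hΩ : IsOpen Ω) (hf : ContDiffOn ℝ (2 : ℕ∞) f Ω) :
    EqOn (pd ex (fun p => pd ex f p + c * f p))
      (fun p => pd ex (pd ex f) p + c * pd ex f p) Ω := by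
  intro p hp
  have h1 := differentiableAt_of_contDiffOn hf hΩ (by norm_num) hp
  have h2 := differentiableAt_of_contDiffOn
    (contDiffOn_pd (v := ex) hf hΩ (m := 1) (by norm_num)) hΩ le_rfl hp
  simp only
  rw [pd_add h2 (h1.const_mul c), pd_const_mul c h1]

lemma pd_ex_ex_expE_mul (k l : ℂ) (hΩ : IsOpen Ω) (hf : ContDiffOn ℝ (2 : ℕ∞) f Ω) :
    EqOn (pd ex (pd ex (fun p => expE k l p * f p)))
      (fun p => expE k l p * (pd ex (pd ex f) p + 2 * Complex.I * l * pd ex f p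
        - l ^ 2 * f p)) Ω := by
  intro p hp
  rw [pd_congr hΩ (pd_ex_expE_mul k l hΩ (hf.of_le (by norm_num))) hp,
    pd_ex_expE_mul k l hΩ (contDiffOn_pd_add _ hΩ hf (by norm_num)) hp]
  simp only
  rw [pd_ex_shift _ hΩ hf hp]
  linear_combination (expE k l p * l ^ 2 * f p) * Complex.I_sq

lemma pd_ex_ex_ex_expE_mul (k l : ℂ) (hΩ : IsOpen Ω) (hf : ContDiffOn ℝ (3 : ℕ∞) f Ω) :
    EqOn (pd ex (pd ex (pd ex (fun p => expE k l p * f p))))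
      (fun p => expE k l p * (pd ex (pd ex (pd ex f)) p + 3 * Complex.I * l * pd ex (pd ex f) p
        - 3 * l ^ 2 * pd ex f p - Complex.I * l ^ 3 * f p)) Ω := by
  intro p hp
  have hs := contDiffOn_pd_add (Complex.I * l) hΩ hf (m := 2) (by norm_num)
  have h1 := pd_congr (v := ex) hΩ (pd_ex_expE_mul k l hΩ (hf.of_le (by norm_num)))
  rw [pd_congr hΩ h1 hp, pd_ex_ex_expE_mul k l hΩ hs hp]
  simp only
  have h2 := pd_ex_shift (Complex.I * l) hΩ (hf.of_le (by norm_num))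
  have h3 := pd_ex_shift (Complex.I * l) hΩ
    (contDiffOn_pd (v := ex) hf hΩ (m := 2) (by norm_num))
  have h4 : pd ex (pd ex (fun p => pd ex f p + Complex.I * l * f p)) p
      = pd ex (pd ex (pd ex f)) p + Complex.I * l * pd ex (pd ex f) p := by
    rw [pd_congr hΩ h2 hp, h3 hp]
  rw [h2 hp, h4]
  linear_combination (expE k l p * (2 * l ^ 2 * pd ex f p)) * Complex.I_sq

/-- Multiplication by `E(k,l)` intertwines the operators at `k + l` and at `k`. -/
lemma laxY_expE_mul (k l : ℂ) (hΩ : IsOpen Ω) (hf : ContDiffOn ℝ (2 : ℕ∞) f Ω) :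
    EqOn (laxY k (fun p => expE k l p * f p)) (fun p => expE k l p * laxY (k + l) f p) Ω := by
  intro p hp
  have h1 := differentiableAt_of_contDiffOn hf hΩ (by norm_num) hp
  simp only [laxY]
  rw [pd_ex_ex_expE_mul k l hΩ hf hp, pd_ex_expE_mul k l hΩ (hf.of_le (by norm_num)) hp,
    pd_mul (differentiableAt_expE k l p) h1, pd_expE_ey]
  simp only
  -- The first-order terms combine to `-2i(k + l) f_x`, and those without derivatives of `f` cancel:
  -- `-l(l + 2k) + l² + 2kl = 0`, that is, `E(k,l)` itself is annihilated by `laxY k`.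
  linear_combination (-2 * expE k l p * k * l * f p) * Complex.I_sq

lemma laxT_expE_mul (k l : ℂ) (hΩ : IsOpen Ω) (hf : ContDiffOn ℝ (3 : ℕ∞) f Ω) :
    EqOn (laxT q k (fun p => expE k l p * f p)) (fun p => expE k l p * laxT q (k + l) f p) Ω := by
  intro p hp
  have h1 := differentiableAt_of_contDiffOn hf hΩ (by norm_num) hp
  simp only [laxT]
  rw [pd_ex_ex_ex_expE_mul k l hΩ hf hp, pd_ex_ex_expE_mul k l hΩ (hf.of_le (by norm_num)) hp,
    pd_ex_expE_mul k l hΩ (hf.of_le (by norm_num)) hp,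
    pd_mul (differentiableAt_expE k l p) h1, pd_expE_et, disp]
  simp only
  -- The dispersion relation enters here: `disp k l = 4il³ + 12ikl² + 12ik²l` cancels what `4∂_x³ +
  -- 12ik∂_x² - 12k²∂_x` produces on `E`. In the `q`-term, `∂_x + ik` becomes `∂_x + i(k + l)`.
  linear_combination (24 * expE k l p * k * l * pd ex f p) * Complex.I_sq

end gauge

/-! ### Weak forms of the Lax operators -/

section weak

variable {Ω : Set ST} {f q φ : ST → ℂ}

lemma integral_linear_three {f₁ f₂ f₃ : ST → ℂ} (h₁ : Integrable f₁) (h₂ : Integrable f₂)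
    (h₃ : Integrable f₃) (c₁ c₂ c₃ : ℂ) :
    Integrable (fun p => c₁ * f₁ p + c₂ * f₂ p + c₃ * f₃ p) ∧
      ∫ p, (c₁ * f₁ p + c₂ * f₂ p + c₃ * f₃ p)
        = c₁ * (∫ p, f₁ p) + c₂ * (∫ p, f₂ p) + c₃ * ∫ p, f₃ p := by
  have i₁ := h₁.const_mul c₁
  have i₂ := h₂.const_mul c₂
  have i₃ := h₃.const_mul c₃
  have i₁₂ : Integrable (fun p => c₁ * f₁ p + c₂ * f₂ p) := i₁.add i₂
  refine ⟨i₁₂.add i₃, ?_⟩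
  rw [integral_add i₁₂ i₃, integral_add i₁ i₂]
  simp only [integral_const_mul]

/-- The weak form of `laxY`. -/
lemma integral_mul_laxY (k : ℂ) (hΩ : IsOpen Ω) (hf : ContDiffOn ℝ (2 : ℕ∞) f Ω)
    (hφ : IsTest Ω 2 φ) :
    ∫ p, φ p * laxY k f p
      = ∫ p, ((-pd ey φ p - pd ex (pd ex φ) p) + k * (2 * Complex.I * pd ex φ p)) * f p := by
  have hf1 : ContDiffOn ℝ (1 : ℕ∞) f Ω := hf.of_le (by norm_num)
  have hx : ContDiffOn ℝ (1 : ℕ∞) (pd ex f) Ω := contDiffOn_pd hf hΩ (by norm_num)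
  have hxx : ContDiffOn ℝ (0 : ℕ∞) (pd ex (pd ex f)) Ω := contDiffOn_pd hx hΩ (by norm_num)
  have hy : ContDiffOn ℝ (0 : ℕ∞) (pd ey f) Ω := contDiffOn_pd hf1 hΩ (by norm_num)
  have tx := hφ.pd ex (m := 1) (by norm_num)
  have ty := hφ.pd ey (m := 1) (by norm_num)
  have txx := tx.pd ex (m := 0) (by norm_num)
  have e1 := hφ.integral_mul_pd hΩ (by norm_num) hf1 ey
  have e2 := hφ.integral_mul_pd hΩ (by norm_num) hf1 ex
  have e3 := hφ.integral_mul_pd hΩ (by norm_num) hx ex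
  have e4 := tx.integral_mul_pd hΩ (by norm_num) hf1 ex
  have l1 := (integral_linear_three (hφ.integrable_mul hΩ hy.continuousOn)
    (hφ.integrable_mul hΩ hxx.continuousOn) (hφ.integrable_mul hΩ hx.continuousOn)
    1 (-1) (-2 * Complex.I * k)).2
  have l2 := (integral_linear_three (ty.integrable_mul hΩ hf.continuousOn)
    (txx.integrable_mul hΩ hf.continuousOn) (tx.integrable_mul hΩ hf.continuousOn)
    (-1) (-1) (2 * Complex.I * k)).2
  rw [e1, e2, e3, e4] at l1
  calc _ = _ := integral_congr_ae (ae_of_all _ fun p => by simp only [laxY]; ring)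
    _ = _ := l1
    _ = _ := by ring
    _ = _ := l2.symm
    _ = _ := integral_congr_ae (ae_of_all _ fun p => by simp only; ring)

/-- The weak form of `laxT`. -/
lemma integral_mul_laxT (k : ℂ) (hΩ : IsOpen Ω) (hf : ContDiffOn ℝ (3 : ℕ∞) f Ω)
    (hq : ContDiffOn ℝ (1 : ℕ∞) q Ω) (hφ : IsTest Ω 3 φ) :
    ∫ p, φ p * laxT q k f p
      = ∫ p, ((-pd et φ p - 4 * pd ex (pd ex (pd ex φ)) p - 6 * pd ex (fun z => q z * φ z) p)
          + k * (12 * Complex.I * pd ex (pd ex φ) p + 6 * Complex.I * (q p * φ p))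
          + k ^ 2 * (12 * pd ex φ p)) * f p := by
  have hf1 : ContDiffOn ℝ (1 : ℕ∞) f Ω := hf.of_le (by norm_num)
  have hx : ContDiffOn ℝ (2 : ℕ∞) (pd ex f) Ω := contDiffOn_pd hf hΩ (by norm_num)
  have hx1 : ContDiffOn ℝ (1 : ℕ∞) (pd ex f) Ω := hx.of_le (by norm_num)
  have hxx : ContDiffOn ℝ (1 : ℕ∞) (pd ex (pd ex f)) Ω := contDiffOn_pd hx hΩ (by norm_num)
  have hxxx : ContDiffOn ℝ (0 : ℕ∞) (pd ex (pd ex (pd ex f))) Ω :=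
    contDiffOn_pd hxx hΩ (by norm_num)
  have ht : ContDiffOn ℝ (0 : ℕ∞) (pd et f) Ω := contDiffOn_pd hf1 hΩ (by norm_num)
  have tx := hφ.pd ex (m := 2) (by norm_num)
  have tt := hφ.pd et (m := 1) (by norm_num)
  have txx := tx.pd ex (m := 1) (by norm_num)
  have txxx := txx.pd ex (m := 0) (by norm_num)
  -- The coefficient `q` is absorbed into the test function, so that integrating `6 q f_x` by parts
  -- puts the derivative on `q φ`.
  have tq := (hφ.of_le (m := 1) (by norm_num)).mul_left hΩ hq
  have tqx := tq.pd ex (m := 0) (by norm_num)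
  have e1 := hφ.integral_mul_pd hΩ (by norm_num) hf1 et
  have e2 := hφ.integral_mul_pd hΩ (by norm_num) hf1 ex
  have e3 := hφ.integral_mul_pd hΩ (by norm_num) hx1 ex
  have e4 := tx.integral_mul_pd hΩ (by norm_num) hf1 ex
  have e5 := hφ.integral_mul_pd hΩ (by norm_num) hxx ex
  have e6 := tx.integral_mul_pd hΩ (by norm_num) hx1 ex
  have e7 := txx.integral_mul_pd hΩ (by norm_num) hf1 ex
  have e8 := tq.integral_mul_pd hΩ (by norm_num) hf1 ex
  obtain ⟨a1, l1⟩ := integral_linear_three (hφ.integrable_mul hΩ ht.continuousOn)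
    (hφ.integrable_mul hΩ hxxx.continuousOn) (hφ.integrable_mul hΩ hxx.continuousOn)
    1 4 (12 * Complex.I * k)
  obtain ⟨a2, l2⟩ := integral_linear_three (hφ.integrable_mul hΩ hx.continuousOn)
    (tq.integrable_mul hΩ hx.continuousOn) (tq.integrable_mul hΩ hf.continuousOn)
    (-12 * k ^ 2) 6 (6 * Complex.I * k)
  obtain ⟨b1, m1⟩ := integral_linear_three (tt.integrable_mul hΩ hf.continuousOn)
    (txxx.integrable_mul hΩ hf.continuousOn) (tqx.integrable_mul hΩ hf.continuousOn)
    (-1) (-4) (-6)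
  obtain ⟨b2, m2⟩ := integral_linear_three (txx.integrable_mul hΩ hf.continuousOn)
    (tq.integrable_mul hΩ hf.continuousOn) (tx.integrable_mul hΩ hf.continuousOn)
    (12 * Complex.I * k) (6 * Complex.I * k) (12 * k ^ 2)
  have l := integral_add a1 a2
  have m := integral_add b1 b2
  rw [l1, l2, e1, e2, e3, e4, e5, e6, e7, e8] at l
  rw [m1, m2] at m
  calc _ = _ := integral_congr_ae (ae_of_all _ fun p => by simp only [laxT]; ring)
    _ = _ := l
    _ = _ := by ring
    _ = _ := m.symm
    _ = _ := integral_congr_ae (ae_of_all _ fun p => by simp only; ring)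

end weak

/-! ### Integral operators of Cauchy type in the spectral parameter -/

/-- The two closed half-planes, the upper one labelled `true` and the lower one `false`. -/
def spec : Set (Bool × ℂ) := {w | (w.1 = true → 0 ≤ w.2.im) ∧ (w.1 = false → w.2.im ≤ 0)}

lemma measurableSet_spec : MeasurableSet spec := by
  have h1 : MeasurableSet {w : Bool × ℂ | w.1 = true → 0 ≤ w.2.im} := by
    have : {w : Bool × ℂ | w.1 = true → 0 ≤ w.2.im}
        = (Prod.fst ⁻¹' {true})ᶜ ∪ {w | 0 ≤ w.2.im} := by
      ext w; simp only [mem_ofPred_eq, mem_union, mem_compl_iff, mem_preimage, mem_singleton_iff]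
      tauto
    rw [this]
    exact (measurable_fst (measurableSet_singleton true)).compl.union
      (measurableSet_le measurable_const (Complex.measurable_im.comp measurable_snd))
  have h2 : MeasurableSet {w : Bool × ℂ | w.1 = false → w.2.im ≤ 0} := by
    have : {w : Bool × ℂ | w.1 = false → w.2.im ≤ 0}
        = (Prod.fst ⁻¹' {false})ᶜ ∪ {w | w.2.im ≤ 0} := by
      ext w; simp only [mem_ofPred_eq, mem_union, mem_compl_iff, mem_preimage, mem_singleton_iff]
      tauto
    rw [this]
    exact (measurable_fst (measurableSet_singleton false)).compl.union
      (measurableSet_le (Complex.measurable_im.comp measurable_snd) measurable_const)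
  exact h1.inter h2

/-- The data of an operator `f ↦ ∫ c(z) (ν(z) - k)⁻¹ E(ν(z), l(z)) f(ν(z) + l(z)) dz`. -/
structure Kernel (Ω : Set ST) (Z : Type*) [MeasurableSpace Z] where
  m : Measure Z
  c : Z → ℂ
  ν : Z → ℂ
  l : Z → ℂ
  side : Z → Bool
  sfinite : SFinite m
  measurable_ν : Measurable ν
  measurable_l : Measurable l
  measurable_side : Measurable side
  mem_spec : ∀ z, (side z, ν z + l z) ∈ spec
  norm_expE_le : ∀ p ∈ Ω, ∀ z, c z ≠ 0 → ‖expE (ν z) (l z) p‖ ≤ 1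
  integrable : ∀ k : ℂ, k.im ≠ 0 → Integrable (fun z => c z / (ν z - k)) m
  ne : ∀ k : ℂ, k.im ≠ 0 → ∀ᵐ z ∂m, ν z ≠ k

/-- Families `f(p, k)` continuous in all variables and bounded in `k`, locally uniformly in `p`. -/
structure Admissible (Ω : Set ST) (f : ST → Bool × ℂ → ℂ) : Prop where
  continuousOn : ContinuousOn (fun w : ST × (Bool × ℂ) => f w.1 w.2) (Ω ×ˢ spec)
  bounded : ∀ K ⊆ Ω, IsCompact K → ∃ C, ∀ p ∈ K, ∀ w ∈ spec, ‖f p w‖ ≤ C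

lemma Admissible.continuousOn_left {Ω : Set ST} {f : ST → Bool × ℂ → ℂ} (hf : Admissible Ω f)
    {w : Bool × ℂ} (hw : w ∈ spec) : ContinuousOn (fun p => f p w) Ω :=
  hf.continuousOn.comp (f := fun p => (p, w)) (by fun_prop) fun _ hp => ⟨hp, hw⟩

lemma Admissible.continuousOn_right {Ω : Set ST} {f : ST → Bool × ℂ → ℂ} (hf : Admissible Ω f)
    {p : ST} (hp : p ∈ Ω) : ContinuousOn (f p) spec :=
  hf.continuousOn.comp (f := fun w => (p, w)) (by fun_prop) fun _ hw => ⟨hp, hw⟩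

lemma Admissible.sub {Ω : Set ST} {f g : ST → Bool × ℂ → ℂ} (hf : Admissible Ω f)
    (hg : Admissible Ω g) : Admissible Ω (fun p w => f p w - g p w) where
  continuousOn := hf.continuousOn.sub hg.continuousOn
  bounded K hK hc := by
    obtain ⟨C, hC⟩ := hf.bounded K hK hc
    obtain ⟨C', hC'⟩ := hg.bounded K hK hc
    exact ⟨C + C', fun p hp w hw =>
      (norm_sub_le _ _).trans (add_le_add (hC p hp w hw) (hC' p hp w hw))⟩

lemma Admissible.mul_left {Ω : Set ST} {f : ST → Bool × ℂ → ℂ} (hf : Admissible Ω f)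
    {W : ST → ℂ} (hW : ContinuousOn W Ω) : Admissible Ω (fun p w => W p * f p w) where
  continuousOn := (hW.comp continuousOn_fst fun _ h => h.1).mul hf.continuousOn
  bounded K hK hc := by
    obtain ⟨C, hC⟩ := hf.bounded K hK hc
    obtain ⟨C', hC'⟩ := hc.exists_bound_of_continuousOn (hW.mono hK)
    refine ⟨C' * C, fun p hp w hw => ?_⟩
    rw [norm_mul]
    exact mul_le_mul (hC' p hp) (hC p hp w hw) (norm_nonneg _)
      ((norm_nonneg _).trans (hC' p hp))

namespace Kernel

variable {Ω : Set ST} {Z : Type*} [MeasurableSpace Z] (κ : Kernel Ω Z)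
  {f g μ G : ST → Bool × ℂ → ℂ} {φ a b d : ST → ℂ} {k : ℂ} {p : ST}

attribute [instance] Kernel.sfinite

/-- The point at which the operator evaluates its argument. -/
def pt (z : Z) : Bool × ℂ := (κ.side z, κ.ν z + κ.l z)

lemma measurable_pt : Measurable κ.pt :=
  κ.measurable_side.prodMk (κ.measurable_ν.add κ.measurable_l)

/-- `E(ν(z), l(z)) f(ν(z) + l(z))`. -/
def wave (f : ST → Bool × ℂ → ℂ) (z : Z) (p : ST) : ℂ := expE (κ.ν z) (κ.l z) p * f p (κ.pt z)

/-- `∫ c(z) (ν(z) - k)⁻¹ E(ν(z), l(z)) f(ν(z) + l(z)) dz`. -/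
def op (f : ST → Bool × ℂ → ℂ) (p : ST) (k : ℂ) : ℂ :=
  ∫ z, κ.c z / (κ.ν z - k) * κ.wave f z p ∂κ.m

lemma measurable_expE : Measurable (fun w : ST × Z => expE (κ.ν w.2) (κ.l w.2) w.1) := by
  have h1 := κ.measurable_ν
  have h2 := κ.measurable_l
  unfold expE E disp
  fun_prop

/-- The exponential is bounded only where the density is nonzero; elsewhere the integrand vanishes
anyway. -/
lemma norm_le {C : ℝ} {z : Z} (hp : p ∈ Ω) (hC : ∀ w ∈ spec, ‖f p w‖ ≤ C) :
    ‖κ.c z / (κ.ν z - k) * κ.wave f z p‖ ≤ ‖κ.c z / (κ.ν z - k)‖ * C := by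
  by_cases hc : κ.c z = 0
  · simp [hc]
  · rw [norm_mul, wave, norm_mul]
    refine mul_le_mul_of_nonneg_left ?_ (norm_nonneg _)
    have h1 := κ.norm_expE_le p hp z hc
    have h2 := hC _ (κ.mem_spec z)
    calc _ ≤ 1 * ‖f p (κ.pt z)‖ := mul_le_mul_of_nonneg_right h1 (norm_nonneg _)
      _ ≤ C := by rw [one_mul]; exact h2

/-- Nothing is known about `f` outside `Ω ×ˢ spec`, so joint measurability, needed for Fubini's
theorem, is obtained for the extension by zero. -/
lemma measurable_indicator (hΩ : IsOpen Ω) (hf : Admissible Ω f) :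
    Measurable (fun w : ST × Z =>
      (Ω ×ˢ spec).indicator (fun w : ST × (Bool × ℂ) => f w.1 w.2) (w.1, κ.pt w.2)) := by
  classical
  have h : Measurable ((Ω ×ˢ spec).indicator (fun w : ST × (Bool × ℂ) => f w.1 w.2)) := by
    rw [← piecewise_eq_indicator]
    exact hf.continuousOn.measurable_piecewise continuousOn_const
      (hΩ.measurableSet.prod measurableSet_spec)
  exact h.comp (measurable_fst.prodMk (κ.measurable_pt.comp measurable_snd))

lemma aestronglyMeasurable_wave (hΩ : IsOpen Ω) (hf : Admissible Ω f) (hp : p ∈ Ω) :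
    AEStronglyMeasurable (fun z => κ.wave f z p) κ.m := by
  have h := κ.measurable_expE.mul (κ.measurable_indicator hΩ hf)
  have h' : Measurable (fun z => κ.wave f z p) := by
    convert h.comp (measurable_prodMk_left (x := p)) using 2 with z
    simp only [Function.comp, wave, Pi.mul_apply]
    rw [indicator_of_mem (show (p, κ.pt z) ∈ Ω ×ˢ spec from ⟨hp, κ.mem_spec z⟩)]
  exact h'.aestronglyMeasurable

lemma integrable_op (hΩ : IsOpen Ω) (hf : Admissible Ω f) (hp : p ∈ Ω) (hk : k.im ≠ 0) :
    Integrable (fun z => κ.c z / (κ.ν z - k) * κ.wave f z p) κ.m := by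
  obtain ⟨C, hC⟩ := hf.bounded {p} (singleton_subset_iff.2 hp) isCompact_singleton
  refine Integrable.mono' ((κ.integrable k hk).norm.mul_const C)
    ((κ.integrable k hk).aestronglyMeasurable.mul (κ.aestronglyMeasurable_wave hΩ hf hp)) ?_
  exact ae_of_all _ fun z => κ.norm_le hp (hC p rfl)

lemma op_sub (hΩ : IsOpen Ω) (hf : Admissible Ω f) (hg : Admissible Ω g) (hp : p ∈ Ω)
    (hk : k.im ≠ 0) : κ.op (fun p w => f p w - g p w) p k = κ.op f p k - κ.op g p k := by
  unfold op
  rw [← integral_sub (κ.integrable_op hΩ hf hp hk) (κ.integrable_op hΩ hg hp hk)]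
  refine integral_congr_ae (ae_of_all _ fun z => ?_)
  simp only [wave]; ring

lemma op_mul_left (W : ST → ℂ) : κ.op (fun p w => W p * f p w) p k = W p * κ.op f p k := by
  unfold op
  rw [← integral_const_mul]
  refine integral_congr_ae (ae_of_all _ fun z => ?_)
  simp only [wave]; ring

/-- Dominated convergence: the bound on `f` is uniform on a compact neighbourhood of the point, and
`|E| ≤ 1` on the carrier of the density. -/
lemma continuousOn_op (hΩ : IsOpen Ω) (hf : Admissible Ω f) (hk : k.im ≠ 0) :
    ContinuousOn (fun p => κ.op f p k) Ω := by
  intro p hp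
  obtain ⟨K, hK, hpK, hKΩ⟩ := exists_compact_subset hΩ hp
  obtain ⟨C, hC⟩ := hf.bounded K hKΩ hK
  have hnh : K ∈ 𝓝 p := mem_interior_iff_mem_nhds.1 hpK
  refine ContinuousAt.continuousWithinAt ?_
  unfold op
  refine continuousAt_of_dominated (bound := fun z => ‖κ.c z / (κ.ν z - k)‖ * C) ?_ ?_
    ((κ.integrable k hk).norm.mul_const C) ?_
  · filter_upwards [hΩ.mem_nhds hp] with x hx
    exact (κ.integrable_op hΩ hf hx hk).aestronglyMeasurable
  · filter_upwards [hnh] with x hx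
    exact ae_of_all _ fun z => κ.norm_le (hKΩ hx) (hC x hx)
  · refine ae_of_all _ fun z => ContinuousAt.mul continuousAt_const ?_
    exact (contDiff_expE _ _ (n := 0)).continuous.continuousAt.mul
      ((hf.continuousOn_left (κ.mem_spec z)).continuousAt (hΩ.mem_nhds hp))

/-- The hypothesis of Fubini's theorem. The integrand is dominated by the tensor product of `|φ|`
and `|c / (ν - k)|`, because `f` is bounded uniformly in `k` over the compact support of `φ`. -/
lemma integrable_prod (hΩ : IsOpen Ω) (hf : Admissible Ω f) (hφ : IsTest Ω 0 φ) (hk : k.im ≠ 0) :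
    Integrable (fun w : ST × Z => φ w.1 * (κ.c w.2 / (κ.ν w.2 - k) * κ.wave f w.2 w.1))
      (volume.prod κ.m) := by
  obtain ⟨C, hC⟩ := hf.bounded _ hφ.subset hφ.compact
  have hdom : Integrable (fun w : ST × Z => (‖φ w.1‖ * C) * ‖κ.c w.2 / (κ.ν w.2 - k)‖)
      (volume.prod κ.m) :=
    (hφ.integrable.norm.mul_const C).mul_prod (κ.integrable k hk).norm
  have hmeas : AEStronglyMeasurable
      (fun w : ST × Z => φ w.1 * (κ.c w.2 / (κ.ν w.2 - k)) * (expE (κ.ν w.2) (κ.l w.2) w.1 *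
        (Ω ×ˢ spec).indicator (fun w : ST × (Bool × ℂ) => f w.1 w.2) (w.1, κ.pt w.2)))
      (volume.prod κ.m) :=
    (hφ.integrable.mul_prod (κ.integrable k hk)).aestronglyMeasurable.mul
      (κ.measurable_expE.mul (κ.measurable_indicator hΩ hf)).aestronglyMeasurable
  refine Integrable.mono' hdom (hmeas.congr (ae_of_all _ fun w => ?_)) (ae_of_all _ fun w => ?_)
  · by_cases hw : w.1 ∈ tsupport φ
    · simp only [wave]
      rw [indicator_of_mem
        (show (w.1, κ.pt w.2) ∈ Ω ×ˢ spec from ⟨hφ.subset hw, κ.mem_spec w.2⟩)]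
      ring
    · simp [image_eq_zero_of_notMem_tsupport hw]
  · by_cases hw : w.1 ∈ tsupport φ
    · rw [norm_mul, mul_assoc, mul_comm C]
      exact mul_le_mul_of_nonneg_left (κ.norm_le (hφ.subset hw) (hC _ hw)) (norm_nonneg _)
    · simp [image_eq_zero_of_notMem_tsupport hw]

lemma integrable_mul_op (hΩ : IsOpen Ω) (hf : Admissible Ω f) (hφ : IsTest Ω 0 φ)
    (hk : k.im ≠ 0) : Integrable (fun p => φ p * κ.op f p k) := by
  have := (κ.integrable_prod hΩ hf hφ hk).integral_prod_left
  simpa only [integral_const_mul, op] using this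

lemma integrable_pairing (hΩ : IsOpen Ω) (hf : Admissible Ω f) (hφ : IsTest Ω 0 φ)
    (hk : k.im ≠ 0) :
    Integrable (fun z => κ.c z / (κ.ν z - k) * ∫ p, φ p * κ.wave f z p) κ.m := by
  have := (κ.integrable_prod hΩ hf hφ hk).integral_prod_right
  refine this.congr (ae_of_all _ fun z => ?_)
  simp only
  rw [← integral_const_mul]
  exact integral_congr_ae (ae_of_all _ fun p => by simp only; ring)

lemma integral_mul_op (hΩ : IsOpen Ω) (hf : Admissible Ω f) (hφ : IsTest Ω 0 φ)
    (hk : k.im ≠ 0) :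
    ∫ p, φ p * κ.op f p k = ∫ z, κ.c z / (κ.ν z - k) * (∫ p, φ p * κ.wave f z p) ∂κ.m := by
  have h1 := integral_integral_swap
    (f := fun p z => φ p * (κ.c z / (κ.ν z - k) * κ.wave f z p)) (κ.integrable_prod hΩ hf hφ hk)
  simp only [integral_const_mul] at h1
  refine h1.trans (integral_congr_ae (ae_of_all _ fun z => ?_))
  simp only
  rw [← integral_const_mul]
  exact integral_congr_ae (ae_of_all _ fun p => by simp only; ring)

lemma continuousOn_wave (hf : Admissible Ω f) (z : Z) : ContinuousOn (κ.wave f z) Ω :=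
  (contDiff_expE _ _ (n := 0)).continuous.continuousOn.mul (hf.continuousOn_left (κ.mem_spec z))

lemma integral_quadratic {F : ST → ℂ} (hΩ : IsOpen Ω) (ha : IsTest Ω 0 a) (hb : IsTest Ω 0 b)
    (hd : IsTest Ω 0 d) (hF : ContinuousOn F Ω) (k : ℂ) :
    ∫ p, (a p + k * b p + k ^ 2 * d p) * F p
      = (∫ p, a p * F p) + k * (∫ p, b p * F p) + k ^ 2 * ∫ p, d p * F p := by
  have h := (integral_linear_three (ha.integrable_mul hΩ hF) (hb.integrable_mul hΩ hF)
    (hd.integrable_mul hΩ hF) 1 k (k ^ 2)).2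
  rw [one_mul] at h
  rw [← h]
  exact integral_congr_ae (ae_of_all _ fun p => by simp only; ring)

/-- The dressing identity: if `μ = 1 + op μ` and `G` arises from `μ` by an operator depending
quadratically on `k` and compatible with multiplication by `E`, then `G - op G` is a quadratic
polynomial in `k` in the weak sense. -/
theorem integral_mul_sub_op (hΩ : IsOpen Ω) (hμ : Admissible Ω μ) (hG : Admissible Ω G)
    (heq : ∀ p ∈ Ω, ∀ w ∈ spec, w.2.im ≠ 0 → μ p w = 1 + κ.op μ p w.2)
    (hφ : IsTest Ω 0 φ) (ha : IsTest Ω 0 a) (hb : IsTest Ω 0 b) (hd : IsTest Ω 0 d)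
    (h₁ : ∀ w ∈ spec, ∫ p, φ p * G p w = ∫ p, (a p + w.2 * b p + w.2 ^ 2 * d p) * μ p w)
    (h₂ : ∀ z, ∫ p, φ p * κ.wave G z p
      = ∫ p, (a p + κ.ν z * b p + κ.ν z ^ 2 * d p) * κ.wave μ z p)
    {w : Bool × ℂ} (hw : w ∈ spec) (hk : w.2.im ≠ 0) :
    Integrable (fun z => κ.c z * ((∫ p, b p * κ.wave μ z p)
      + (κ.ν z + w.2) * ∫ p, d p * κ.wave μ z p)) κ.m ∧
    ∫ p, φ p * (G p w - κ.op G p w.2)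
      = (∫ p, a p) + w.2 * (∫ p, b p) + w.2 ^ 2 * (∫ p, d p)
        - ∫ z, κ.c z * ((∫ p, b p * κ.wave μ z p)
            + (κ.ν z + w.2) * ∫ p, d p * κ.wave μ z p) ∂κ.m := by
  obtain ⟨s, k⟩ := w
  simp only at hk ⊢
  -- With `k` frozen, the whole quadratic expression is a single test function, to which Fubini's
  -- theorem applies.
  have hψ : IsTest Ω 0 (fun p => a p + k * b p + k ^ 2 * d p) :=
    (ha.add (hb.const_mul hΩ k)).add (hd.const_mul hΩ (k ^ 2))
  have i₁ := κ.integrable_pairing hΩ hμ hψ hk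
  have i₂ := κ.integrable_pairing hΩ hG hφ hk
  -- On the left the coefficients are taken at `ν` for `G` and at `k` for `μ`. The constant parts
  -- cancel, and `(ν - k)⁻¹` times the difference of the rest is `b + (ν + k) d`. The points with `ν
  -- = k` form a null set.
  have hae : ∀ᵐ z ∂κ.m,
      κ.c z / (κ.ν z - k) * (∫ p, φ p * κ.wave G z p)
        - κ.c z / (κ.ν z - k) * (∫ p, (a p + k * b p + k ^ 2 * d p) * κ.wave μ z p)
      = κ.c z * ((∫ p, b p * κ.wave μ z p) + (κ.ν z + k) * ∫ p, d p * κ.wave μ z p) := by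
    filter_upwards [κ.ne k hk] with z hz
    have hz' : κ.ν z - k ≠ 0 := sub_ne_zero.2 hz
    rw [h₂, integral_quadratic hΩ ha hb hd (κ.continuousOn_wave hμ z),
      integral_quadratic hΩ ha hb hd (κ.continuousOn_wave hμ z)]
    field_simp
    ring
  -- The density `c` alone need not be integrable: the right-hand side is integrable as a difference
  -- of two integrable pairings.
  refine ⟨(i₂.sub i₁).congr hae, ?_⟩
  rw [← integral_congr_ae hae, integral_sub i₂ i₁, ← κ.integral_mul_op hΩ hG hφ hk,
    ← κ.integral_mul_op hΩ hμ hψ hk]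
  have e₁ : ∫ p, φ p * (G p (s, k) - κ.op G p k)
      = (∫ p, φ p * G p (s, k)) - ∫ p, φ p * κ.op G p k := by
    rw [← integral_sub (hφ.integrable_mul hΩ (hG.continuousOn_left hw))
      (κ.integrable_mul_op hΩ hG hφ hk)]
    simp only [mul_sub]
  have e₂ : ∫ p, (a p + k * b p + k ^ 2 * d p) * μ p (s, k)
      = (∫ p, (a p + k * b p + k ^ 2 * d p))
        + ∫ p, (a p + k * b p + k ^ 2 * d p) * κ.op μ p k := by
    rw [← integral_add hψ.integrable (κ.integrable_mul_op hΩ hμ hψ hk)]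
    refine integral_congr_ae (ae_of_all _ fun p => ?_)
    by_cases hp : p ∈ tsupport (fun p => a p + k * b p + k ^ 2 * d p)
    · simp only [heq p (hψ.subset hp) (s, k) hw hk]; ring
    · have h0 : a p + k * b p + k ^ 2 * d p = 0 :=
        image_eq_zero_of_notMem_tsupport (f := fun p => a p + k * b p + k ^ 2 * d p) hp
      simp only [h0, zero_mul, add_zero]
  have e₃ := integral_quadratic hΩ ha hb hd (F := fun _ => 1) continuousOn_const k
  simp only [mul_one] at e₃
  rw [e₁, h₁ _ hw, e₂, e₃]
  ring

end Kernel

/-- Continuous functions which agree weakly agree. -/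
lemma eqOn_of_forall_integral_eq {Ω : Set ST} (hΩ : IsOpen Ω) {F G : ST → ℂ}
    (hF : ContinuousOn F Ω) (hG : ContinuousOn G Ω)
    (h : ∀ φ, IsTest Ω ⊤ φ → ∫ p, φ p * F p = ∫ p, φ p * G p) : EqOn F G Ω := by
  have hc : ContinuousOn (fun p => F p - G p) Ω := hF.sub hG
  have hae := hΩ.ae_eq_zero_of_integral_contDiff_smul_eq_zero (μ := volume)
    (hc.locallyIntegrableOn hΩ.measurableSet) (fun g hg hgc hgs => by
      have ht : IsTest Ω ⊤ (fun p => (g p : ℂ)) :=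
        ⟨Complex.ofRealCLM.contDiff.comp hg, hgc.comp_left Complex.ofReal_zero,
          (closure_mono (fun p hp => by simpa using hp) : _ ⊆ tsupport g).trans hgs⟩
      have := h _ ht
      rw [← sub_eq_zero, ← integral_sub (ht.integrable_mul hΩ hF) (ht.integrable_mul hΩ hG)] at this
      rw [← this]
      exact integral_congr_ae (ae_of_all _ fun p => by simp [mul_sub]))
  refine Measure.eqOn_open_of_ae_eq (μ := volume) ?_ hΩ hF hG
  rw [Filter.EventuallyEq, ae_restrict_iff' hΩ.measurableSet]
  filter_upwards [hae] with p hp hpΩ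
  exact sub_eq_zero.1 (hp hpΩ)

/-! ### The operator in the integral equation for `μ` -/

lemma measurableSet_domχ₂ : MeasurableSet domχ₂ := by
  have h1 : MeasurableSet {z : ℝ × ℝ | z.1 < 0} := measurableSet_lt (by fun_prop) (by fun_prop)
  have h2 : MeasurableSet {z : ℝ × ℝ | z.1 < z.2} := measurableSet_lt (by fun_prop) (by fun_prop)
  have h3 : MeasurableSet {z : ℝ × ℝ | z.2 < 0} := measurableSet_lt (by fun_prop) (by fun_prop)
  exact h1.inter (h2.inter h3)

lemma measurableSet_domχ₁ : MeasurableSet domχ₁ := by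
  have h1 : MeasurableSet {z : ℝ × ℝ | 0 < z.1} := measurableSet_lt (by fun_prop) (by fun_prop)
  have h2 : MeasurableSet {z : ℝ × ℝ | z.1 < z.2} := measurableSet_lt (by fun_prop) (by fun_prop)
  exact h1.inter h2

lemma measurableSet_domψ₂ : MeasurableSet domψ₂ := by
  have h1 : MeasurableSet {z : ℝ × ℝ | z.1 < 0} := measurableSet_lt (by fun_prop) (by fun_prop)
  have h2 : MeasurableSet {z : ℝ × ℝ | z.2 < z.1} := measurableSet_lt (by fun_prop) (by fun_prop)
  exact h1.inter h2

lemma measurableSet_domψ₁ : MeasurableSet domψ₁ := by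
  have h1 : MeasurableSet {z : ℝ × ℝ | 0 < z.1} := measurableSet_lt (by fun_prop) (by fun_prop)
  have h2 : MeasurableSet {z : ℝ × ℝ | 0 < z.2} := measurableSet_lt (by fun_prop) (by fun_prop)
  have h3 : MeasurableSet {z : ℝ × ℝ | z.2 < z.1} := measurableSet_lt (by fun_prop) (by fun_prop)
  exact h1.inter (h2.inter h3)

/-- The four open quadrants. -/
def quad₁ : Set ℂ := {ν | 0 < ν.re ∧ 0 < ν.im}
def quad₂ : Set ℂ := {ν | ν.re < 0 ∧ 0 < ν.im}
def quad₃ : Set ℂ := {ν | ν.re < 0 ∧ ν.im < 0}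
def quad₄ : Set ℂ := {ν | 0 < ν.re ∧ ν.im < 0}

lemma measurableSet_re_im :
    MeasurableSet {ν : ℂ | 0 < ν.re} ∧ MeasurableSet {ν : ℂ | ν.re < 0} ∧
    MeasurableSet {ν : ℂ | 0 < ν.im} ∧ MeasurableSet {ν : ℂ | ν.im < 0} :=
  ⟨measurableSet_lt measurable_const Complex.measurable_re,
    measurableSet_lt Complex.measurable_re measurable_const,
    measurableSet_lt measurable_const Complex.measurable_im,
    measurableSet_lt Complex.measurable_im measurable_const⟩

lemma measurableSet_quad₁ : MeasurableSet quad₁ :=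
  measurableSet_re_im.1.inter measurableSet_re_im.2.2.1
lemma measurableSet_quad₂ : MeasurableSet quad₂ :=
  measurableSet_re_im.2.1.inter measurableSet_re_im.2.2.1
lemma measurableSet_quad₃ : MeasurableSet quad₃ :=
  measurableSet_re_im.2.1.inter measurableSet_re_im.2.2.2
lemma measurableSet_quad₄ : MeasurableSet quad₄ :=
  measurableSet_re_im.1.inter measurableSet_re_im.2.2.2

open Classical in
/-- The density of the four jump terms. -/
def jumpC (S : SpectralData) (z : ℝ × ℝ) : ℂ :=
  -Complex.I / Real.pi *
    (if z ∈ domχ₂ then S.χ₂ (z.1 - z.2) (2 * z.2) else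
      if z ∈ domχ₁ then S.χ₁ (z.1 - z.2) (2 * z.2) else
      if z ∈ domψ₂ then S.ψ₂ (z.1 - z.2) (2 * z.2) else
      if z ∈ domψ₁ then S.ψ₁ (z.1 - z.2) (2 * z.2) else 0)

open Classical in
/-- The density of the four area terms. -/
def areaC (S : SpectralData) (ν : ℂ) : ℂ :=
  1 / Real.pi *
    (if ν ∈ quad₁ then S.γp ν else if ν ∈ quad₂ then - S.γp ν else
      if ν ∈ quad₃ then - S.γm ν else if ν ∈ quad₄ then S.γm ν else 0)

/-- A function vanishing off four disjoint sets is the sum of its restrictions to them. -/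
lemma eq_sum_indicator {α : Type*} {A B C D : Set α} (hAB : Disjoint A B) (hAC : Disjoint A C)
    (hAD : Disjoint A D) (hBC : Disjoint B C) (hBD : Disjoint B D) (hCD : Disjoint C D)
    (F : α → ℂ) (h0 : ∀ z, z ∉ A → z ∉ B → z ∉ C → z ∉ D → F z = 0) (z : α) :
    F z = A.indicator F z + B.indicator F z + C.indicator F z + D.indicator F z := by
  rw [Set.disjoint_left] at *
  by_cases hA : z ∈ A
  · simp [hA, hAB hA, hAC hA, hAD hA]
  by_cases hB : z ∈ B
  · simp [hA, hB, hBC hB, hBD hB]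
  by_cases hC : z ∈ C
  · simp [hA, hB, hC, hCD hC]
  by_cases hD : z ∈ D
  · simp [hA, hB, hC, hD]
  · simp [hA, hB, hC, hD, h0 z hA hB hC hD]

lemma integrable_of_four {α : Type*} [MeasurableSpace α] {m : Measure α} {A B C D : Set α}
    (mA : MeasurableSet A) (mB : MeasurableSet B) (mC : MeasurableSet C) (mD : MeasurableSet D)
    (hAB : Disjoint A B) (hAC : Disjoint A C)
    (hAD : Disjoint A D) (hBC : Disjoint B C) (hBD : Disjoint B D) (hCD : Disjoint C D)
    {F : α → ℂ} (h0 : ∀ z, z ∉ A → z ∉ B → z ∉ C → z ∉ D → F z = 0)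
    (iA : IntegrableOn F A m) (iB : IntegrableOn F B m) (iC : IntegrableOn F C m)
    (iD : IntegrableOn F D m) : Integrable F m :=
  (((((integrable_indicator_iff mA).2 iA).add ((integrable_indicator_iff mB).2 iB)).add
    ((integrable_indicator_iff mC).2 iC)).add ((integrable_indicator_iff mD).2 iD)).congr
    (ae_of_all _ fun z => (eq_sum_indicator hAB hAC hAD hBC hBD hCD F h0 z).symm)

lemma integral_eq_four {α : Type*} [MeasurableSpace α] {m : Measure α} {A B C D : Set α}
    (mA : MeasurableSet A) (mB : MeasurableSet B) (mC : MeasurableSet C) (mD : MeasurableSet D)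
    (hAB : Disjoint A B) (hAC : Disjoint A C)
    (hAD : Disjoint A D) (hBC : Disjoint B C) (hBD : Disjoint B D) (hCD : Disjoint C D)
    {F : α → ℂ} (h0 : ∀ z, z ∉ A → z ∉ B → z ∉ C → z ∉ D → F z = 0) (hF : Integrable F m) :
    ∫ z, F z ∂m = (∫ z in A, F z ∂m) + (∫ z in B, F z ∂m) + (∫ z in C, F z ∂m)
      + ∫ z in D, F z ∂m := by
  have iAB : Integrable (fun z => A.indicator F z + B.indicator F z) m :=
    (hF.indicator mA).add (hF.indicator mB)
  have iABC : Integrable (fun z => A.indicator F z + B.indicator F z + C.indicator F z) m :=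
    iAB.add (hF.indicator mC)
  rw [← integral_indicator mA, ← integral_indicator mB, ← integral_indicator mC,
    ← integral_indicator mD, ← integral_add (hF.indicator mA) (hF.indicator mB),
    ← integral_add iAB (hF.indicator mC), ← integral_add iABC (hF.indicator mD)]
  exact integral_congr_ae (ae_of_all _ fun z =>
    eq_sum_indicator hAB hAC hAD hBC hBD hCD F h0 z)

lemma integrableOn_of_eq_const_mul_div {α : Type*} [MeasurableSpace α] {m : Measure α} {D : Set α}
    (hD : MeasurableSet D) {F G c : α → ℂ} (s : ℂ) (hG : IntegrableOn (fun z => G z / c z) D m)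
    (h : ∀ z ∈ D, F z = s * G z) : IntegrableOn (fun z => F z / c z) D m := by
  have hi : IntegrableOn (fun z => s * (G z / c z)) D m := Integrable.const_mul hG s
  exact hi.congr_fun (fun z hz => by simp only [h z hz, mul_div_assoc]) hD

lemma measurableEmbedding_inl {α β : Type*} [MeasurableSpace α] [MeasurableSpace β] :
    MeasurableEmbedding (Sum.inl : α → α ⊕ β) :=
  ⟨Sum.inl_injective, measurable_inl, fun _ hs => measurableSet_inl_image.2 hs⟩

lemma measurableEmbedding_inr {α β : Type*} [MeasurableSpace α] [MeasurableSpace β] :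
    MeasurableEmbedding (Sum.inr : β → α ⊕ β) :=
  ⟨Sum.inr_injective, measurable_inr, fun _ hs => measurableSet_inr_image.2 hs⟩

section disjoint

lemma disjoint_dom : Disjoint domχ₂ domχ₁ ∧ Disjoint domχ₂ domψ₂ ∧ Disjoint domχ₂ domψ₁ ∧
    Disjoint domχ₁ domψ₂ ∧ Disjoint domχ₁ domψ₁ ∧ Disjoint domψ₂ domψ₁ := by
  simp only [Set.disjoint_left, domχ₂, domχ₁, domψ₂, domψ₁, mem_ofPred_eq]
  refine ⟨?_, ?_, ?_, ?_, ?_, ?_⟩ <;> rintro z h h' <;> linarith [h.1, h.2, h'.1, h'.2]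

lemma disjoint_quad : Disjoint quad₁ quad₂ ∧ Disjoint quad₁ quad₃ ∧ Disjoint quad₁ quad₄ ∧
    Disjoint quad₂ quad₃ ∧ Disjoint quad₂ quad₄ ∧ Disjoint quad₃ quad₄ := by
  simp only [Set.disjoint_left, quad₁, quad₂, quad₃, quad₄, mem_ofPred_eq]
  refine ⟨?_, ?_, ?_, ?_, ?_, ?_⟩ <;> rintro z h h' <;> linarith [h.1, h.2, h'.1, h'.2]

end disjoint

section values

variable (S : SpectralData)

lemma jumpC_χ₂ {z : ℝ × ℝ} (hz : z ∈ domχ₂) :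
    jumpC S z = -Complex.I / Real.pi * S.χ₂ (z.1 - z.2) (2 * z.2) := by
  simp [jumpC, hz]

lemma jumpC_χ₁ {z : ℝ × ℝ} (hz : z ∈ domχ₁) :
    jumpC S z = -Complex.I / Real.pi * S.χ₁ (z.1 - z.2) (2 * z.2) := by
  have h1 : z ∉ domχ₂ := Set.disjoint_right.1 disjoint_dom.1 hz
  simp [jumpC, hz, h1]

lemma jumpC_ψ₂ {z : ℝ × ℝ} (hz : z ∈ domψ₂) :
    jumpC S z = -Complex.I / Real.pi * S.ψ₂ (z.1 - z.2) (2 * z.2) := by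
  have h1 : z ∉ domχ₂ := Set.disjoint_right.1 disjoint_dom.2.1 hz
  have h2 : z ∉ domχ₁ := Set.disjoint_right.1 disjoint_dom.2.2.2.1 hz
  simp [jumpC, hz, h1, h2]

lemma jumpC_ψ₁ {z : ℝ × ℝ} (hz : z ∈ domψ₁) :
    jumpC S z = -Complex.I / Real.pi * S.ψ₁ (z.1 - z.2) (2 * z.2) := by
  have h1 : z ∉ domχ₂ := Set.disjoint_right.1 disjoint_dom.2.2.1 hz
  have h2 : z ∉ domχ₁ := Set.disjoint_right.1 disjoint_dom.2.2.2.2.1 hz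
  have h3 : z ∉ domψ₂ := Set.disjoint_right.1 disjoint_dom.2.2.2.2.2 hz
  simp [jumpC, hz, h1, h2, h3]

lemma jumpC_zero {z : ℝ × ℝ} (h1 : z ∉ domχ₂) (h2 : z ∉ domχ₁) (h3 : z ∉ domψ₂)
    (h4 : z ∉ domψ₁) : jumpC S z = 0 := by
  simp [jumpC, h1, h2, h3, h4]

lemma areaC_quad₁ {ν : ℂ} (hν : ν ∈ quad₁) : areaC S ν = 1 / Real.pi * S.γp ν := by
  simp [areaC, hν]

lemma areaC_quad₂ {ν : ℂ} (hν : ν ∈ quad₂) : areaC S ν = -(1 / Real.pi) * S.γp ν := by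
  have h1 : ν ∉ quad₁ := Set.disjoint_right.1 disjoint_quad.1 hν
  simp [areaC, hν, h1]

lemma areaC_quad₃ {ν : ℂ} (hν : ν ∈ quad₃) : areaC S ν = -(1 / Real.pi) * S.γm ν := by
  have h1 : ν ∉ quad₁ := Set.disjoint_right.1 disjoint_quad.2.1 hν
  have h2 : ν ∉ quad₂ := Set.disjoint_right.1 disjoint_quad.2.2.2.1 hν
  simp [areaC, hν, h1, h2]

lemma areaC_quad₄ {ν : ℂ} (hν : ν ∈ quad₄) : areaC S ν = 1 / Real.pi * S.γm ν := by
  have h1 : ν ∉ quad₁ := Set.disjoint_right.1 disjoint_quad.2.2.1 hν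
  have h2 : ν ∉ quad₂ := Set.disjoint_right.1 disjoint_quad.2.2.2.2.1 hν
  have h3 : ν ∉ quad₃ := Set.disjoint_right.1 disjoint_quad.2.2.2.2.2 hν
  simp [areaC, hν, h1, h2, h3]

lemma areaC_zero {ν : ℂ} (h1 : ν ∉ quad₁) (h2 : ν ∉ quad₂) (h3 : ν ∉ quad₃)
    (h4 : ν ∉ quad₄) : areaC S ν = 0 := by
  simp [areaC, h1, h2, h3, h4]

lemma integrable_jumpC (hS : S.Decays) {k : ℂ} (hk : k.im ≠ 0) :
    Integrable (fun z : ℝ × ℝ => jumpC S z / (((z.1 - z.2 : ℝ) : ℂ) - k)) := by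
  obtain ⟨d1, d2, d3, d4, d5, d6⟩ := disjoint_dom
  refine integrable_of_four measurableSet_domχ₂ measurableSet_domχ₁ measurableSet_domψ₂
    measurableSet_domψ₁ d1 d2 d3 d4 d5 d6 (fun z h1 h2 h3 h4 => ?_) ?_ ?_ ?_ ?_
  · rw [jumpC_zero S h1 h2 h3 h4, zero_div]
  · exact integrableOn_of_eq_const_mul_div measurableSet_domχ₂ _ (hS.chi₂ k hk)
      fun z hz => jumpC_χ₂ S hz
  · exact integrableOn_of_eq_const_mul_div measurableSet_domχ₁ _ (hS.chi₁ k hk)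
      fun z hz => jumpC_χ₁ S hz
  · exact integrableOn_of_eq_const_mul_div measurableSet_domψ₂ _ (hS.psi₂ k hk)
      fun z hz => jumpC_ψ₂ S hz
  · exact integrableOn_of_eq_const_mul_div measurableSet_domψ₁ _ (hS.psi₁ k hk)
      fun z hz => jumpC_ψ₁ S hz

lemma integrable_areaC (hS : S.Decays) {k : ℂ} (hk : k.im ≠ 0) :
    Integrable (fun ν : ℂ => areaC S ν / (ν - k)) := by
  obtain ⟨d1, d2, d3, d4, d5, d6⟩ := disjoint_quad
  refine integrable_of_four measurableSet_quad₁ measurableSet_quad₂ measurableSet_quad₃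
    measurableSet_quad₄ d1 d2 d3 d4 d5 d6 (fun z h1 h2 h3 h4 => ?_) ?_ ?_ ?_ ?_
  · rw [areaC_zero S h1 h2 h3 h4, zero_div]
  · exact integrableOn_of_eq_const_mul_div measurableSet_quad₁ _
      ((hS.gammaPlus k hk).mono_set fun z hz => hz.2) fun z hz => areaC_quad₁ S hz
  · exact integrableOn_of_eq_const_mul_div measurableSet_quad₂ _
      ((hS.gammaPlus k hk).mono_set fun z hz => hz.2) fun z hz => areaC_quad₂ S hz
  · exact integrableOn_of_eq_const_mul_div measurableSet_quad₃ _
      ((hS.gammaMinus k hk).mono_set fun z hz => hz.2) fun z hz => areaC_quad₃ S hz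
  · exact integrableOn_of_eq_const_mul_div measurableSet_quad₄ _
      ((hS.gammaMinus k hk).mono_set fun z hz => hz.2) fun z hz => areaC_quad₄ S hz

end values

/-- For `l = -2ν_R` one has `l + 2ν = 2iν_I` and `l² + 3νl + 3ν² = ν_R² - 3ν_I²`, so the exponent is
purely imaginary. -/
lemma norm_expE_area (ν : ℂ) (p : ST) : ‖expE ν (-2 * ν.re) p‖ ≤ 1 := by
  rw [expE, E, Complex.norm_exp]
  refine (Real.exp_le_one_iff.2 (le_of_eq ?_))
  obtain ⟨a, b⟩ := ν
  simp [disp, pow_succ]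
  exact Or.inl (Or.inr (by ring))

/-- Here `ν` and `l` are real, so the `x`- and `t`-terms are oscillatory, while `l (l + 2ν) = 4 z₁
z₂` gives decay in `y`. -/
lemma norm_expE_jump {z : ℝ × ℝ} (hz : 0 ≤ z.1 * z.2) {p : ST} (hy : 0 < p.2.1) :
    ‖expE ((z.1 - z.2 : ℝ) : ℂ) (-2 * z.1) p‖ ≤ 1 := by
  rw [expE, E, Complex.norm_exp]
  refine Real.exp_le_one_iff.2 ?_
  have h : 0 ≤ z.1 * z.2 * p.2.1 := mul_nonneg hz hy.le
  simp [disp, pow_succ]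
  nlinarith [h]

/-- The operator in the integral equation for `μ`: the points of `ℝ × ℝ` carry the jump terms and
the points of `ℂ` the area terms. -/
def pompeiuKernel (T : ℝ) (S : SpectralData) (hS : S.Decays) :
    Kernel (region T) ((ℝ × ℝ) ⊕ ℂ) where
  m := (volume : Measure (ℝ × ℝ)).map Sum.inl + (volume : Measure ℂ).map Sum.inr
  c := Sum.elim (jumpC S) (areaC S)
  ν := Sum.elim (fun z => ((z.1 - z.2 : ℝ) : ℂ)) id
  l := Sum.elim (fun z => -2 * (z.1 : ℂ)) (fun ν => -2 * (ν.re : ℂ))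
  side := Sum.elim (fun _ => true) (fun ν => decide (0 ≤ ν.im))
  sfinite := inferInstance
  measurable_ν := by
    refine Measurable.sumElim ?_ measurable_id
    fun_prop
  measurable_l := by
    refine Measurable.sumElim ?_ ?_
    · fun_prop
    · exact measurable_const.mul (Complex.measurable_ofReal.comp Complex.measurable_re)
  measurable_side := by
    refine Measurable.sumElim measurable_const ?_
    refine measurable_to_bool ?_
    have : (fun ν : ℂ => decide (0 ≤ ν.im)) ⁻¹' {true} = {ν | 0 ≤ ν.im} := by
      ext ν; simp
    rw [this]
    exact measurableSet_le measurable_const Complex.measurable_im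
  mem_spec := by
    rintro (z | ν)
    · simp [spec]
    · simp only [spec, mem_ofPred_eq, Sum.elim_inr, decide_eq_true_eq, decide_eq_false_iff_not,
        id]
      have : (ν + -2 * (ν.re : ℂ)).im = ν.im := by simp
      rw [this]
      exact ⟨fun h => h, fun h => (not_le.1 h).le⟩
  norm_expE_le := by
    rintro p hp (z | ν) hc
    · refine norm_expE_jump ?_ hp.1
      -- On each of the four jump domains the two coordinates have the same sign, and off them the
      -- density is zero.
      by_contra hneg
      refine hc (jumpC_zero S (fun h => hneg ?_) (fun h => hneg ?_) (fun h => hneg ?_)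
        (fun h => hneg ?_))
      · exact mul_nonneg_of_nonpos_of_nonpos h.1.le h.2.2.le
      · exact mul_nonneg h.1.le (h.1.trans h.2).le
      · exact mul_nonneg_of_nonpos_of_nonpos h.1.le (h.2.trans h.1).le
      · exact mul_nonneg h.1.le h.2.1.le
    · exact norm_expE_area ν p
  integrable := by
    intro k hk
    refine Integrable.add_measure ?_ ?_
    · exact (measurableEmbedding_inl (β := ℂ)).integrable_map_iff.2 (integrable_jumpC S hS hk)
    · exact (measurableEmbedding_inr (α := ℝ × ℝ)).integrable_map_iff.2 (integrable_areaC S hS hk)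
  ne := by
    intro k hk
    rw [ae_add_measure_iff, (measurableEmbedding_inl (β := ℂ)).ae_map_iff, (measurableEmbedding_inr (α := ℝ × ℝ)).ae_map_iff]
    constructor
    -- The jump terms sit at real `ν`, hence never at a nonreal `k`; for the area terms only the
    -- single point `ν = k` is excluded.
    · refine ae_of_all _ fun z h => hk ?_
      rw [← h]
      exact Complex.ofReal_im _
    · exact (measure_singleton k : volume {k} = 0) |> compl_mem_ae_iff.2

section op

variable {T : ℝ} {S : SpectralData} (hS : S.Decays)

/-- Once the inner contours are parametrized by `s`, the signs of the four terms and the factors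
`±i` all combine to the same constant `-i/π`. The argument `ν + l` is the real point `-z₁ - z₂`,
taken from the upper side. -/
lemma setIntegral_jumpTerm {D : Set (ℝ × ℝ)} (hD : MeasurableSet D) {c : ℝ → ℝ → ℂ}
    (hc : ∀ z ∈ D, jumpC S z = -Complex.I / Real.pi * c (z.1 - z.2) (2 * z.2))
    (f : ST → Bool × ℂ → ℂ) (p : ST) (k : ℂ) :
    ∫ z in D, jumpC S z / (((z.1 - z.2 : ℝ) : ℂ) - k) *
        (pompeiuKernel T S hS).wave f (Sum.inl z) p
      = -Complex.I / Real.pi * jumpTerm c D p.1 p.2.1 p.2.2 (fun k => f p (true, k)) k := by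
  rw [jumpTerm, ← integral_const_mul]
  refine setIntegral_congr_fun hD fun z hz => ?_
  have e : ((z.1 - z.2 : ℝ) : ℂ) + -2 * (z.1 : ℂ) = ((-z.1 - z.2 : ℝ) : ℂ) := by push_cast; ring
  simp only [hc z hz, Kernel.wave, Kernel.pt, pompeiuKernel, Sum.elim_inl, expE, e]
  ring

/-- The point `ν + l = ν - 2ν_R` is the reflection of `ν` in the imaginary axis; it stays in the
half-plane of `ν`, which determines `b`. -/
lemma setIntegral_areaTerm {D : Set ℂ} (hD : MeasurableSet D) {γ : ℂ → ℂ} {s : ℂ} {b : Bool}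
    (hc : ∀ ν ∈ D, areaC S ν = s * γ ν) (hb : ∀ ν ∈ D, decide (0 ≤ ν.im) = b)
    (f : ST → Bool × ℂ → ℂ) (p : ST) (k : ℂ) :
    ∫ ν in D, areaC S ν / (ν - k) * (pompeiuKernel T S hS).wave f (Sum.inr ν) p
      = s * areaTerm γ D p.1 p.2.1 p.2.2 (fun k => f p (b, k)) k := by
  rw [areaTerm, ← integral_const_mul]
  refine setIntegral_congr_fun hD fun ν hν => ?_
  have e : ν + -2 * (ν.re : ℂ) = -(starRingEnd ℂ ν) := by
    apply Complex.ext <;> simp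
    ring
  simp only [hc ν hν, Kernel.wave, Kernel.pt, pompeiuKernel, Sum.elim_inr, expE, id, e, hb ν hν]
  ring

/-- The eight terms are the restrictions of one integral to disjoint pieces of its parameter space.
Points outside these pieces, such as the axes, carry zero density. -/
lemma pompeiuRHS_eq_op {f : ST → Bool × ℂ → ℂ} (hf : Admissible (region T) f) {p : ST}
    (hp : p ∈ region T) {k : ℂ} (hk : k.im ≠ 0) :
    pompeiuRHS S p.1 p.2.1 p.2.2 (fun k => f p (true, k)) (fun k => f p (false, k)) k
      = 1 + (pompeiuKernel T S hS).op f p k := by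
  have hi := (pompeiuKernel T S hS).integrable_op (isOpen_region T) hf hp hk
  have hi' : Integrable (fun z => (pompeiuKernel T S hS).c z / ((pompeiuKernel T S hS).ν z - k)
      * (pompeiuKernel T S hS).wave f z p) ((volume : Measure (ℝ × ℝ)).map Sum.inl
        + (volume : Measure ℂ).map Sum.inr) := hi
  rw [integrable_add_measure, (measurableEmbedding_inl (β := ℂ)).integrable_map_iff,
    (measurableEmbedding_inr (α := ℝ × ℝ)).integrable_map_iff] at hi'
  obtain ⟨hl, hr⟩ := hi'
  have hl' : Integrable (fun z : ℝ × ℝ => jumpC S z / (((z.1 - z.2 : ℝ) : ℂ) - k) *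
        (pompeiuKernel T S hS).wave f (Sum.inl z) p) := hl
  have hr' : Integrable (fun ν : ℂ => areaC S ν / (ν - k) *
        (pompeiuKernel T S hS).wave f (Sum.inr ν) p) := hr
  have key : (pompeiuKernel T S hS).op f p k
      = (∫ z : ℝ × ℝ, jumpC S z / (((z.1 - z.2 : ℝ) : ℂ) - k) *
        (pompeiuKernel T S hS).wave f (Sum.inl z) p)
        + ∫ ν : ℂ, areaC S ν / (ν - k) * (pompeiuKernel T S hS).wave f (Sum.inr ν) p := by
    have := integral_add_measure (f := fun z => (pompeiuKernel T S hS).c z /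
      ((pompeiuKernel T S hS).ν z - k) * (pompeiuKernel T S hS).wave f z p)
      ((measurableEmbedding_inl (β := ℂ)).integrable_map_iff.2 hl)
      ((measurableEmbedding_inr (α := ℝ × ℝ)).integrable_map_iff.2 hr)
    rw [(measurableEmbedding_inl (β := ℂ)).integral_map, (measurableEmbedding_inr (α := ℝ × ℝ)).integral_map] at this
    exact this
  obtain ⟨d1, d2, d3, d4, d5, d6⟩ := disjoint_dom
  obtain ⟨c1, c2, c3, c4, c5, c6⟩ := disjoint_quad
  rw [key, integral_eq_four measurableSet_domχ₂ measurableSet_domχ₁ measurableSet_domψ₂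
    measurableSet_domψ₁ d1 d2 d3 d4 d5 d6
    (fun z h1 h2 h3 h4 => by rw [jumpC_zero S h1 h2 h3 h4, zero_div, zero_mul]) hl',
    integral_eq_four measurableSet_quad₁ measurableSet_quad₂ measurableSet_quad₃
    measurableSet_quad₄ c1 c2 c3 c4 c5 c6
    (fun z h1 h2 h3 h4 => by rw [areaC_zero S h1 h2 h3 h4, zero_div, zero_mul]) hr',
    setIntegral_jumpTerm hS measurableSet_domχ₂ (fun z hz => jumpC_χ₂ S hz),
    setIntegral_jumpTerm hS measurableSet_domχ₁ (fun z hz => jumpC_χ₁ S hz),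
    setIntegral_jumpTerm hS measurableSet_domψ₂ (fun z hz => jumpC_ψ₂ S hz),
    setIntegral_jumpTerm hS measurableSet_domψ₁ (fun z hz => jumpC_ψ₁ S hz),
    setIntegral_areaTerm hS measurableSet_quad₁ (b := true) (fun z hz => areaC_quad₁ S hz)
      (fun z hz => by simpa using hz.2.le),
    setIntegral_areaTerm hS measurableSet_quad₂ (b := true) (fun z hz => areaC_quad₂ S hz)
      (fun z hz => by simpa using hz.2.le),
    setIntegral_areaTerm hS measurableSet_quad₃ (b := false) (fun z hz => areaC_quad₃ S hz)
      (fun z hz => by simpa using hz.2),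
    setIntegral_areaTerm hS measurableSet_quad₄ (b := false) (fun z hz => areaC_quad₄ S hz)
      (fun z hz => by simpa using hz.2)]
  simp only [pompeiuRHS, quad₁, quad₂, quad₃, quad₄]
  ring

end op

/-- The family `(p, k) ↦ μ^±(p, k)` on both half-planes. -/
def joinHalves (μp μm : ℝ → ℝ → ℝ → ℂ → ℂ) (p : ST) (w : Bool × ℂ) : ℂ :=
  if w.1 then μp p.1 p.2.1 p.2.2 w.2 else μm p.1 p.2.1 p.2.2 w.2

/-- The homogeneous integral equation has only the trivial solution. -/
theorem eq_zero_of_eq_op {T : ℝ} {S : SpectralData} (hS : S.Decays)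
    {μp μm : ℝ → ℝ → ℝ → ℂ → ℂ}
    (hμ : ∀ x y t : ℝ, 0 < y → 0 < t → t < T → UniquePompeiu S x y t (μp x y t) (μm x y t))
    (ha : Admissible (region T) (joinHalves μp μm))
    {F : ST → Bool × ℂ → ℂ} (hF : Admissible (region T) F) {p : ST} (hp : p ∈ region T)
    (h : ∀ w ∈ spec, w.2.im ≠ 0 → F p w = (pompeiuKernel T S hS).op F p w.2)
    {w : Bool × ℂ} (hw : w ∈ spec) : F p w = 0 := by
  obtain ⟨hsol, huniq⟩ := hμ p.1 p.2.1 p.2.2 hp.1 hp.2.1 hp.2.2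
  have hd := ha.sub hF
  obtain ⟨C, hC⟩ := hd.bounded {p} (singleton_subset_iff.2 hp) isCompact_singleton
  have hcont := hd.continuousOn_right hp
  have hup : ∀ k ∈ upperHalf, ((true, k) : Bool × ℂ) ∈ spec := fun k hk => ⟨fun _ => hk, by simp⟩
  have hlow : ∀ k ∈ lowerHalf, ((false, k) : Bool × ℂ) ∈ spec := fun k hk =>
    ⟨by simp, fun _ => hk⟩
  have heq : ∀ k : ℂ, k.im ≠ 0 →
      pompeiuRHS S p.1 p.2.1 p.2.2 (fun k => joinHalves μp μm p (true, k) - F p (true, k))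
        (fun k => joinHalves μp μm p (false, k) - F p (false, k)) k
      = pompeiuRHS S p.1 p.2.1 p.2.2 (μp p.1 p.2.1 p.2.2) (μm p.1 p.2.1 p.2.2) k
        - (pompeiuKernel T S hS).op F p k := by
    intro k hk
    have h1 := pompeiuRHS_eq_op hS hd hp hk
    have h2 := pompeiuRHS_eq_op hS ha hp hk
    rw [h1, (pompeiuKernel T S hS).op_sub (isOpen_region T) ha hF hp hk]
    simp only [joinHalves, if_true, Bool.false_eq_true, if_false] at h2 ⊢
    rw [h2]; ring
  -- If `F = K F`, then `μ - F` solves the same inhomogeneous equation as `μ`, and uniqueness gives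
  -- `F = 0`, also at the points of the real axis.
  have := huniq (fun k => joinHalves μp μm p (true, k) - F p (true, k))
    (fun k => joinHalves μp μm p (false, k) - F p (false, k))
    { continuous_upper := hcont.comp (f := fun k => (true, k)) (by fun_prop) hup
      continuous_lower := hcont.comp (f := fun k => (false, k)) (by fun_prop) hlow
      bounded_upper := ⟨C, fun k hk => hC p rfl _ (hup k hk)⟩
      bounded_lower := ⟨C, fun k hk => hC p rfl _ (hlow k hk)⟩
      equation_upper := fun k hk => by
        rw [heq k hk.ne', ← hsol.equation_upper k hk, h _ (hup k hk.le) hk.ne']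
        rfl
      equation_lower := fun k hk => by
        rw [heq k hk.ne, ← hsol.equation_lower k hk, h _ (hlow k hk.le) hk.ne]
        rfl }
  obtain ⟨b, k⟩ := w
  cases b
  · have h1 := this.2 (show k ∈ lowerHalf from hw.2 rfl)
    simpa [joinHalves] using h1
  · have h1 := this.1 (show k ∈ upperHalf from hw.1 rfl)
    simpa [joinHalves] using h1

/-! ### Compatibility of the Lax pair -/

/-- `f` is differentiable at `p` with directional derivative `a`. -/
structure HasPd (v : ST) (f : ST → ℂ) (p : ST) (a : ℂ) : Prop where
  differentiableAt : DifferentiableAt ℝ f p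
  pd_eq : pd v f p = a

namespace HasPd

variable {v p : ST} {f g : ST → ℂ} {a b : ℂ}

lemma of_differentiableAt (h : DifferentiableAt ℝ f p) : HasPd v f p (pd v f p) := ⟨h, rfl⟩

lemma add (hf : HasPd v f p a) (hg : HasPd v g p b) : HasPd v (fun x => f x + g x) p (a + b) :=
  ⟨hf.1.add hg.1, by rw [pd_add hf.1 hg.1, hf.2, hg.2]⟩

lemma sub (hf : HasPd v f p a) (hg : HasPd v g p b) : HasPd v (fun x => f x - g x) p (a - b) :=
  ⟨hf.1.sub hg.1, by rw [pd_sub hf.1 hg.1, hf.2, hg.2]⟩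

lemma mul (hf : HasPd v f p a) (hg : HasPd v g p b) :
    HasPd v (fun x => f x * g x) p (f p * b + a * g p) :=
  ⟨hf.1.mul hg.1, by rw [pd_mul hf.1 hg.1, hf.2, hg.2]⟩

lemma const_mul (c : ℂ) (hf : HasPd v f p a) : HasPd v (fun x => c * f x) p (c * a) :=
  ⟨hf.1.const_mul c, by rw [pd_const_mul c hf.1, hf.2]⟩

end HasPd

section compatibility

variable {Ω : Set ST} {f q W : ST → ℂ}

/-- Cross-differentiation of `f_y = f_xx + q f` and `f_t = -4 f_xxx - 6 q f_x + W f`. -/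
theorem lax_compatibility (hΩ : IsOpen Ω) (hf : ContDiffOn ℝ (5 : ℕ∞) f Ω)
    (hq : ContDiffOn ℝ (3 : ℕ∞) q Ω) (hW : ContDiffOn ℝ (2 : ℕ∞) W Ω)
    (hY : EqOn (pd ey f) (fun p => pd ex (pd ex f) p + q p * f p) Ω)
    (hT : EqOn (pd et f) (fun p => -4 * pd ex (pd ex (pd ex f)) p - 6 * (q p * pd ex f p)
      + W p * f p) Ω) {p : ST} (hp : p ∈ Ω) :
    (6 * pd ex (pd ex q) p + 2 * pd ex W p + 6 * pd ey q p) * pd ex f p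
      + (pd et q p + 4 * pd ex (pd ex (pd ex q)) p + 6 * q p * pd ex q p - pd ey W p
        + pd ex (pd ex W) p) * f p = 0 := by
  have c1 : ContDiffOn ℝ (4 : ℕ∞) (pd ex f) Ω := contDiffOn_pd hf hΩ (by norm_num)
  have c2 : ContDiffOn ℝ (3 : ℕ∞) (pd ex (pd ex f)) Ω := contDiffOn_pd c1 hΩ (by norm_num)
  have c3 : ContDiffOn ℝ (2 : ℕ∞) (pd ex (pd ex (pd ex f))) Ω :=
    contDiffOn_pd c2 hΩ (by norm_num)
  have c4 : ContDiffOn ℝ (1 : ℕ∞) (pd ex (pd ex (pd ex (pd ex f)))) Ω :=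
    contDiffOn_pd c3 hΩ (by norm_num)
  have cq1 : ContDiffOn ℝ (2 : ℕ∞) (pd ex q) Ω := contDiffOn_pd hq hΩ (by norm_num)
  have cq2 : ContDiffOn ℝ (1 : ℕ∞) (pd ex (pd ex q)) Ω := contDiffOn_pd cq1 hΩ (by norm_num)
  have cW1 : ContDiffOn ℝ (1 : ℕ∞) (pd ex W) Ω := contDiffOn_pd hW hΩ (by norm_num)
  have d0 (v : ST) : ∀ z ∈ Ω, HasPd v f z (pd v f z) := fun z hz =>
    .of_differentiableAt (differentiableAt_of_contDiffOn hf hΩ (by norm_num) hz)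
  have d1 (v : ST) : ∀ z ∈ Ω, HasPd v (pd ex f) z (pd v (pd ex f) z) := fun z hz =>
    .of_differentiableAt (differentiableAt_of_contDiffOn c1 hΩ (by norm_num) hz)
  have d2 (v : ST) : ∀ z ∈ Ω, HasPd v (pd ex (pd ex f)) z (pd v (pd ex (pd ex f)) z) := fun z hz =>
    .of_differentiableAt (differentiableAt_of_contDiffOn c2 hΩ (by norm_num) hz)
  have d3 (v : ST) : ∀ z ∈ Ω, HasPd v (pd ex (pd ex (pd ex f))) z (pd v (pd ex (pd ex (pd ex f))) z) := fun z hz =>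
    .of_differentiableAt (differentiableAt_of_contDiffOn c3 hΩ (by norm_num) hz)
  have d4 (v : ST) : ∀ z ∈ Ω, HasPd v (pd ex (pd ex (pd ex (pd ex f)))) z (pd v (pd ex (pd ex (pd ex (pd ex f)))) z) := fun z hz =>
    .of_differentiableAt (differentiableAt_of_contDiffOn c4 hΩ (by norm_num) hz)
  have q0 (v : ST) : ∀ z ∈ Ω, HasPd v q z (pd v q z) := fun z hz =>
    .of_differentiableAt (differentiableAt_of_contDiffOn hq hΩ (by norm_num) hz)
  have q1 (v : ST) : ∀ z ∈ Ω, HasPd v (pd ex q) z (pd v (pd ex q) z) := fun z hz =>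
    .of_differentiableAt (differentiableAt_of_contDiffOn cq1 hΩ (by norm_num) hz)
  have q2 (v : ST) : ∀ z ∈ Ω, HasPd v (pd ex (pd ex q)) z (pd v (pd ex (pd ex q)) z) := fun z hz =>
    .of_differentiableAt (differentiableAt_of_contDiffOn cq2 hΩ (by norm_num) hz)
  have w0 (v : ST) : ∀ z ∈ Ω, HasPd v W z (pd v W z) := fun z hz =>
    .of_differentiableAt (differentiableAt_of_contDiffOn hW hΩ (by norm_num) hz)
  have w1 (v : ST) : ∀ z ∈ Ω, HasPd v (pd ex W) z (pd v (pd ex W) z) := fun z hz =>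
    .of_differentiableAt (differentiableAt_of_contDiffOn cW1 hΩ (by norm_num) hz)
  have y1 : EqOn (pd ex (pd ey f))
      (fun z => pd ex (pd ex (pd ex f)) z + (q z * pd ex f z + pd ex q z * f z)) Ω := by
    intro z hz
    rw [pd_congr hΩ hY hz]
    exact ((d2 ex z hz).add ((q0 ex z hz).mul (d0 ex z hz))).2
  have y2 : EqOn (pd ex (pd ex (pd ey f)))
      (fun z => pd ex (pd ex (pd ex (pd ex f))) z + ((q z * pd ex (pd ex f) z
        + pd ex q z * pd ex f z) + (pd ex q z * pd ex f z + pd ex (pd ex q) z * f z))) Ω := by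
    intro z hz
    rw [pd_congr hΩ y1 hz]
    exact ((d3 ex z hz).add (((q0 ex z hz).mul (d1 ex z hz)).add
      ((q1 ex z hz).mul (d0 ex z hz)))).2
  have y3 : pd ex (pd ex (pd ex (pd ey f))) p
      = pd ex (pd ex (pd ex (pd ex (pd ex f)))) p
        + (((q p * pd ex (pd ex (pd ex f)) p + pd ex q p * pd ex (pd ex f) p)
          + (pd ex q p * pd ex (pd ex f) p + pd ex (pd ex q) p * pd ex f p))
        + ((pd ex q p * pd ex (pd ex f) p + pd ex (pd ex q) p * pd ex f p)
          + (pd ex (pd ex q) p * pd ex f p + pd ex (pd ex (pd ex q)) p * f p))) := by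
    rw [pd_congr hΩ y2 hp]
    exact ((d4 ex p hp).add ((((q0 ex p hp).mul (d2 ex p hp)).add
      ((q1 ex p hp).mul (d1 ex p hp))).add (((q1 ex p hp).mul (d1 ex p hp)).add
      ((q2 ex p hp).mul (d0 ex p hp))))).2
  have t1 : EqOn (pd ex (pd et f))
      (fun z => -4 * pd ex (pd ex (pd ex (pd ex f))) z
        - 6 * (q z * pd ex (pd ex f) z + pd ex q z * pd ex f z)
        + (W z * pd ex f z + pd ex W z * f z)) Ω := by
    intro z hz
    rw [pd_congr hΩ hT hz]
    exact ((((d3 ex z hz).const_mul (-4)).sub (((q0 ex z hz).mul (d1 ex z hz)).const_mul 6)).add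
      ((w0 ex z hz).mul (d0 ex z hz))).2
  have t2 : pd ex (pd ex (pd et f)) p
      = -4 * pd ex (pd ex (pd ex (pd ex (pd ex f)))) p
        - 6 * ((q p * pd ex (pd ex (pd ex f)) p + pd ex q p * pd ex (pd ex f) p)
          + (pd ex q p * pd ex (pd ex f) p + pd ex (pd ex q) p * pd ex f p))
        + ((W p * pd ex (pd ex f) p + pd ex W p * pd ex f p)
          + (pd ex W p * pd ex f p + pd ex (pd ex W) p * f p)) := by
    rw [pd_congr hΩ t1 hp]
    exact ((((d4 ex p hp).const_mul (-4)).sub ((((q0 ex p hp).mul (d2 ex p hp)).add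
      ((q1 ex p hp).mul (d1 ex p hp))).const_mul 6)).add (((w0 ex p hp).mul (d1 ex p hp)).add
      ((w1 ex p hp).mul (d0 ex p hp)))).2
  -- Both mixed derivatives are expressed through `x`-derivatives of `f`. Those of order two to five
  -- cancel, which leaves only `f_x` and `f`.
  have cross := pd_comm (v := et) (w := ey) hf hΩ (by norm_num) hp
  have lhs : pd et (pd ey f) p
      = pd ex (pd ex (pd et f)) p + (q p * pd et f p + pd et q p * f p) := by
    rw [pd_congr hΩ hY hp, ← pd_congr hΩ (pd_comm (v := et) (w := ex) hf hΩ (by norm_num)) hp,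
      ← pd_comm (v := et) (w := ex) c1 hΩ (by norm_num) hp]
    exact ((d2 et p hp).add ((q0 et p hp).mul (d0 et p hp))).2
  have rhs : pd ey (pd et f) p
      = -4 * pd ex (pd ex (pd ex (pd ey f))) p
        - 6 * (q p * pd ex (pd ey f) p + pd ey q p * pd ex f p)
        + (W p * pd ey f p + pd ey W p * f p) := by
    have s1 := pd_comm (v := ey) (w := ex) hf hΩ (by norm_num)
    have s2 : EqOn (pd ey (pd ex (pd ex f))) (pd ex (pd ex (pd ey f))) Ω := fun z hz => by
      rw [pd_comm (v := ey) (w := ex) c1 hΩ (by norm_num) hz, pd_congr hΩ s1 hz]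
    have s3 : pd ey (pd ex (pd ex (pd ex f))) p = pd ex (pd ex (pd ex (pd ey f))) p := by
      rw [pd_comm (v := ey) (w := ex) c2 hΩ (by norm_num) hp, pd_congr hΩ s2 hp]
    rw [pd_congr hΩ hT hp, ← s3, ← s1 hp]
    exact ((((d3 ey p hp).const_mul (-4)).sub (((q0 ey p hp).mul (d1 ey p hp)).const_mul 6)).add
      ((w0 ey p hp).mul (d0 ey p hp))).2
  rw [lhs, rhs, t2, y3, y1 hp, hY hp, hT hp] at cross
  simp only at cross
  linear_combination cross

end compatibility

/-! ### Regularity of the family `μ` -/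

/-- The label is discrete, so each half-plane is treated separately and no matching across the real
axis is required. -/
lemma continuousOn_halves {Ω : Set ST} {X : Type*} [TopologicalSpace X] {F : ST → Bool × ℂ → X}
    (hp : ContinuousOn (fun z : ST × ℂ => F z.1 (true, z.2)) (Ω ×ˢ upperHalf))
    (hm : ContinuousOn (fun z : ST × ℂ => F z.1 (false, z.2)) (Ω ×ˢ lowerHalf)) :
    ContinuousOn (fun z : ST × (Bool × ℂ) => F z.1 z.2) (Ω ×ˢ spec) := by
  rintro ⟨p, b, k⟩ hz
  have hN : {z : ST × (Bool × ℂ) | z.2.1 = b} ∈ 𝓝 ((p, b, k) : ST × (Bool × ℂ)) :=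
    (isOpen_discrete {b}).preimage (continuous_fst.comp continuous_snd) |>.mem_nhds rfl
  rw [← continuousWithinAt_inter hN]
  have hc : ContinuousOn (fun z : ST × (Bool × ℂ) => (z.1, z.2.2)) univ := by fun_prop
  cases b
  · have h := hm.comp (hc.mono (subset_univ ((Ω ×ˢ spec) ∩ {z | z.2.1 = false})))
      (fun z hz => ⟨hz.1.1, hz.1.2.2 hz.2⟩)
    exact (h.congr fun z hz => by
      obtain ⟨z1, z2, z3⟩ := z
      obtain rfl : z2 = false := hz.2
      rfl) _ ⟨hz, rfl⟩
  · have h := hp.comp (hc.mono (subset_univ ((Ω ×ˢ spec) ∩ {z | z.2.1 = true})))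
      (fun z hz => ⟨hz.1.1, hz.1.2.1 hz.2⟩)
    exact (h.congr fun z hz => by
      obtain ⟨z1, z2, z3⟩ := z
      obtain rfl : z2 = true := hz.2
      rfl) _ ⟨hz, rfl⟩

lemma deriv_slice_x {T : ℝ} {f : ST → ℂ} {n : ℕ∞} (hf : ContDiffOn ℝ n f (region T))
    (hn : 1 ≤ n) {y t : ℝ} (hy : 0 < y) (ht : 0 < t) (htT : t < T) :
    deriv (fun s => f (s, y, t)) = fun s => pd ex f (s, y, t) := by
  ext s
  exact (hasDerivAt_slice_x (p := (s, y, t))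
    (differentiableAt_of_contDiffOn hf (isOpen_region T) hn ⟨hy, ht, htT⟩)).deriv

lemma iteratedDeriv_slice_x {T : ℝ} {f : ST → ℂ} (hf : ContDiffOn ℝ (3 : ℕ∞) f (region T))
    {y t : ℝ} (hy : 0 < y) (ht : 0 < t) (htT : t < T) (x : ℝ) :
    iteratedDeriv 2 (fun s => f (s, y, t)) x = pd ex (pd ex f) (x, y, t) ∧
    iteratedDeriv 3 (fun s => f (s, y, t)) x = pd ex (pd ex (pd ex f)) (x, y, t) := by
  have h1 : ContDiffOn ℝ (2 : ℕ∞) (pd ex f) (region T) :=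
    contDiffOn_pd hf (isOpen_region T) (by norm_num)
  have h2 : ContDiffOn ℝ (1 : ℕ∞) (pd ex (pd ex f)) (region T) :=
    contDiffOn_pd h1 (isOpen_region T) (by norm_num)
  have e1 : iteratedDeriv 1 (fun s => f (s, y, t)) = fun s => pd ex f (s, y, t) := by
    rw [iteratedDeriv_one, deriv_slice_x hf (by norm_num) hy ht htT]
  have e2 : iteratedDeriv 2 (fun s => f (s, y, t)) = fun s => pd ex (pd ex f) (s, y, t) := by
    rw [iteratedDeriv_succ, e1, deriv_slice_x h1 (by norm_num) hy ht htT]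
  have e3 : iteratedDeriv 3 (fun s => f (s, y, t))
      = fun s => pd ex (pd ex (pd ex f)) (s, y, t) := by
    rw [iteratedDeriv_succ, e2, deriv_slice_x h2 (by norm_num) hy ht htT]
  exact ⟨congrFun e2 x, congrFun e3 x⟩

/-- `μ` on both half-planes together, as a family of functions on space-time, is smooth with
derivatives continuous in all variables, and satisfies the bounds as `k → ∞`. -/
structure RegularFamily (Ω : Set ST) (μ : ST → Bool × ℂ → ℂ) (q : ST → ℂ) : Prop where
  smooth : ∀ w ∈ spec, ContDiffOn ℝ (5 : ℕ∞) (fun p => μ p w) Ω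
  continuous : ∀ n : ℕ, n ≤ 3 → ContinuousOn
    (fun z : ST × (Bool × ℂ) => iteratedFDeriv ℝ n (fun p => μ p z.2) z.1) (Ω ×ˢ spec)
  bounds : ∀ K ⊆ Ω, IsCompact K → ∃ C : ℝ, ∀ p ∈ K, ∀ w ∈ spec,
      (1 + ‖w.2‖) * ‖μ p w - 1‖ ≤ C ∧
      (1 + ‖w.2‖) * ‖w.2 * pd ex (fun p => μ p w) p - Complex.I / 2 * q p‖ ≤ C ∧
      (1 + ‖w.2‖) * ‖pd ex (pd ex (fun p => μ p w)) p‖ ≤ C ∧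
      ‖pd ex (pd ex (pd ex (fun p => μ p w))) p‖ ≤ C ∧
      ‖pd ey (fun p => μ p w) p‖ ≤ C ∧
      ‖pd et (fun p => μ p w) p‖ ≤ C

lemma RegularOn.bounds_pd {T : ℝ} {D : Set ℂ} {μ : ℝ → ℝ → ℝ → ℂ → ℂ} {q : ℝ → ℝ → ℝ → ℂ}
    (h : RegularOn T D μ q) {K : Set ST} (hK : K ⊆ region T) (hc : IsCompact K) :
    ∃ C : ℝ, ∀ p ∈ K, ∀ k ∈ D,
      (1 + ‖k‖) * ‖μ p.1 p.2.1 p.2.2 k - 1‖ ≤ C ∧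
      (1 + ‖k‖) * ‖k * pd ex (fun p => μ p.1 p.2.1 p.2.2 k) p
        - Complex.I / 2 * q p.1 p.2.1 p.2.2‖ ≤ C ∧
      (1 + ‖k‖) * ‖pd ex (pd ex (fun p => μ p.1 p.2.1 p.2.2 k)) p‖ ≤ C ∧
      ‖pd ex (pd ex (pd ex (fun p => μ p.1 p.2.1 p.2.2 k))) p‖ ≤ C ∧
      ‖pd ey (fun p => μ p.1 p.2.1 p.2.2 k) p‖ ≤ C ∧
      ‖pd et (fun p => μ p.1 p.2.1 p.2.2 k) p‖ ≤ C := by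
  obtain ⟨C, hC⟩ := h.bounds K hc hK
  refine ⟨C, fun p hp k hk => ?_⟩
  obtain ⟨x, y, t⟩ := p
  obtain ⟨hy, ht, htT⟩ := hK hp
  have hs : ContDiffOn ℝ (5 : ℕ∞) (fun p : ST => μ p.1 p.2.1 p.2.2 k) (region T) := h.smooth k hk
  have hd := differentiableAt_of_contDiffOn hs (isOpen_region T) (by norm_num) (hK hp)
  have e1 := (hasDerivAt_slice_x hd).deriv
  have e2 := iteratedDeriv_slice_x (hs.of_le (by exact_mod_cast (by norm_num : (3 : ℕ∞) ≤ 5)))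
    hy ht htT x
  have e3 := (hasDerivAt_slice_y hd).deriv
  have e4 := (hasDerivAt_slice_t hd).deriv
  have := hC x y t k hk hp
  simp only at e1 e2 e3 e4 this ⊢
  rw [e1, e2.1, e2.2, e3, e4] at this
  exact this

lemma regularFamily_joinHalves {T : ℝ} {μp μm : ℝ → ℝ → ℝ → ℂ → ℂ} {q : ℝ → ℝ → ℝ → ℂ}
    (hp : RegularOn T upperHalf μp q) (hm : RegularOn T lowerHalf μm q) :
    RegularFamily (region T) (joinHalves μp μm) (fun p => q p.1 p.2.1 p.2.2) where
  smooth := by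
    rintro ⟨b, k⟩ hw
    cases b
    · exact hm.smooth k (hw.2 rfl)
    · exact hp.smooth k (hw.1 rfl)
  continuous n hn :=
    continuousOn_halves (F := fun p w => iteratedFDeriv ℝ n (fun p => joinHalves μp μm p w) p)
      (hp.continuous n hn) (hm.continuous n hn)
  bounds K hK hc := by
    obtain ⟨C, hC⟩ := hp.bounds_pd hK hc
    obtain ⟨C', hC'⟩ := hm.bounds_pd hK hc
    refine ⟨max C C', ?_⟩
    rintro p hpK ⟨b, k⟩ hw
    cases b
    · obtain ⟨h1, h2, h3, h4, h5, h6⟩ := hC' p hpK k (hw.2 rfl)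
      exact ⟨h1.trans (le_max_right _ _), h2.trans (le_max_right _ _),
        h3.trans (le_max_right _ _), h4.trans (le_max_right _ _), h5.trans (le_max_right _ _),
        h6.trans (le_max_right _ _)⟩
    · obtain ⟨h1, h2, h3, h4, h5, h6⟩ := hC p hpK k (hw.1 rfl)
      exact ⟨h1.trans (le_max_left _ _), h2.trans (le_max_left _ _),
        h3.trans (le_max_left _ _), h4.trans (le_max_left _ _), h5.trans (le_max_left _ _),
        h6.trans (le_max_left _ _)⟩

/-- The part `|k| ≤ 1` of the two half-planes is a union of two compact half-discs. This supplies
the bound on `μ_x` near `k = 0`, where a bound on `k μ_x` gives none. -/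
lemma exists_bound_compact {Ω K : Set ST} (hK : K ⊆ Ω) (hc : IsCompact K)
    {F : ST → Bool × ℂ → ℂ}
    (hF : ContinuousOn (fun z : ST × (Bool × ℂ) => F z.1 z.2) (Ω ×ˢ spec)) :
    ∃ C, ∀ p ∈ K, ∀ w ∈ spec, ‖w.2‖ ≤ 1 → ‖F p w‖ ≤ C := by
  have h1 : IsCompact (({true} : Set Bool) ×ˢ (Metric.closedBall (0 : ℂ) 1 ∩ upperHalf)) :=
    isCompact_singleton.prod ((isCompact_closedBall _ _).inter_right
      (isClosed_le continuous_const Complex.continuous_im))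
  have h2 : IsCompact (({false} : Set Bool) ×ˢ (Metric.closedBall (0 : ℂ) 1 ∩ lowerHalf)) :=
    isCompact_singleton.prod ((isCompact_closedBall _ _).inter_right
      (isClosed_le Complex.continuous_im continuous_const))
  obtain ⟨C, hC⟩ := (hc.prod (h1.union h2)).exists_bound_of_continuousOn (hF.mono (by
    rintro ⟨p, b, k⟩ ⟨hp, h | h⟩
    · obtain rfl : b = true := h.1
      exact ⟨hK hp, fun _ => h.2.2, by simp⟩
    · obtain rfl : b = false := h.1
      exact ⟨hK hp, by simp, fun _ => h.2.2⟩))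
  refine ⟨C, ?_⟩
  rintro p hp ⟨b, k⟩ hw hk
  refine hC (p, b, k) ⟨hp, ?_⟩
  cases b
  · exact Or.inr ⟨rfl, by simpa using hk, hw.2 rfl⟩
  · exact Or.inl ⟨rfl, by simpa using hk, hw.1 rfl⟩

namespace RegularFamily

variable {Ω : Set ST} {μ : ST → Bool × ℂ → ℂ} {q : ST → ℂ}

lemma continuousOn_pd (h : RegularFamily Ω μ q) (hΩ : IsOpen Ω) (v : ST) :
    ContinuousOn (fun z : ST × (Bool × ℂ) => pd v (fun p => μ p z.2) z.1) (Ω ×ˢ spec) := by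
  have := (ContinuousMultilinearMap.apply ℝ _ ℂ (Fin.cons v Fin.elim0)).continuous.comp_continuousOn
    (h.continuous 1 (by norm_num))
  refine this.congr fun z hz => ?_
  exact pd_pd_eq_iteratedFDeriv (h.smooth z.2 hz.2) hΩ (by norm_num) _ Fin.elim0
    (fun p _ => by simp) hz.1

end RegularFamily

namespace RegularFamily

variable {Ω : Set ST} {μ : ST → Bool × ℂ → ℂ} {q : ST → ℂ}

lemma continuousOn_pd_pd (h : RegularFamily Ω μ q) (hΩ : IsOpen Ω) (v v' : ST) :
    ContinuousOn (fun z : ST × (Bool × ℂ) => pd v (pd v' (fun p => μ p z.2)) z.1)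
      (Ω ×ˢ spec) := by
  have := (ContinuousMultilinearMap.apply ℝ _ ℂ
    (Fin.cons v (Fin.cons v' Fin.elim0))).continuous.comp_continuousOn
    (h.continuous 2 (by norm_num))
  refine this.congr fun z hz => ?_
  have hs := h.smooth z.2 hz.2
  exact pd_pd_eq_iteratedFDeriv hs hΩ (by norm_num) _ _
    (pd_pd_eq_iteratedFDeriv hs hΩ (by norm_num) _ Fin.elim0 (fun p _ => by simp)) hz.1

lemma continuousOn_pd_pd_pd (h : RegularFamily Ω μ q) (hΩ : IsOpen Ω) (v v' v'' : ST) :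
    ContinuousOn (fun z : ST × (Bool × ℂ) => pd v (pd v' (pd v'' (fun p => μ p z.2))) z.1)
      (Ω ×ˢ spec) := by
  have := (ContinuousMultilinearMap.apply ℝ _ ℂ
    (Fin.cons v (Fin.cons v' (Fin.cons v'' Fin.elim0)))).continuous.comp_continuousOn
    (h.continuous 3 (by norm_num))
  refine this.congr fun z hz => ?_
  have hs := h.smooth z.2 hz.2
  exact pd_pd_eq_iteratedFDeriv hs hΩ (by norm_num) _ _
    (pd_pd_eq_iteratedFDeriv hs hΩ (by norm_num) _ _
      (pd_pd_eq_iteratedFDeriv hs hΩ (by norm_num) _ Fin.elim0 (fun p _ => by simp))) hz.1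

lemma continuousOn_family (h : RegularFamily Ω μ q) :
    ContinuousOn (fun z : ST × (Bool × ℂ) => μ z.1 z.2) (Ω ×ˢ spec) := by
  have := (ContinuousMultilinearMap.apply ℝ _ ℂ Fin.elim0).continuous.comp_continuousOn
    (h.continuous 0 (by norm_num))
  exact this.congr fun z hz => by simp

lemma le_of_mul_one_add {a b C : ℝ} (ha : 0 ≤ a) (hb : 0 ≤ b) (h : (1 + a) * b ≤ C) :
    b ≤ C ∧ a * b ≤ C := by
  constructor <;> nlinarith [mul_nonneg ha hb]

/-- The bounds, uniform in `k`, which enter the two operators. -/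
lemma uniform_bounds (h : RegularFamily Ω μ q) (hΩ : IsOpen Ω) {K : Set ST} (hK : K ⊆ Ω)
    (hc : IsCompact K) :
    ∃ C : ℝ, 0 ≤ C ∧ (∀ p ∈ K, ‖q p‖ ≤ C) ∧ ∀ p ∈ K, ∀ w ∈ spec,
      ‖μ p w‖ ≤ C ∧ ‖w.2 * (μ p w - 1)‖ ≤ C ∧ ‖pd ex (fun p => μ p w) p‖ ≤ C ∧
      ‖w.2 * pd ex (fun p => μ p w) p‖ ≤ C ∧
      ‖w.2 * (w.2 * pd ex (fun p => μ p w) p - Complex.I / 2 * q p)‖ ≤ C ∧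
      ‖pd ex (pd ex (fun p => μ p w)) p‖ ≤ C ∧ ‖w.2 * pd ex (pd ex (fun p => μ p w)) p‖ ≤ C ∧
      ‖pd ex (pd ex (pd ex (fun p => μ p w))) p‖ ≤ C ∧
      ‖pd ey (fun p => μ p w) p‖ ≤ C ∧
      ‖pd et (fun p => μ p w) p‖ ≤ C := by
  obtain ⟨C, hC⟩ := h.bounds K hK hc
  obtain ⟨B, hB⟩ := exists_bound_compact (F := fun p w => pd ex (fun p => μ p w) p) hK hc
    (h.continuousOn_pd hΩ ex)
  have hq : ∀ p ∈ K, ‖q p‖ ≤ 2 * C := by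
    intro p hp
    -- At `k = 0` the bound on `k μ_x - iq/2` becomes a bound on `q` itself.
    have := (hC p hp (true, 0) ⟨fun _ => le_rfl, by simp⟩).2.1
    simp at this
    linarith
  refine ⟨2 * |C| + |B| + 1, by positivity, fun p hp => ?_, fun p hp w hw => ?_⟩
  · have := hq p hp
    linarith [le_abs_self C, abs_nonneg B]
  obtain ⟨h1, h2, h3, h4, h5, h6⟩ := hC p hp w hw
  have hk := norm_nonneg w.2
  have hCa := le_abs_self C
  have hCn := abs_nonneg C
  have hBa := le_abs_self B
  have hBn := abs_nonneg B
  obtain ⟨a1, b1⟩ := le_of_mul_one_add hk (norm_nonneg _) h1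
  obtain ⟨a2, b2⟩ := le_of_mul_one_add hk (norm_nonneg _) h2
  obtain ⟨a3, b3⟩ := le_of_mul_one_add hk (norm_nonneg _) h3
  have hkx : ‖w.2 * pd ex (fun p => μ p w) p‖ ≤ 2 * C := by
    have e : w.2 * pd ex (fun p => μ p w) p
        = (w.2 * pd ex (fun p => μ p w) p - Complex.I / 2 * q p) + Complex.I / 2 * q p := by ring
    have n1 : ‖Complex.I / 2 * q p‖ ≤ C := by
      have := hq p hp
      simp only [norm_mul, norm_div, Complex.norm_I, Complex.norm_ofNat]
      linarith
    rw [e]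
    exact (norm_add_le _ _).trans (by linarith)
  refine ⟨?_, ?_, ?_, ?_, ?_, ?_, ?_, ?_, ?_, ?_⟩
  · have : ‖μ p w‖ ≤ ‖μ p w - 1‖ + ‖(1 : ℂ)‖ := by
      simpa using norm_add_le (μ p w - 1) 1
    rw [norm_one] at this
    linarith
  · rw [norm_mul]; linarith
  -- For `|k| ≥ 1` the bound on `μ_x` follows from that on `k μ_x`; for `|k| ≤ 1` compactness is
  -- used.
  · rcases le_total ‖w.2‖ 1 with hle | hge
    · have := hB p hp w hw hle
      linarith
    · rw [norm_mul] at hkx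
      have : ‖pd ex (fun p => μ p w) p‖ ≤ ‖w.2‖ * ‖pd ex (fun p => μ p w) p‖ :=
        le_mul_of_one_le_left (norm_nonneg _) hge
      linarith
  · linarith
  · rw [norm_mul]; linarith
  · linarith
  · rw [norm_mul]; linarith
  · linarith
  · linarith
  · linarith

lemma admissible (h : RegularFamily Ω μ q) (hΩ : IsOpen Ω) : Admissible Ω μ where
  continuousOn := h.continuousOn_family
  bounded K hK hc := by
    obtain ⟨C, -, -, hC⟩ := h.uniform_bounds hΩ hK hc
    exact ⟨C, fun p hp w hw => (hC p hp w hw).1⟩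

lemma admissible_laxY (h : RegularFamily Ω μ q) (hΩ : IsOpen Ω) :
    Admissible Ω (fun p w => laxY w.2 (fun p => μ p w) p) where
  continuousOn := by
    have hk : ContinuousOn (fun z : ST × (Bool × ℂ) => z.2.2) (Ω ×ˢ spec) :=
      (continuous_snd.comp continuous_snd).continuousOn
    exact ((h.continuousOn_pd hΩ ey).sub (h.continuousOn_pd_pd hΩ ex ex)).sub
      ((continuousOn_const.mul hk).mul (h.continuousOn_pd hΩ ex))
  bounded K hK hc := by
    obtain ⟨C, -, -, hC⟩ := h.uniform_bounds hΩ hK hc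
    refine ⟨C + C + 2 * C, fun p hp w hw => ?_⟩
    obtain ⟨-, -, -, h4, -, h6, -, -, h9, -⟩ := hC p hp w hw
    have e : laxY w.2 (fun p => μ p w) p = (pd ey (fun p => μ p w) p
        - pd ex (pd ex (fun p => μ p w)) p)
        - 2 * Complex.I * (w.2 * pd ex (fun p => μ p w) p) := by
      rw [laxY]; ring
    have n : ‖2 * Complex.I * (w.2 * pd ex (fun p => μ p w) p)‖ ≤ 2 * C := by
      rw [norm_mul]
      simp only [norm_mul _ Complex.I, Complex.norm_I, Complex.norm_ofNat, mul_one]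
      linarith
    rw [e]
    exact (norm_sub_le _ _).trans (add_le_add ((norm_sub_le _ _).trans (add_le_add h9 h6)) n)

/-- Two terms of `laxT` grow linearly in `k`, but their growth cancels: `-12k²μ_x + 6ikqμ =
-12k(kμ_x - iq/2) + 6ikq(μ - 1)`, and both terms on the right are bounded. This explains the term
`6ikq` in the operator. -/
lemma admissible_laxT (h : RegularFamily Ω μ q) (hΩ : IsOpen Ω) (hq : ContinuousOn q Ω) :
    Admissible Ω (fun p w => laxT q w.2 (fun p => μ p w) p) where
  continuousOn := by
    have hk : ContinuousOn (fun z : ST × (Bool × ℂ) => z.2.2) (Ω ×ˢ spec) :=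
      (continuous_snd.comp continuous_snd).continuousOn
    have hq' : ContinuousOn (fun z : ST × (Bool × ℂ) => q z.1) (Ω ×ˢ spec) :=
      hq.comp continuousOn_fst fun _ h => h.1
    have c1 := h.continuousOn_pd hΩ ex
    exact ((((h.continuousOn_pd hΩ et).add (continuousOn_const.mul
      (h.continuousOn_pd_pd_pd hΩ ex ex ex))).add
      ((continuousOn_const.mul hk).mul (h.continuousOn_pd_pd hΩ ex ex))).sub
      ((continuousOn_const.mul (hk.pow 2)).mul c1)).add
      ((continuousOn_const.mul hq').mul (c1.add
        ((continuousOn_const.mul hk).mul h.continuousOn_family)))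
  bounded K hK hc := by
    obtain ⟨C, hC0, hqC, hC⟩ := h.uniform_bounds hΩ hK hc
    refine ⟨C + 4 * C + 12 * C + 12 * C + 6 * (C * C) + 6 * (C * C), fun p hp w hw => ?_⟩
    obtain ⟨-, h2, h3, -, h5, -, h7, h8, -, h10⟩ := hC p hp w hw
    have hqp := hqC p hp
    have e : laxT q w.2 (fun p => μ p w) p = pd et (fun p => μ p w) p
        + 4 * pd ex (pd ex (pd ex (fun p => μ p w))) p
        + 12 * Complex.I * (w.2 * pd ex (pd ex (fun p => μ p w)) p)
        - 12 * (w.2 * (w.2 * pd ex (fun p => μ p w) p - Complex.I / 2 * q p))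
        + 6 * (q p * pd ex (fun p => μ p w) p)
        + 6 * Complex.I * (q p * (w.2 * (μ p w - 1))) := by
      rw [laxT]; ring
    have n2 : ‖4 * pd ex (pd ex (pd ex (fun p => μ p w))) p‖ ≤ 4 * C := by
      rw [norm_mul, Complex.norm_ofNat]; linarith
    have n3 : ‖12 * Complex.I * (w.2 * pd ex (pd ex (fun p => μ p w)) p)‖ ≤ 12 * C := by
      rw [norm_mul]
      simp only [norm_mul _ Complex.I, Complex.norm_I, Complex.norm_ofNat, mul_one]; linarith
    have n4 : ‖12 * (w.2 * (w.2 * pd ex (fun p => μ p w) p - Complex.I / 2 * q p))‖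
        ≤ 12 * C := by
      rw [norm_mul, Complex.norm_ofNat]; linarith
    have n5 : ‖6 * (q p * pd ex (fun p => μ p w) p)‖ ≤ 6 * (C * C) := by
      rw [norm_mul, Complex.norm_ofNat, norm_mul]
      have := mul_le_mul hqp h3 (norm_nonneg _) hC0
      linarith
    have n6 : ‖6 * Complex.I * (q p * (w.2 * (μ p w - 1)))‖ ≤ 6 * (C * C) := by
      rw [norm_mul]
      rw [norm_mul (q p)]
      have := mul_le_mul hqp h2 (norm_nonneg _) hC0
      simp only [norm_mul _ Complex.I, Complex.norm_I, Complex.norm_ofNat, mul_one]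
      linarith
    rw [e]
    refine (norm_add_le _ _).trans (add_le_add ((norm_add_le _ _).trans (add_le_add
      ((norm_sub_le _ _).trans (add_le_add ((norm_add_le _ _).trans (add_le_add
      ((norm_add_le _ _).trans (add_le_add h10 n2)) n3)) n4)) n5)) n6)

/-- `μ` does not vanish at `p` for some `k`. -/
lemma exists_ne_zero (h : RegularFamily Ω μ q) {p : ST} (hp : p ∈ Ω) :
    ∃ w ∈ spec, μ p w ≠ 0 := by
  obtain ⟨C, hC⟩ := h.bounds {p} (singleton_subset_iff.2 hp) isCompact_singleton
  -- At `k = i|C|`, a zero of `μ` would turn the bound on `μ - 1` into `1 + |C| ≤ C`.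
  have hw : ((true, (|C| : ℝ) * Complex.I) : Bool × ℂ) ∈ spec :=
    ⟨fun _ => by simp, by simp⟩
  refine ⟨_, hw, fun h0 => ?_⟩
  have := (hC p rfl _ hw).1
  rw [h0] at this
  simp at this
  linarith [le_abs_self C]

/-- A multiplier between families of class `C^n` is of class `C^n`. -/
lemma contDiffOn_multiplier (h : RegularFamily Ω μ q) (hΩ : IsOpen Ω) {G : ST → Bool × ℂ → ℂ}
    {W : ST → ℂ} {n : ℕ∞} (hn : n ≤ 5) (hG : ∀ w ∈ spec, ContDiffOn ℝ n (fun p => G p w) Ω)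
    (hW : ∀ p ∈ Ω, ∀ w ∈ spec, G p w = W p * μ p w) : ContDiffOn ℝ n W Ω := by
  intro p hp
  obtain ⟨w, hw, hne⟩ := h.exists_ne_zero hp
  have hs : ContDiffOn ℝ n (fun p => μ p w) Ω := (h.smooth w hw).of_le (by exact_mod_cast hn)
  -- Near `p` the multiplier is the quotient `G / μ` at a value of `k` with `μ ≠ 0`, and so inherits
  -- the regularity of both.
  have hsp : ContDiffAt ℝ n (fun p => μ p w) p := hs.contDiffAt (hΩ.mem_nhds hp)
  have hdiv := ((hG w hw).contDiffAt (hΩ.mem_nhds hp)).mul (hsp.inv hne)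
  refine (hdiv.congr_of_eventuallyEq ?_).contDiffWithinAt
  filter_upwards [hΩ.mem_nhds hp, hsp.continuousAt.eventually_ne hne] with z hz hz0
  simp only [Pi.inv_apply]
  rw [hW z hz w hw, mul_inv_cancel_right₀ hz0]

end RegularFamily

/-! ### Dressing -/

section dressing

variable {Ω : Set ST} {Z : Type*} [MeasurableSpace Z] {κ : Kernel Ω Z}
  {μ G : ST → Bool × ℂ → ℂ} {q : ST → ℂ}

/-- If `G - op G` does not depend on `k`, then `G` is a multiple of `μ`. -/
theorem exists_multiplier (hΩ : IsOpen Ω) (hμ : Admissible Ω μ) (hG : Admissible Ω G)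
    (heq : ∀ p ∈ Ω, ∀ w ∈ spec, w.2.im ≠ 0 → μ p w = 1 + κ.op μ p w.2)
    (huniq : ∀ F, Admissible Ω F → ∀ p ∈ Ω,
      (∀ w ∈ spec, w.2.im ≠ 0 → F p w = κ.op F p w.2) → ∀ w ∈ spec, F p w = 0)
    (hind : ∀ φ, IsTest Ω ⊤ φ → ∀ w ∈ spec, w.2.im ≠ 0 → ∀ w' ∈ spec, w'.2.im ≠ 0 →
      ∫ p, φ p * (G p w - κ.op G p w.2) = ∫ p, φ p * (G p w' - κ.op G p w'.2)) :
    ∃ W : ST → ℂ, ContinuousOn W Ω ∧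
      (∀ p ∈ Ω, ∀ w ∈ spec, w.2.im ≠ 0 → G p w - κ.op G p w.2 = W p) ∧
      ∀ p ∈ Ω, ∀ w ∈ spec, G p w = W p * μ p w := by
  have hwI : ((true, Complex.I) : Bool × ℂ) ∈ spec := ⟨fun _ => by simp, by simp⟩
  have hI : (Complex.I).im ≠ 0 := by simp
  have hcont : ∀ w ∈ spec, w.2.im ≠ 0 → ContinuousOn (fun p => G p w - κ.op G p w.2) Ω :=
    fun w hw hk => (hG.continuousOn_left hw).sub (κ.continuousOn_op hΩ hG hk)
  have hWc := hcont _ hwI hI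
  have hW : ∀ p ∈ Ω, ∀ w ∈ spec, w.2.im ≠ 0 →
      G p w - κ.op G p w.2 = G p (true, Complex.I) - κ.op G p Complex.I := fun p hp w hw hk =>
    eqOn_of_forall_integral_eq hΩ (hcont w hw hk) hWc
      (fun φ hφ => hind φ hφ w hw hk _ hwI hI) hp
  -- The common value of `G - K G` is read off at `k = i`; any nonreal point would do.
  refine ⟨fun p => G p (true, Complex.I) - κ.op G p Complex.I, hWc, hW, fun p hp w hw => ?_⟩
  have hWμ := hμ.mul_left hWc
  -- As `W` does not involve `k`, `K (W μ) = W (μ - 1)`, while `K G = G - W`. Hence `G - W μ`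
  -- satisfies the homogeneous equation.
  refine sub_eq_zero.1 (huniq _ (hG.sub hWμ) p hp (fun w hw hk => ?_) w hw)
  rw [κ.op_sub hΩ hG hWμ hp hk, κ.op_mul_left (f := μ)]
  have e1 := hW p hp w hw hk
  have e2 := heq p hp w hw hk
  simp only at e1 ⊢
  rw [e2]
  linear_combination e1

lemma isTest_zero : IsTest Ω 0 (fun _ => 0) :=
  ⟨contDiff_const, HasCompactSupport.zero, by simp [tsupport]⟩

lemma contDiffOn_wave (h : RegularFamily Ω μ q) (z : Z) :
    ContDiffOn ℝ (5 : ℕ∞) (κ.wave μ z) Ω :=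
  (contDiff_expE _ _).contDiffOn.mul (h.smooth _ (κ.mem_spec z))

lemma integral_congr_on_tsupport {φ F G : ST → ℂ} (hφ : tsupport φ ⊆ Ω) (h : EqOn F G Ω) :
    ∫ p, φ p * F p = ∫ p, φ p * G p := by
  refine integral_congr_ae (ae_of_all _ fun p => ?_)
  by_cases hp : p ∈ tsupport φ
  · simp only [h (hφ hp)]
  · simp only [image_eq_zero_of_notMem_tsupport hp, zero_mul]

/-- The dressing identity for `∂_y - ∂_x² - 2ik∂_x`. -/
lemma dressing_laxY (hΩ : IsOpen Ω) (h : RegularFamily Ω μ q)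
    (heq : ∀ p ∈ Ω, ∀ w ∈ spec, w.2.im ≠ 0 → μ p w = 1 + κ.op μ p w.2)
    {φ : ST → ℂ} (hφ : IsTest Ω ⊤ φ) {w : Bool × ℂ} (hw : w ∈ spec) (hk : w.2.im ≠ 0) :
    Integrable (fun z => κ.c z * ∫ p, 2 * Complex.I * pd ex φ p * κ.wave μ z p) κ.m ∧
    ∫ p, φ p * (laxY w.2 (fun p => μ p w) p
        - κ.op (fun p w => laxY w.2 (fun p => μ p w) p) p w.2)
      = - ∫ z, κ.c z * (∫ p, 2 * Complex.I * pd ex φ p * κ.wave μ z p) ∂κ.m := by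
  have t2 : IsTest Ω 2 φ := hφ.of_le le_top
  have tx : IsTest Ω 1 (pd ex φ) := t2.pd ex (by norm_num)
  have ty : IsTest Ω 1 (pd ey φ) := t2.pd ey (by norm_num)
  have txx : IsTest Ω 0 (pd ex (pd ex φ)) := tx.pd ex (by norm_num)
  have ha : IsTest Ω 0 (fun p => -pd ey φ p - pd ex (pd ex φ) p) :=
    ((ty.of_le (by norm_num)).neg hΩ).sub txx hΩ
  have hb : IsTest Ω 0 (fun p => 2 * Complex.I * pd ex φ p) :=
    (tx.of_le (by norm_num)).const_mul hΩ _
  have key := κ.integral_mul_sub_op hΩ (h.admissible hΩ) (h.admissible_laxY hΩ) heq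
    (hφ.of_le le_top) ha hb isTest_zero
    (fun w hw => by
      simp only [mul_zero, add_zero]
      exact integral_mul_laxY w.2 hΩ ((h.smooth w hw).of_le
        (by exact_mod_cast (by norm_num : (2 : ℕ∞) ≤ 5))) t2)
    (fun z => by
      simp only [mul_zero, add_zero]
      have hs := h.smooth _ (κ.mem_spec z)
      rw [← integral_mul_laxY (κ.ν z) hΩ ((contDiffOn_wave h z).of_le
        (by exact_mod_cast (by norm_num : (2 : ℕ∞) ≤ 5))) t2]
      exact integral_congr_on_tsupport hφ.subset fun p hp =>
        (laxY_expE_mul (κ.ν z) (κ.l z) hΩ (hs.of_le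
          (by exact_mod_cast (by norm_num : (2 : ℕ∞) ≤ 5))) hp).symm) hw hk
  -- The polynomial part in `k` consists of integrals of derivatives of test functions and drops
  -- out; the remaining term does not contain `k`, since there is no quadratic coefficient.
  have i1 : ∫ p, (-pd ey φ p - pd ex (pd ex φ) p) = 0 := by
    have i0 : Integrable (fun p => -pd ey φ p) := ty.integrable.neg
    rw [integral_sub i0 txx.integrable, integral_neg, t2.integral_pd hΩ (by norm_num), tx.integral_pd hΩ le_rfl]
    simp
  have i2 : ∫ p, 2 * Complex.I * pd ex φ p = 0 := by
    rw [integral_const_mul, t2.integral_pd hΩ (by norm_num), mul_zero]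
  simp only [zero_mul, integral_zero, mul_zero, add_zero, i1, i2, zero_sub] at key
  exact key

/-- The dressing identity for `∂_t + 4∂_x³ + 12ik∂_x² - 12k²∂_x + 6q(∂_x + ik)`: by the identity
for `laxY`, the terms which depend on `k` cancel. -/
lemma dressing_laxT (hΩ : IsOpen Ω) (h : RegularFamily Ω μ q) (hq : ContDiffOn ℝ (3 : ℕ∞) q Ω)
    (heq : ∀ p ∈ Ω, ∀ w ∈ spec, w.2.im ≠ 0 → μ p w = 1 + κ.op μ p w.2)
    (hY : ∀ p ∈ Ω, ∀ w ∈ spec, w.2.im ≠ 0 → laxY w.2 (fun p => μ p w) p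
        - κ.op (fun p w => laxY w.2 (fun p => μ p w) p) p w.2 = q p)
    {φ : ST → ℂ} (hφ : IsTest Ω ⊤ φ) {w w' : Bool × ℂ} (hw : w ∈ spec) (hk : w.2.im ≠ 0)
    (hw' : w' ∈ spec) (hk' : w'.2.im ≠ 0) :
    ∫ p, φ p * (laxT q w.2 (fun p => μ p w) p
        - κ.op (fun p w => laxT q w.2 (fun p => μ p w) p) p w.2)
      = ∫ p, φ p * (laxT q w'.2 (fun p => μ p w') p
        - κ.op (fun p w => laxT q w.2 (fun p => μ p w) p) p w'.2) := by
  have t3 : IsTest Ω 3 φ := hφ.of_le le_top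
  have tx : IsTest Ω 2 (pd ex φ) := t3.pd ex (by norm_num)
  have tt : IsTest Ω 0 (pd et φ) := t3.pd et (by norm_num)
  have txx : IsTest Ω 1 (pd ex (pd ex φ)) := tx.pd ex (by norm_num)
  have txxx : IsTest Ω 0 (pd ex (pd ex (pd ex φ))) := txx.pd ex (by norm_num)
  have tq : IsTest Ω 1 (fun p => q p * φ p) :=
    (t3.of_le (by norm_num)).mul_left hΩ (hq.of_le (by norm_num))
  have tqx := tq.pd ex (m := 0) (by norm_num)
  have ha : IsTest Ω 0 (fun p => -pd et φ p - 4 * pd ex (pd ex (pd ex φ)) p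
      - 6 * pd ex (fun z => q z * φ z) p) :=
    ((tt.neg hΩ).sub (txxx.const_mul hΩ 4) hΩ).sub (tqx.const_mul hΩ 6) hΩ
  have hb : IsTest Ω 0 (fun p => 12 * Complex.I * pd ex (pd ex φ) p
      + 6 * Complex.I * (q p * φ p)) :=
    ((txx.of_le (by norm_num)).const_mul hΩ _).add ((tq.of_le (by norm_num)).const_mul hΩ _)
  have hd : IsTest Ω 0 (fun p => 12 * pd ex φ p) := (tx.of_le (by norm_num)).const_mul hΩ _
  have l3 : ((3 : ℕ∞) : WithTop ℕ∞) ≤ (5 : ℕ∞) := by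
    exact_mod_cast (by norm_num : (3 : ℕ∞) ≤ 5)
  have hq1 : ContDiffOn ℝ (1 : ℕ∞) q Ω := hq.of_le (by norm_num)
  have key : ∀ w ∈ spec, w.2.im ≠ 0 → _ := fun w hw hk =>
    κ.integral_mul_sub_op hΩ (h.admissible hΩ) (h.admissible_laxT hΩ hq.continuousOn) heq
      (hφ.of_le le_top) ha hb hd
      (fun w hw => integral_mul_laxT w.2 hΩ ((h.smooth w hw).of_le l3) hq1 t3)
      (fun z => by
        rw [← integral_mul_laxT (κ.ν z) hΩ ((contDiffOn_wave h z).of_le l3) hq1 t3]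
        exact integral_congr_on_tsupport hφ.subset fun p hp =>
          (laxT_expE_mul (κ.ν z) (κ.l z) hΩ ((h.smooth _ (κ.mem_spec z)).of_le l3) hp).symm) hw hk
  -- Of the polynomial part, `6ik ∫ φ q` is the only surviving `k`-dependent term. It has to be
  -- matched by the `k`-dependence of the spectral integral.
  have ib : ∫ p, (12 * Complex.I * pd ex (pd ex φ) p + 6 * Complex.I * (q p * φ p))
      = 6 * Complex.I * ∫ p, φ p * q p := by
    have j1 : Integrable (fun p => 12 * Complex.I * pd ex (pd ex φ) p) :=
      txx.integrable.const_mul _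
    have j2 : Integrable (fun p => 6 * Complex.I * (q p * φ p)) := tq.integrable.const_mul _
    rw [integral_add j1 j2, integral_const_mul, integral_const_mul,
      tx.integral_pd hΩ (by norm_num), mul_zero, zero_add]
    simp only [mul_comm (q _)]
  have id : ∫ p, 12 * pd ex φ p = 0 := by
    rw [integral_const_mul, t3.integral_pd hΩ (by norm_num), mul_zero]
  obtain ⟨iY, eY⟩ := dressing_laxY hΩ h heq hφ hw hk
  have eq' : ∫ p, φ p * q p
      = - ∫ z, κ.c z * (∫ p, 2 * Complex.I * pd ex φ p * κ.wave μ z p) ∂κ.m := by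
    rw [← eY]
    exact integral_congr_on_tsupport hφ.subset fun p hp => (hY p hp w hw hk).symm
  obtain ⟨i₁, e₁⟩ := key w hw hk
  obtain ⟨i₂, e₂⟩ := key w' hw' hk'
  -- Two values of `k` are compared, because only the full integrand is known to be integrable, not
  -- its part containing `ν`; in the difference that part disappears.
  have hdiff : (∫ z, κ.c z * ((∫ p, (12 * Complex.I * pd ex (pd ex φ) p
        + 6 * Complex.I * (q p * φ p)) * κ.wave μ z p)
        + (κ.ν z + w.2) * ∫ p, 12 * pd ex φ p * κ.wave μ z p) ∂κ.m)
      - (∫ z, κ.c z * ((∫ p, (12 * Complex.I * pd ex (pd ex φ) p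
        + 6 * Complex.I * (q p * φ p)) * κ.wave μ z p)
        + (κ.ν z + w'.2) * ∫ p, 12 * pd ex φ p * κ.wave μ z p) ∂κ.m)
      = (w.2 - w'.2) * (6 * Complex.I * ∫ p, φ p * q p) := by
    rw [← integral_sub i₁ i₂, eq']
    -- Since `12 = -6i · 2i`, the coefficient of `k` is a multiple of the spectral integral which
    -- `dressing_laxY` identifies with `-∫ φ q`.
    have : ∀ z, (∫ p, 12 * pd ex φ p * κ.wave μ z p)
        = -6 * Complex.I * ∫ p, 2 * Complex.I * pd ex φ p * κ.wave μ z p := by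
      intro z
      rw [← integral_const_mul]
      refine integral_congr_ae (ae_of_all _ fun p => ?_)
      linear_combination (12 * pd ex φ p * κ.wave μ z p) * Complex.I_sq
    simp only [this]
    have r : (w.2 - w'.2) * (6 * Complex.I
          * -∫ z, κ.c z * (∫ p, 2 * Complex.I * pd ex φ p * κ.wave μ z p) ∂κ.m)
        = ∫ z, (-6 * Complex.I * (w.2 - w'.2))
          * (κ.c z * ∫ p, 2 * Complex.I * pd ex φ p * κ.wave μ z p) ∂κ.m := by
      rw [integral_const_mul]
      ring
    rw [r]
    refine integral_congr_ae (ae_of_all _ fun z => ?_)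
    simp only
    ring
  rw [e₁, e₂, ib, id]
  linear_combination (-1 : ℂ) * hdiff

end dressing

/-! ### Identification of the potential -/

section potential

variable {Ω : Set ST} {μ : ST → Bool × ℂ → ℂ} {q Q : ST → ℂ}

/-- The points `in` of the upper half-plane. -/
def imagPt (n : ℕ) : Bool × ℂ := (true, n * Complex.I)

lemma imagPt_mem (n : ℕ) : imagPt n ∈ spec := ⟨fun _ => by simp [imagPt], by simp [imagPt]⟩

lemma norm_imagPt (n : ℕ) : ‖(imagPt n).2‖ = n := by simp [imagPt]

/-- If `∂_yμ - ∂_x²μ - 2ik∂_xμ = Qμ`, then `Q` is the potential `q`. -/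
theorem eq_potential (hΩ : IsOpen Ω) (h : RegularFamily Ω μ q) (hQc : ContinuousOn Q Ω)
    (hQ : ∀ p ∈ Ω, ∀ w ∈ spec, laxY w.2 (fun p => μ p w) p = Q p * μ p w) : EqOn Q q Ω := by
  rintro ⟨x, y, t⟩ hp
  have hcont : Continuous (fun s : ℝ => ((x, s, t) : ST)) := by fun_prop
  have hnh : (fun s : ℝ => ((x, s, t) : ST)) ⁻¹' Ω ∈ 𝓝 y :=
    hcont.continuousAt.preimage_mem_nhds (hΩ.mem_nhds hp)
  obtain ⟨δ, hδ, hball⟩ := Metric.nhds_basis_closedBall.mem_iff.1 hnh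
  have hKc : IsCompact ((fun s : ℝ => ((x, s, t) : ST)) '' Metric.closedBall y δ) :=
    (isCompact_closedBall y δ).image hcont
  have hKΩ : (fun s : ℝ => ((x, s, t) : ST)) '' Metric.closedBall y δ ⊆ Ω := image_subset_iff.2 hball
  obtain ⟨C, hC⟩ := h.bounds _ hKΩ hKc
  obtain ⟨B, hB⟩ := hKc.exists_bound_of_continuousOn (hQc.mono hKΩ)
  have hmem : ∀ s ∈ Metric.ball y δ,
      ((x, s, t) : ST) ∈ (fun s : ℝ => ((x, s, t) : ST)) '' Metric.closedBall y δ :=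
    fun s hs => ⟨s, Metric.ball_subset_closedBall hs, rfl⟩
  have hlim (A : ℝ) : Tendsto (fun n : ℕ => A / (1 + (n : ℝ))) atTop (𝓝 0) :=
    tendsto_const_nhds.div_atTop (tendsto_atTop_add_const_left _ _ tendsto_natCast_atTop_atTop)
  have hbd : ∀ (n : ℕ) (p : ST), p ∈ (fun s : ℝ => ((x, s, t) : ST)) '' Metric.closedBall y δ →
      ‖μ p (imagPt n) - 1‖ ≤ C / (1 + n) ∧
      ‖(imagPt n).2 * pd ex (fun p => μ p (imagPt n)) p - Complex.I / 2 * q p‖ ≤ C / (1 + n) ∧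
      ‖pd ex (pd ex (fun p => μ p (imagPt n))) p‖ ≤ C / (1 + n) := by
    intro n p hp
    obtain ⟨h1, h2, h3, -⟩ := hC p hp _ (imagPt_mem n)
    rw [norm_imagPt] at h1 h2 h3
    have hn : (0 : ℝ) < 1 + n := by positivity
    refine ⟨?_, ?_, ?_⟩ <;> rw [le_div_iff₀ hn] <;> linarith
  -- The hypotheses give `μ → 1` but no limit for `μ_y`. The equation shows that `μ_y → Q - q`
  -- locally uniformly in `y`; hence `Q - q` is the `y`-derivative of the limit function `1`.
  have hder : HasDerivAt (fun _ : ℝ => (1 : ℂ)) (Q (x, y, t) - q (x, y, t)) y := by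
    refine hasDerivAt_of_tendstoUniformlyOn (l := atTop) (s := Metric.ball y δ)
      (f := fun (n : ℕ) s => μ (x, s, t) (imagPt n))
      (f' := fun n s => pd ey (fun p => μ p (imagPt n)) (x, s, t))
      (g' := fun s => Q (x, s, t) - q (x, s, t))
      Metric.isOpen_ball ?_ ?_ ?_ (Metric.mem_ball_self hδ)
    · rw [Metric.tendstoUniformlyOn_iff]
      intro ε hε
      filter_upwards [(hlim ((|B| + 3) * C)).eventually (gt_mem_nhds hε)] with n hn s hs
      have hm := hmem s hs
      obtain ⟨h1, h2, h3⟩ := hbd n _ hm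
      have hQp := hQ _ (hKΩ hm) _ (imagPt_mem n)
      have hBp := hB _ hm
      rw [dist_comm, dist_eq_norm]
      have e : pd ey (fun p => μ p (imagPt n)) (x, s, t) - (Q (x, s, t) - q (x, s, t))
          = Q (x, s, t) * (μ (x, s, t) (imagPt n) - 1)
            + pd ex (pd ex (fun p => μ p (imagPt n))) (x, s, t)
            + 2 * Complex.I * ((imagPt n).2 * pd ex (fun p => μ p (imagPt n)) (x, s, t)
              - Complex.I / 2 * q (x, s, t)) := by
        rw [laxY] at hQp
        linear_combination hQp + q (x, s, t) * Complex.I_sq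
      have n1 : ‖Q (x, s, t) * (μ (x, s, t) (imagPt n) - 1)‖ ≤ |B| * (C / (1 + n)) := by
        rw [norm_mul]
        exact mul_le_mul (hBp.trans (le_abs_self B)) h1 (norm_nonneg _) (abs_nonneg B)
      have n2 : ‖2 * Complex.I * ((imagPt n).2 * pd ex (fun p => μ p (imagPt n)) (x, s, t)
              - Complex.I / 2 * q (x, s, t))‖ ≤ 2 * (C / (1 + n)) := by
        rw [norm_mul]
        simp only [norm_mul _ Complex.I, Complex.norm_I, Complex.norm_ofNat, mul_one]
        linarith
      rw [e]
      calc _ ≤ |B| * (C / (1 + n)) + C / (1 + n) + 2 * (C / (1 + n)) :=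
            (norm_add_le _ _).trans (add_le_add ((norm_add_le _ _).trans (add_le_add n1 h3)) n2)
        _ = (|B| + 3) * C / (1 + n) := by ring
        _ < ε := hn
    · refine Eventually.of_forall fun n s hs => ?_
      exact hasDerivAt_slice_y (p := (x, s, t)) (differentiableAt_of_contDiffOn
        (h.smooth _ (imagPt_mem n)) hΩ (by norm_num) (hKΩ (hmem s hs)))
    · intro s hs
      rw [tendsto_iff_norm_sub_tendsto_zero]
      exact squeeze_zero (fun _ => norm_nonneg _) (fun n => (hbd n _ (hmem s hs)).1) (hlim C)
  exact (sub_eq_zero.1 (hder.unique (hasDerivAt_const y (1 : ℂ))))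

/-- If `A (∂_xμ + ikμ) + B μ = 0` for all `k`, then `A = B = 0`. -/
lemma coefficients_eq_zero (h : RegularFamily Ω μ q) {p : ST} (hp : p ∈ Ω) {A B : ℂ}
    (hAB : ∀ w ∈ spec, A * (pd ex (fun p => μ p w) p + Complex.I * w.2 * μ p w)
      + B * μ p w = 0) : A = 0 ∧ B = 0 := by
  obtain ⟨C, hC⟩ := h.bounds {p} (singleton_subset_iff.2 hp) isCompact_singleton
  have hlim (A : ℝ) : Tendsto (fun n : ℕ => A / (1 + (n : ℝ))) atTop (𝓝 0) :=
    tendsto_const_nhds.div_atTop (tendsto_atTop_add_const_left _ _ tendsto_natCast_atTop_atTop)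
  have hbd : ∀ n : ℕ, ‖μ p (imagPt n) - 1‖ ≤ C / (1 + n) ∧
      ‖(imagPt n).2 * pd ex (fun p => μ p (imagPt n)) p - Complex.I / 2 * q p‖
        ≤ C / (1 + n) := by
    intro n
    obtain ⟨h1, h2, -⟩ := hC p rfl _ (imagPt_mem n)
    rw [norm_imagPt] at h1 h2
    have hn : (0 : ℝ) < 1 + n := by positivity
    refine ⟨?_, ?_⟩ <;> rw [le_div_iff₀ hn] <;> linarith
  have l1 : Tendsto (fun n => μ p (imagPt n)) atTop (𝓝 1) := by
    rw [tendsto_iff_norm_sub_tendsto_zero]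
    exact squeeze_zero (fun _ => norm_nonneg _) (fun n => (hbd n).1) (hlim C)
  have l2 : Tendsto (fun n => (imagPt n).2 * pd ex (fun p => μ p (imagPt n)) p) atTop
      (𝓝 (Complex.I / 2 * q p)) := by
    rw [tendsto_iff_norm_sub_tendsto_zero]
    exact squeeze_zero (fun _ => norm_nonneg _) (fun n => (hbd n).2) (hlim C)
  have l3 : Tendsto (fun n => ((imagPt n).2)⁻¹) atTop (𝓝 0) := by
    rw [tendsto_zero_iff_norm_tendsto_zero]
    simp only [norm_inv, norm_imagPt]
    exact tendsto_inv_atTop_nhds_zero_nat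
  -- The relation divided by `k = in`: in the limit only `iA` remains.
  have l4 : Tendsto (fun n => A * (((imagPt n).2 * pd ex (fun p => μ p (imagPt n)) p)
      * ((imagPt n).2)⁻¹ ^ 2 + Complex.I * μ p (imagPt n)) + B * μ p (imagPt n)
      * ((imagPt n).2)⁻¹) atTop
      (𝓝 (A * (Complex.I / 2 * q p * 0 ^ 2 + Complex.I * 1) + B * 1 * 0)) :=
    (((l2.mul (l3.pow 2)).add (l1.const_mul _)).const_mul A).add ((l1.const_mul B).mul l3)
  have l5 : A * (Complex.I / 2 * q p * 0 ^ 2 + Complex.I * 1) + B * 1 * 0 = 0 := by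
    refine tendsto_nhds_unique l4 (tendsto_const_nhds.congr' ?_)
    filter_upwards [eventually_ge_atTop 1] with n hn
    have hne : (imagPt n).2 ≠ 0 := by
      rw [← norm_pos_iff, norm_imagPt]
      exact_mod_cast hn
    have := hAB _ (imagPt_mem n)
    field_simp
    linear_combination (-1 : ℂ) * this
  have hA : A = 0 := by simpa using l5
  refine ⟨hA, ?_⟩
  obtain ⟨w, hw, hne⟩ := h.exists_ne_zero hp
  have := hAB w hw
  rw [hA, zero_mul, zero_add] at this
  exact (mul_eq_zero.1 this).resolve_right hne

end potential

/-! ### The equation -/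

/-- The Lax pair satisfied by the family `μ`. -/
theorem exists_lax_pair {Ω : Set ST} {Z : Type*} [MeasurableSpace Z] {κ : Kernel Ω Z}
    {μ : ST → Bool × ℂ → ℂ} {q : ST → ℂ} (hΩ : IsOpen Ω) (h : RegularFamily Ω μ q)
    (heq : ∀ p ∈ Ω, ∀ w ∈ spec, w.2.im ≠ 0 → μ p w = 1 + κ.op μ p w.2)
    (huniq : ∀ F, Admissible Ω F → ∀ p ∈ Ω,
      (∀ w ∈ spec, w.2.im ≠ 0 → F p w = κ.op F p w.2) → ∀ w ∈ spec, F p w = 0) :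
    ContDiffOn ℝ (3 : ℕ∞) q Ω ∧ ∃ W : ST → ℂ, ContDiffOn ℝ (2 : ℕ∞) W Ω ∧
      ∀ p ∈ Ω, ∀ w ∈ spec, laxY w.2 (fun p => μ p w) p = q p * μ p w ∧
        laxT q w.2 (fun p => μ p w) p = W p * μ p w := by
  have smooth : ∀ w ∈ spec, ContDiffOn ℝ (4 : ℕ∞) (pd ex (fun p => μ p w)) Ω ∧
      ContDiffOn ℝ (4 : ℕ∞) (pd ey (fun p => μ p w)) Ω ∧
      ContDiffOn ℝ (4 : ℕ∞) (pd et (fun p => μ p w)) Ω ∧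
      ContDiffOn ℝ (3 : ℕ∞) (pd ex (pd ex (fun p => μ p w))) Ω ∧
      ContDiffOn ℝ (2 : ℕ∞) (pd ex (pd ex (pd ex (fun p => μ p w)))) Ω := by
    intro w hw
    have h1 : ContDiffOn ℝ (4 : ℕ∞) (pd ex (fun p => μ p w)) Ω :=
      contDiffOn_pd (h.smooth w hw) hΩ (by norm_num)
    have h2 : ContDiffOn ℝ (3 : ℕ∞) (pd ex (pd ex (fun p => μ p w))) Ω :=
      contDiffOn_pd h1 hΩ (by norm_num)
    exact ⟨h1, contDiffOn_pd (h.smooth w hw) hΩ (by norm_num),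
      contDiffOn_pd (h.smooth w hw) hΩ (by norm_num), h2, contDiffOn_pd h2 hΩ (by norm_num)⟩
  have l34 : ((3 : ℕ∞) : WithTop ℕ∞) ≤ (4 : ℕ∞) := by
    exact_mod_cast (by norm_num : (3 : ℕ∞) ≤ 4)
  have l24 : ((2 : ℕ∞) : WithTop ℕ∞) ≤ (4 : ℕ∞) := by
    exact_mod_cast (by norm_num : (2 : ℕ∞) ≤ 4)
  have l23 : ((2 : ℕ∞) : WithTop ℕ∞) ≤ (3 : ℕ∞) := by
    exact_mod_cast (by norm_num : (2 : ℕ∞) ≤ 3)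
  have l25 : ((2 : ℕ∞) : WithTop ℕ∞) ≤ (5 : ℕ∞) := by
    exact_mod_cast (by norm_num : (2 : ℕ∞) ≤ 5)
  obtain ⟨Q, hQc, hQop, hQ⟩ := exists_multiplier hΩ (h.admissible hΩ) (h.admissible_laxY hΩ) heq
    huniq (fun φ hφ w hw hk w' hw' hk' => by
      rw [(dressing_laxY hΩ h heq hφ hw hk).2, (dressing_laxY hΩ h heq hφ hw' hk').2])
  -- At first `q` is given only as a pointwise limit. Its regularity comes from `Q`, which is
  -- locally `laxY μ / μ` and loses two of the five derivatives of `μ`.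
  have hQq := eq_potential hΩ h hQc hQ
  have hQ3 : ContDiffOn ℝ (3 : ℕ∞) Q Ω := by
    refine h.contDiffOn_multiplier hΩ (G := fun p w => laxY w.2 (fun p => μ p w) p)
      (by norm_num) (fun w hw => ?_) hQ
    obtain ⟨h1, h2, -, h4, -⟩ := smooth w hw
    exact ((h2.of_le l34).sub h4).sub (contDiffOn_const.mul (h1.of_le l34))
  have hq3 : ContDiffOn ℝ (3 : ℕ∞) q Ω := hQ3.congr fun p hp => (hQq hp).symm
  obtain ⟨W, -, -, hW⟩ := exists_multiplier hΩ (h.admissible hΩ)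
    (h.admissible_laxT hΩ hq3.continuousOn) heq huniq (fun φ hφ w hw hk w' hw' hk' =>
      dressing_laxT hΩ h hq3 heq
        (fun p hp w hw hk => (hQop p hp w hw hk).trans (hQq hp)) hφ hw hk hw' hk')
  refine ⟨hq3, W, ?_, fun p hp w hw => ⟨?_, hW p hp w hw⟩⟩
  -- `W` is only `C²`, because `laxT` contains three `x`-derivatives.
  · refine h.contDiffOn_multiplier hΩ (G := fun p w => laxT q w.2 (fun p => μ p w) p)
      (by norm_num) (fun w hw => ?_) hW
    obtain ⟨h1, -, h3, h4, h5⟩ := smooth w hw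
    exact ((((h3.of_le l24).add (contDiffOn_const.mul h5)).add
      (contDiffOn_const.mul (h4.of_le l23))).sub (contDiffOn_const.mul (h1.of_le l24))).add
      ((contDiffOn_const.mul (hq3.of_le l23)).mul ((h1.of_le l24).add
        (contDiffOn_const.mul ((h.smooth w hw).of_le l25))))
  · rw [← hQq hp]
    exact hQ p hp w hw

/-- The compatibility conditions of the Lax pair. -/
theorem compatibility_conditions {Ω : Set ST} {μ : ST → Bool × ℂ → ℂ} {q W : ST → ℂ}
    (hΩ : IsOpen Ω) (h : RegularFamily Ω μ q) (hq : ContDiffOn ℝ (3 : ℕ∞) q Ω)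
    (hW : ContDiffOn ℝ (2 : ℕ∞) W Ω)
    (hlax : ∀ p ∈ Ω, ∀ w ∈ spec, laxY w.2 (fun p => μ p w) p = q p * μ p w ∧
        laxT q w.2 (fun p => μ p w) p = W p * μ p w) {p : ST} (hp : p ∈ Ω) :
    6 * pd ex (pd ex q) p + 2 * pd ex W p + 6 * pd ey q p = 0 ∧
    pd et q p + 4 * pd ex (pd ex (pd ex q)) p + 6 * q p * pd ex q p - pd ey W p
        + pd ex (pd ex W) p = 0 := by
  refine coefficients_eq_zero h hp fun w hw => ?_
  have hs := h.smooth w hw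
  have l3 : ((3 : ℕ∞) : WithTop ℕ∞) ≤ (5 : ℕ∞) := by
    exact_mod_cast (by norm_num : (3 : ℕ∞) ≤ 5)
  have l2 : ((2 : ℕ∞) : WithTop ℕ∞) ≤ (5 : ℕ∞) := by
    exact_mod_cast (by norm_num : (2 : ℕ∞) ≤ 5)
  have l1 : ((1 : ℕ∞) : WithTop ℕ∞) ≤ (5 : ℕ∞) := by
    exact_mod_cast (by norm_num : (1 : ℕ∞) ≤ 5)
  -- Multiplication by `E(0,k)` conjugates the operators at `k` to those at `0`, so the Lax pair for
  -- this function no longer contains the spectral parameter.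
  have hψ : ContDiffOn ℝ (5 : ℕ∞) (fun p => expE 0 w.2 p * μ p w) Ω :=
    (contDiff_expE _ _).contDiffOn.mul hs
  have key := lax_compatibility hΩ hψ hq hW
    (fun z hz => by
      have h1 := laxY_expE_mul 0 w.2 hΩ (hs.of_le l2) hz
      simp only [zero_add, (hlax z hz w hw).1] at h1
      rw [laxY] at h1
      linear_combination h1)
    (fun z hz => by
      have h1 := laxT_expE_mul (q := q) 0 w.2 hΩ (hs.of_le l3) hz
      simp only [zero_add, (hlax z hz w hw).2] at h1
      rw [laxT] at h1
      linear_combination h1) hp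
  rw [pd_ex_expE_mul 0 w.2 hΩ (hs.of_le l1) hp] at key
  have hne : expE 0 w.2 p ≠ 0 := Complex.exp_ne_zero _
  refine (mul_eq_zero.1 (?_ : expE 0 w.2 p * _ = 0)).resolve_left hne
  linear_combination key

/-- Elimination of `W` from the compatibility conditions. -/
theorem solvesKPII_of_conditions {T : ℝ} {q : ℝ → ℝ → ℝ → ℂ} {W : ST → ℂ}
    (hq : ContDiffOn ℝ (3 : ℕ∞) (fun p : ST => q p.1 p.2.1 p.2.2) (region T))
    (hW : ContDiffOn ℝ (2 : ℕ∞) W (region T)) (hdecay : DecaysLeft T q)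
    (hA : ∀ p ∈ region T, 6 * pd ex (pd ex (fun p : ST => q p.1 p.2.1 p.2.2)) p
      + 2 * pd ex W p + 6 * pd ey (fun p : ST => q p.1 p.2.1 p.2.2) p = 0)
    (hB : ∀ p ∈ region T, pd et (fun p : ST => q p.1 p.2.1 p.2.2) p
      + 4 * pd ex (pd ex (pd ex (fun p : ST => q p.1 p.2.1 p.2.2))) p
      + 6 * q p.1 p.2.1 p.2.2 * pd ex (fun p : ST => q p.1 p.2.1 p.2.2) p - pd ey W p
      + pd ex (pd ex W) p = 0) : SolvesKPII T q := by
  refine ⟨hq, fun x y t hy ht htT => ?_⟩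
  set f : ST → ℂ := fun p => q p.1 p.2.1 p.2.2 with hf
  have hΩ := isOpen_region T
  have cx : ContDiffOn ℝ (2 : ℕ∞) (pd ex f) (region T) := contDiffOn_pd hq hΩ (by norm_num)
  have cy : ContDiffOn ℝ (2 : ℕ∞) (pd ey f) (region T) := contDiffOn_pd hq hΩ (by norm_num)
  have cxx : ContDiffOn ℝ (1 : ℕ∞) (pd ex (pd ex f)) (region T) := contDiffOn_pd cx hΩ (by norm_num)
  have cxy : ContDiffOn ℝ (1 : ℕ∞) (pd ex (pd ey f)) (region T) := contDiffOn_pd cy hΩ (by norm_num)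
  have cyy : ContDiffOn ℝ (1 : ℕ∞) (pd ey (pd ey f)) (region T) := contDiffOn_pd cy hΩ (by norm_num)
  have cWy : ContDiffOn ℝ (1 : ℕ∞) (pd ey W) (region T) := contDiffOn_pd hW hΩ (by norm_num)
  -- Only derivatives of `W` occur in the two conditions, and this relation determines `W_xx`; the
  -- remaining `W_y` is absorbed into `V`.
  have hWx : EqOn (pd ex W) (fun p => -3 * pd ex (pd ex f) p + -3 * pd ey f p) (region T) :=
    fun p hp => by linear_combination (1 / 2 : ℂ) * hA p hp
  have d {g : ST → ℂ} (hg : ContDiffOn ℝ (1 : ℕ∞) g (region T)) (v : ST) :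
      ∀ p ∈ region T, HasPd v g p (pd v g p) := fun p hp =>
    .of_differentiableAt (differentiableAt_of_contDiffOn hg hΩ le_rfl hp)
  have l12 : ((1 : ℕ∞) : WithTop ℕ∞) ≤ (2 : ℕ∞) := by norm_num
  have hWv (v : ST) : EqOn (pd v (pd ex W))
      (fun p => -3 * pd v (pd ex (pd ex f)) p + -3 * pd v (pd ey f) p) (region T) := fun p hp => by
    rw [pd_congr hΩ hWx hp]
    exact (((d cxx v p hp).const_mul _).add ((d (cy.of_le l12) v p hp).const_mul _)).2
  -- This is what the second condition contains besides `q_t + 6qq_x + q_xxx`, after `W_xx` is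
  -- replaced by `-3q_xxx - 3q_xy`. Its `x`-derivative is `3q_yy`, because the terms `q_xxy` cancel.
  set V : ST → ℂ := fun p => -1 * pd ey W p + -3 * pd ex (pd ey f) p with hV
  have hVx : ∀ p ∈ region T, HasPd ex V p (3 * pd ey (pd ey f) p) := by
    intro p hp
    have e1 := (((d cWy ex p hp).const_mul (-1)).add ((d cxy ex p hp).const_mul (-3)))
    have e2 : pd ex (pd ey W) p = pd ey (pd ex W) p := pd_comm hW hΩ le_rfl hp
    have e3 : pd ey (pd ex (pd ex f)) p = pd ex (pd ex (pd ey f)) p := by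
      rw [pd_comm (v := ey) (w := ex) cx hΩ le_rfl hp,
        pd_congr hΩ (pd_comm (v := ey) (w := ex) hq hΩ (by norm_num)) hp]
    rw [e2, hWv ey hp] at e1
    simp only [e3] at e1
    convert e1 using 1
    ring
  have hVeq : ∀ p ∈ region T, pd et f p + 6 * f p * pd ex f p + pd ex (pd ex (pd ex f)) p + V p
      = 0 := by
    intro p hp
    have e1 := hB p hp
    rw [hWv ex hp] at e1
    simp only [hV]
    linear_combination e1
  have hmem : ∀ ξ : ℝ, ((ξ, y, t) : ST) ∈ region T := fun ξ => ⟨hy, ht, htT⟩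
  have hdf : ∀ ξ : ℝ, DifferentiableAt ℝ f (ξ, y, t) := fun ξ =>
    differentiableAt_of_contDiffOn hq hΩ (by norm_num) (hmem ξ)
  have ex1 : ∀ ξ, deriv (fun s => q s y t) ξ = pd ex f (ξ, y, t) := fun ξ =>
    (hasDerivAt_slice_x (p := (ξ, y, t)) (hdf ξ)).deriv
  have et1 : ∀ ξ, deriv (fun s => q ξ y s) t = pd et f (ξ, y, t) := fun ξ =>
    (hasDerivAt_slice_t (p := (ξ, y, t)) (hdf ξ)).deriv
  have ex3 : ∀ ξ, iteratedDeriv 3 (fun s => q s y t) ξ = pd ex (pd ex (pd ex f)) (ξ, y, t) :=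
    fun ξ => (iteratedDeriv_slice_x hq hy ht htT ξ).2
  have ey2 : ∀ ξ, iteratedDeriv 2 (fun s => q ξ s t) y = pd ey (pd ey f) (ξ, y, t) := by
    intro ξ
    have e1 : deriv (fun s => q ξ s t) =ᶠ[𝓝 y] fun s => pd ey f (ξ, s, t) := by
      filter_upwards [lt_mem_nhds hy] with s hs
      exact (hasDerivAt_slice_y (p := (ξ, s, t))
        (differentiableAt_of_contDiffOn hq hΩ (by norm_num) ⟨hs, ht, htT⟩)).deriv
    rw [iteratedDeriv_succ, iteratedDeriv_one, e1.deriv_eq]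
    exact (hasDerivAt_slice_y (p := (ξ, y, t))
      (differentiableAt_of_contDiffOn cy hΩ (by norm_num) (hmem ξ))).deriv
  -- By `hVeq`, `V` is a combination of quantities assumed to decay, so no decay of `W` is needed.
  -- This limit yields convergence of the improper integral and the value `V = 3 ∂ₓ⁻¹ q_yy`.
  have hVlim : Tendsto (fun ξ => V (ξ, y, t)) atBot (𝓝 0) := by
    obtain ⟨h1, h2, h3, h4⟩ := hdecay y t hy ht htT
    have := ((h4.add ((h1.const_mul 6).mul h2)).add h3).neg
    simp only [mul_zero, add_zero, neg_zero] at this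
    refine this.congr fun ξ => ?_
    rw [ex1, et1, ex3]
    linear_combination - hVeq _ (hmem ξ)
  refine ⟨V (x, y, t) / 3, ?_, ?_⟩
  · have hcont : Continuous (fun ξ : ℝ => pd ey (pd ey f) (ξ, y, t)) :=
      cyy.continuousOn.comp_continuous (by fun_prop) hmem
    have hint : ∀ X : ℝ, ∫ ξ in X..x, iteratedDeriv 2 (fun s => q ξ s t) y
        = (V (x, y, t) - V (X, y, t)) / 3 := by
      intro X
      simp only [ey2]
      have := intervalIntegral.integral_eq_sub_of_hasDerivAt (a := X) (b := x)
        (f := fun ξ => V (ξ, y, t)) (f' := fun ξ => 3 * pd ey (pd ey f) (ξ, y, t))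
        (fun ξ _ => by
          have h1 := hVx _ (hmem ξ)
          have h2 := hasDerivAt_slice_x (p := (ξ, y, t)) h1.1
          rw [h1.2] at h2
          exact h2)
        ((hcont.const_mul 3).intervalIntegrable _ _)
      rw [← this, intervalIntegral.integral_const_mul]
      ring
    rw [HasDxInv]
    simp only [hint]
    simpa using (tendsto_const_nhds.sub hVlim).div_const (3 : ℂ)
  · rw [ex1, et1, ex3]
    have := hVeq _ (hmem x)
    simp only [hf] at this ⊢
    linear_combination this

end KPII

end

/-! ### Conclusion: from the integral equation to KPII -/

theorem mainTheorem1 (T : ℝ) (hT : 0 < T)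
    (u : ℝ → ℝ → ℝ → ℂ) (q₀ g h : ℝ → ℝ → ℂ)
    (hu : KPII.SolvesIBVP T u q₀ g h)
    (ρp ρm φm : ℝ → ℝ → ℂ → ℂ)
    (hρp : KPII.IsRhoPlus q₀ ρp)
    (hρφm : KPII.IsRhoPhiMinus T q₀ g h ρm φm)
    (hGR : KPII.GlobalRelation T u q₀ g h ρm φm)
    (S : KPII.SpectralData)
    (hγp : ∀ k ∈ KPII.upperHalf, S.γp k = KPII.gammaPlus q₀ ρp k)
    (hγm : ∀ k ∈ KPII.lowerHalf, S.γm k = KPII.gammaMinus T q₀ g h ρm φm k)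
    (hχ : ∀ kR : ℝ, kR ≤ 0 →
      KPII.UniqueVolterra (KPII.rKer q₀ ρp) (KPII.pFun T g h φm) kR 0 (-2 * kR)
        (S.χ₂ kR) (S.χ₁ kR))
    (hψ : ∀ kR : ℝ, 0 ≤ kR →
      KPII.UniqueVolterra (KPII.rKer q₀ ρp) (KPII.pFun T g h φm) kR (-2 * kR) 0
        (S.ψ₂ kR) (S.ψ₁ kR))
    (hS : S.Decays)
    (μp μm : ℝ → ℝ → ℝ → ℂ → ℂ)
    (hμ : ∀ x y t : ℝ, 0 < y → 0 < t → t < T → KPII.UniquePompeiu S x y t (μp x y t) (μm x y t))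
    (q : ℝ → ℝ → ℝ → ℂ)
    (hq : KPII.IsPotential T μp μm q)
    (hμp_reg : KPII.RegularOn T KPII.upperHalf μp q)
    (hμm_reg : KPII.RegularOn T KPII.lowerHalf μm q)
    (hq_decay : KPII.DecaysLeft T q) :
    KPII.SolvesKPII T q := by
  have hΩ := KPII.isOpen_region T
  have hreg := KPII.regularFamily_joinHalves hμp_reg hμm_reg
  have hadm := hreg.admissible hΩ
  have heq : ∀ p ∈ KPII.region T, ∀ w ∈ KPII.spec, w.2.im ≠ 0 →
      KPII.joinHalves μp μm p w
        = 1 + (KPII.pompeiuKernel T S hS).op (KPII.joinHalves μp μm) p w.2 := by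
    rintro p hp ⟨b, k⟩ hw hk
    have hsol := (hμ p.1 p.2.1 p.2.2 hp.1 hp.2.1 hp.2.2).1
    rw [← KPII.pompeiuRHS_eq_op hS hadm hp hk]
    cases b
    · exact hsol.equation_lower k (lt_of_le_of_ne (hw.2 rfl) hk)
    · exact hsol.equation_upper k (lt_of_le_of_ne (hw.1 rfl) (Ne.symm hk))
  obtain ⟨hq3, W, hW, hlax⟩ := KPII.exists_lax_pair hΩ hreg heq
    (fun F hF p hp h w hw => KPII.eq_zero_of_eq_op hS hμ hadm hF hp h hw)
  have hcond := fun p (hp : p ∈ KPII.region T) =>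
    KPII.compatibility_conditions hΩ hreg hq3 hW hlax hp
  exact KPII.solvesKPII_of_conditions hq3 hW hq_decay (fun p hp => (hcond p hp).1)
    (fun p hp => (hcond p hp).2)
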